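/- An \emph{end sum pair} $(M,r)$ of dimension $n+1\ge 2$ consists of a smooth, connected, oriented, noncompact (Hausdorff, second countable) $(n+1)$-manifold $M$ with compact, possibly empty, boundary, and a smoothly embedded proper ray $r:[0,\infty)\to \operatorname{Int} M$. Let $(M,r)$ and $(N,s)$ be end sum pairs of the same dimension $n+1\ge 2$. Let $\nu r\subset\operatorname{Int}M$ and $\nu s\subset\operatorname{Int}N$ be smooth closed regular neighborhoods of $r$ and $s$; that is, $\nu r$ is the image of a smooth proper embedding of the closed half-space $\{x\in\mathbb{R}^{n+1} : x_0\ge 0\}$ into $\operatorname{Int}M$ carrying the ray $[1,\infty)\times\{0\}$ onto the image of $r$, and similarly for $\nu s$. Put $\widehat M=M-\operatorname{Int}\nu r$ and $\widehat N=N-\operatorname{Int}\nu s$, and let the \emph{end sum} $S=(M,r)\mathbin{\natural}(N,s)$ be obtained by gluing $\widehat M$ and $\widehat N$ along $\partial\nu r\approx\mathbb{R}^n$ and $\partial\nu s\approx\mathbb{R}^n$ by an orientation-reversing diffeomorphism $\partial\nu r\to\partial\nu s$, where boundaries are oriented as boundaries of $\widehat M$ and $\widehat N$ by the outward-normal-first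 convention. For a space $X$ with a compact exhaustion $K_1\subseteq K_2\subseteq\cdots$ (each $K_i$ compact, $K_i\subseteq\operatorname{int}K_{i+1}$, $\bigcup_i K_i=X$), an \emph{end} of $X$ is a sequence $V_1\supseteq V_2\supseteq\cdots$ where $V_i$ is a connected component of $X-K_i$ whose closure in $X$ is noncompact. Let $E(X)$ be the set of ends; for $M$, $N$ and $S$, any compact exhaustions may be used. Then $S$ admits a compact exhaustion and $$|E(S)|=|E(M)|+|E(N)|-1,$$ where infinite cardinalities are not distinguished. In particular, if $M$ and $N$ are one-ended, then $S$ is one-ended. -/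

import Mathlib

open scoped Manifold ContDiff

noncomputable section

namespace EndTheory

/-! ### Ends of a space -/

/-- `C` is a connected component of the subspace `A` of `X`, and it is unbounded:
its closure in `X` is not compact. -/
def IsUnboundedComponent {X : Type*} [TopologicalSpace X] (A C : Set X) : Prop :=
  (∃ x ∈ A, C = connectedComponentIn A x) ∧ ¬ IsCompact (closure C)

/-- The set of ends of `X` with respect to a compact exhaustion `K`: nested sequences
`V 0 ⊇ V 1 ⊇ V 2 ⊇ ⋯` where `V i` is an unbounded component of the complement of `K i`. -/
def Ends {X : Type*} [TopologicalSpace X] (K : CompactExhaustion X) : Type _ :=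
  {V : ℕ → Set X // (∀ i, IsUnboundedComponent (K i)ᶜ (V i)) ∧ ∀ i, V (i + 1) ⊆ V i}

/-- The number of ends of `X`, computed with a compact exhaustion `K`, as an extended natural
number (so all infinite cardinalities are the same value `⊤`). -/
def numEnds {X : Type*} [TopologicalSpace X] (K : CompactExhaustion X) : ℕ∞ :=
  ENat.card (Ends K)

/-! ### Orientations of smooth manifolds with boundary -/

/-- A choice of an orientation of every tangent space of an `m`-dimensional manifold is an
orientation of the manifold if it is locally constant in the local trivializations of the
tangent bundle that come from charts. -/
def IsManifoldOrientation (m : ℕ) [NeZero m] {M : Type*} [TopologicalSpace M]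
    [ChartedSpace (EuclideanHalfSpace m) M] [IsManifold (𝓡∂ m) ∞ M]
    (o : ∀ x : M, Orientation ℝ (TangentSpace (𝓡∂ m) x) (Fin m)) : Prop :=
  ∀ x : M, ∀ y : M, ∀ hy : y ∈ (trivializationAt (EuclideanSpace ℝ (Fin m))
      (TangentSpace (𝓡∂ m) : M → Type) x).baseSet, ∀ᶠ z in nhds y,
    ∀ hz : z ∈ (trivializationAt (EuclideanSpace ℝ (Fin m))
      (TangentSpace (𝓡∂ m) : M → Type) x).baseSet,
    Orientation.map (Fin m) ((trivializationAt (EuclideanSpace ℝ (Fin m))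
        (TangentSpace (𝓡∂ m) : M → Type) x).continuousLinearEquivAt ℝ z hz).toLinearEquiv (o z) =
      Orientation.map (Fin m) ((trivializationAt (EuclideanSpace ℝ (Fin m))
        (TangentSpace (𝓡∂ m) : M → Type) x).continuousLinearEquivAt ℝ y hy).toLinearEquiv (o y)

/-- The family `v` is a basis of `V` that is positively oriented for `o`. -/
def IsPositiveFrame {V ι : Type*} [AddCommGroup V] [Module ℝ V] [Fintype ι] [DecidableEq ι]
    (o : Orientation ℝ V ι) (v : ι → V) : Prop :=
  ∃ b : Module.Basis ι ℝ V, (∀ i, b i = v i) ∧ b.orientation = o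

/-! ### Smooth proper embeddings, rays, regular neighborhoods -/

/-- A smooth proper embedding of the closed half-space `{x ∈ ℝᵏ | 0 ≤ x 0}` into the manifold
interior of an `m`-dimensional manifold with boundary: a smooth, proper, injective immersion.
(A proper injective continuous map between these spaces is a closed topological embedding.) -/
structure IsSmoothProperEmbedding (k m : ℕ) [NeZero k] [NeZero m] {M : Type*} [TopologicalSpace M]
    [ChartedSpace (EuclideanHalfSpace m) M] (f : EuclideanHalfSpace k → M) : Prop where
  contMDiff : ContMDiff (𝓡∂ k) (𝓡∂ m) ∞ f
  isProperMap : IsProperMap f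
  injective : Function.Injective f
  mfderiv_injective : ∀ x, Function.Injective (mfderiv (𝓡∂ k) (𝓡∂ m) f x)
  mem_interior : ∀ x, f x ∈ (𝓡∂ m).interior M

/-- `(M, r)` is an end sum pair of dimension `n + 1`: `M` is a smooth (Hausdorff, second countable),
connected, noncompact manifold with compact, possibly empty boundary, oriented by `o`, and `r` is a
smoothly embedded proper ray in the interior of `M`. Here the half-line `[0, ∞)` is
`EuclideanHalfSpace 1`. -/
structure IsEndSumPair (n : ℕ) {M : Type*} [TopologicalSpace M]
    [ChartedSpace (EuclideanHalfSpace (n + 1)) M] [IsManifold (𝓡∂ (n + 1)) ∞ M]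
    (o : ∀ x : M, Orientation ℝ (TangentSpace (𝓡∂ (n + 1)) x) (Fin (n + 1)))
    (r : EuclideanHalfSpace 1 → M) : Prop where
  t2Space : T2Space M
  secondCountable : SecondCountableTopology M
  connected : ConnectedSpace M
  noncompact : NoncompactSpace M
  compact_boundary : IsCompact ((𝓡∂ (n + 1)).boundary M)
  oriented : IsManifoldOrientation (n + 1) o
  ray : IsSmoothProperEmbedding 1 (n + 1) r

/-- `Φ` parametrizes a smooth closed regular neighborhood `ν r = Set.range Φ` of the ray `r`
in the interior of `M`: it is a smooth proper embedding of the closed half-space of full dimension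
under which the straight ray `{(t, 0, …, 0) | 1 ≤ t}` corresponds to the image of `r`. -/
structure IsRegularNeighborhood (n : ℕ) {M : Type*} [TopologicalSpace M]
    [ChartedSpace (EuclideanHalfSpace (n + 1)) M] (r : EuclideanHalfSpace 1 → M)
    (Φ : EuclideanHalfSpace (n + 1) → M) : Prop where
  embedding : IsSmoothProperEmbedding (n + 1) (n + 1) Φ
  image_axis : Φ '' {x | 1 ≤ x.1 0 ∧ ∀ i : Fin n, x.1 i.succ = 0} = Set.range r

/-! ### The end sum -/

/-- The linear inclusion `y ↦ (0, y)` of `ℝⁿ` onto the boundary hyperplane of `ℝⁿ⁺¹`. -/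
def consZero (n : ℕ) (y : EuclideanSpace ℝ (Fin n)) : EuclideanSpace ℝ (Fin (n + 1)) :=
  WithLp.toLp 2 (Fin.cons 0 fun i => y i)

/-- The inclusion of `ℝⁿ` as the boundary of the closed half-space of dimension `n + 1`. -/
def bdry (n : ℕ) (y : EuclideanSpace ℝ (Fin n)) : EuclideanHalfSpace (n + 1) :=
  ⟨consZero n y, by simp [consZero]⟩

/-- The complement `M̂ = M - Int (ν r)` of the manifold interior of the regular neighborhood
parametrized by `Φ`. Its new boundary component `∂ (ν r)` is the image of `Φ ∘ bdry n`. -/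
def hat (n : ℕ) {M : Type*} (Φ : EuclideanHalfSpace (n + 1) → M) : Set M :=
  (Φ '' {x | 0 < x.1 0})ᶜ

/-- Elementary identifications: the point `Φ (0, y)` of `∂ (ν r) ⊆ M̂` is glued to the point
`Ψ (0, g y)` of `∂ (ν s) ⊆ N̂`. -/
def endSumRel (n : ℕ) {M N : Type*} (Φ : EuclideanHalfSpace (n + 1) → M)
    (Ψ : EuclideanHalfSpace (n + 1) → N)
    (g : EuclideanSpace ℝ (Fin n) → EuclideanSpace ℝ (Fin n))
    (a b : hat n Φ ⊕ hat n Ψ) : Prop :=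
  ∃ (y : EuclideanSpace ℝ (Fin n)) (p : hat n Φ) (q : hat n Ψ),
    p.1 = Φ (bdry n y) ∧ q.1 = Ψ (bdry n (g y)) ∧ a = Sum.inl p ∧ b = Sum.inr q

/-- The end sum as an adjunction space: `M̂` and `N̂` glued along `∂ (ν r)` and `∂ (ν s)` by the map
which is `g` in the parametrizations `Φ ∘ bdry n` and `Ψ ∘ bdry n` of these boundaries. -/
def EndSum (n : ℕ) {M N : Type*} (Φ : EuclideanHalfSpace (n + 1) → M)
    (Ψ : EuclideanHalfSpace (n + 1) → N)
    (g : EuclideanSpace ℝ (Fin n) → EuclideanSpace ℝ (Fin n)) : Type _ :=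
  Quot (endSumRel n Φ Ψ g)

/-- The end sum carries the quotient topology of the disjoint union. -/
instance (n : ℕ) {M N : Type*} [TopologicalSpace M] [TopologicalSpace N]
    (Φ : EuclideanHalfSpace (n + 1) → M) (Ψ : EuclideanHalfSpace (n + 1) → N)
    (g : EuclideanSpace ℝ (Fin n) → EuclideanSpace ℝ (Fin n)) :
    TopologicalSpace (EndSum n Φ Ψ g) :=
  inferInstanceAs (TopologicalSpace (Quot (endSumRel n Φ Ψ g)))

/-- The frame at the point `Φ (0, z)` of `∂ (ν r)`, in the tangent space of `M`, consisting of the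
outward normal vector of `M̂` (which is the inward normal vector `dΦ(e₀)` of `ν r`), followed by the
images under `d(Φ ∘ bdry n)` of the vectors `v i` of `ℝⁿ`. -/
def boundaryFrame (n : ℕ) {M : Type*} [TopologicalSpace M]
    [ChartedSpace (EuclideanHalfSpace (n + 1)) M] (Φ : EuclideanHalfSpace (n + 1) → M)
    (z : EuclideanSpace ℝ (Fin n)) (v : Fin n → EuclideanSpace ℝ (Fin n)) :
    Fin (n + 1) → TangentSpace (𝓡∂ (n + 1)) (Φ (bdry n z)) :=
  fun i => mfderiv (𝓡∂ (n + 1)) (𝓡∂ (n + 1)) Φ (bdry n z)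
    ((Fin.cons (EuclideanSpace.single 0 1) fun j => consZero n (v j) :
      Fin (n + 1) → EuclideanSpace ℝ (Fin (n + 1))) i)

/-- The gluing map `∂ (ν r) → ∂ (ν s)`, which is `g` in the parametrizations `Φ ∘ bdry n` and
`Ψ ∘ bdry n`, reverses the boundary orientations, taken as boundary of `M̂` and of `N̂` with
the outward normal vector first: it sends positive frames to negative frames and conversely. -/
def ReversesOrientation (n : ℕ) {M N : Type*} [TopologicalSpace M]
    [ChartedSpace (EuclideanHalfSpace (n + 1)) M] [TopologicalSpace N]
    [ChartedSpace (EuclideanHalfSpace (n + 1)) N]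
    (oM : ∀ x : M, Orientation ℝ (TangentSpace (𝓡∂ (n + 1)) x) (Fin (n + 1)))
    (oN : ∀ x : N, Orientation ℝ (TangentSpace (𝓡∂ (n + 1)) x) (Fin (n + 1)))
    (Φ : EuclideanHalfSpace (n + 1) → M) (Ψ : EuclideanHalfSpace (n + 1) → N)
    (g : EuclideanSpace ℝ (Fin n) → EuclideanSpace ℝ (Fin n)) : Prop :=
  ∀ (y : EuclideanSpace ℝ (Fin n)) (v : Fin n → EuclideanSpace ℝ (Fin n)),
    IsPositiveFrame (oM (Φ (bdry n y))) (boundaryFrame n Φ y v) ↔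
      IsPositiveFrame (-(oN (Ψ (bdry n (g y)))))
        (boundaryFrame n Ψ (g y) fun j => fderiv ℝ g y (v j))

end EndTheory

end

noncomputable section
namespace EndTheory

open Set Topology

/-! ### The number of ends as a supremum over compact sets -/

section Counting

variable {X : Type*} [TopologicalSpace X]

/-! The ends form an inverse limit of finite sets, the unbounded components of complements of
compact sets, with surjective bonding maps. Their number is therefore the supremum of the
cardinalities of these sets, taken over all compact sets (`numEnds_eq_iSup_compacts`), and it
suffices to compare component counts on cofinally many compact sets of `M`, `N` and `S`.

Call the common boundary of the two regular neighborhoods, a copy of ℝⁿ in `S`, the seam. Choose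
large compact sets `K` in `M` and `L` in `N` that meet the neighborhoods in cylinders with the same
trace on the seam, a ball. The neighborhood minus `K` is connected, so replacing `M` by its hat does
not change the count (`IsSplitBy.encard_unboundedComponents`), and likewise for `N`. The part of the
seam outside the ball is unbounded and lies in one component on each side. Gluing merges these two
components and leaves all others alone (`IsGluing.encard_unboundedComponents`), so the count for `S`
plus one is the sum of the other two. Passing to suprema gives the formula (`numEnds_gluing`).

The geometric point is that the seam near infinity lies in a single component of the hat minus `K`
(`IsConnectedAtInfinity`). For n ≥ 2 this holds because ℝⁿ minus a ball is connected. For n = 1 the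
seam is a line with two ends, and one argues by contradiction with Stokes' theorem. If the two ends
lay in different components, there would be a function `F₀` equal to a step across the strip `νr`,
to 1 on the component of the right end and to 0 elsewhere, hence locally constant outside the strip
and a compact set. For a compactly supported `h` equal to 1 near that compact set, the integral of
`dF ∧ dh`, where `F` is `F₀` cut off near the compact set, vanishes by Stokes. But only the strip
contributes, and there the integral is visibly nonzero
(`IsSmoothProperEmbedding.false_of_locally_constant`). Orientation and compactness of the boundary
enter here.

The counting also needs the hats to be locally connected along their new boundary. This comes from
extending `Φ` across the boundary hyperplane to a local homeomorphism by a C¹ reflection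
(`IsSmoothProperEmbedding.exists_openPartialHomeomorph`). -/

/-- The set of unbounded connected components of a subspace. -/
def unboundedComponents (A : Set X) : Set (Set X) := {C | IsUnboundedComponent A C}

lemma Ends.antitone {K : CompactExhaustion X} (e : Ends K) : Antitone e.1 :=
  antitone_nat_of_succ_le e.2.2

lemma IsUnboundedComponent.nonempty {A C : Set X} (h : IsUnboundedComponent A C) : C.Nonempty := by
  obtain ⟨⟨x, hx, rfl⟩, -⟩ := h
  exact ⟨x, mem_connectedComponentIn hx⟩

lemma IsUnboundedComponent.subset {A C : Set X} (h : IsUnboundedComponent A C) : C ⊆ A := by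
  obtain ⟨⟨x, hx, rfl⟩, -⟩ := h
  exact connectedComponentIn_subset _ _

lemma IsUnboundedComponent.isPreconnected {A C : Set X} (h : IsUnboundedComponent A C) :
    IsPreconnected C := by
  obtain ⟨⟨x, hx, rfl⟩, -⟩ := h
  exact isPreconnected_connectedComponentIn

lemma IsUnboundedComponent.eq_connectedComponentIn {A C : Set X} (h : IsUnboundedComponent A C)
    {x : X} (hx : x ∈ C) : C = connectedComponentIn A x := by
  obtain ⟨⟨y, hy, rfl⟩, -⟩ := h
  exact connectedComponentIn_eq hx

lemma IsUnboundedComponent.subset_of_isPreconnected {A C D : Set X}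
    (h : IsUnboundedComponent A C) (hD : IsPreconnected D) (hDA : D ⊆ A) {x : X} (hxC : x ∈ C)
    (hxD : x ∈ D) : D ⊆ C := by
  rw [h.eq_connectedComponentIn hxC]
  exact hD.subset_connectedComponentIn hxD hDA

lemma IsUnboundedComponent.eq_of_mem {A C D : Set X} (hC : IsUnboundedComponent A C)
    (hD : IsUnboundedComponent A D) {x : X} (hxC : x ∈ C) (hxD : x ∈ D) : C = D := by
  rw [hC.eq_connectedComponentIn hxC, hD.eq_connectedComponentIn hxD]

lemma isUnboundedComponent_connectedComponentIn [R1Space X] {A W : Set X} {x : X} (hx : x ∈ A)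
    (hW : W ⊆ connectedComponentIn A x) (hWu : ¬ IsCompact (closure W)) :
    IsUnboundedComponent A (connectedComponentIn A x) :=
  ⟨⟨x, hx, rfl⟩, fun h => hWu (h.of_isClosed_subset isClosed_closure (closure_mono hW))⟩

/-- Every unbounded component of a smaller set lies in one of the larger set. -/
lemma IsUnboundedComponent.exists_superset [R1Space X] {A B W : Set X} (hAB : A ⊆ B)
    (hW : IsUnboundedComponent A W) : ∃ V, IsUnboundedComponent B V ∧ W ⊆ V := by
  obtain ⟨x, hx⟩ := hW.nonempty
  have hsub : W ⊆ connectedComponentIn B x :=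
    hW.isPreconnected.subset_connectedComponentIn hx (hW.subset.trans hAB)
  exact ⟨_, isUnboundedComponent_connectedComponentIn (hAB (hW.subset hx)) hsub hW.2, hsub⟩

lemma IsUnboundedComponent.not_subset [T2Space X] {A C L : Set X} (hC : IsUnboundedComponent A C)
    (hL : IsCompact L) : ¬ C ⊆ L := fun h =>
  hC.2 (hL.of_isClosed_subset isClosed_closure (closure_minimal h hL.isClosed))

variable [T2Space X] [LocallyConnectedSpace X] [ConnectedSpace X]

/-- All but finitely many components of the complement of a compact set `K` lie in a given
compact neighborhood of `K`. -/
lemma finite_components_not_subset {K L : Set X} (hK : IsCompact K) (hL : IsCompact L)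
    (hKL : K ⊆ interior L) :
    {C : Set X | (∃ x ∈ Kᶜ, C = connectedComponentIn Kᶜ x) ∧ ¬ C ⊆ L}.Finite := by
  have hfr : IsCompact (frontier L) := hL.of_isClosed_subset isClosed_frontier
    hL.isClosed.frontier_subset
  have hKo : IsOpen Kᶜ := hK.isClosed.isOpen_compl
  have hfrK : frontier L ⊆ Kᶜ := fun x hx hxK => hx.2 (hKL hxK)
  obtain ⟨t, ht⟩ := hfr.elim_finite_subcover (fun y : X => connectedComponentIn Kᶜ y)
    (fun y => hKo.connectedComponentIn)
    (fun y hy => mem_iUnion.2 ⟨y, mem_connectedComponentIn (hfrK hy)⟩)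
  -- Components that meet the frontier of `L` are among the finitely many of the subcover. One that
  -- misses it without lying in `L` stays in `Lᶜ`, away from `K`, so it is clopen and equals `univ`.
  refine ((t.finite_toSet.image (fun y => connectedComponentIn Kᶜ y)).union
    (finite_singleton (univ : Set X))).subset ?_
  rintro C ⟨⟨x, hx, rfl⟩, hCL⟩
  by_cases hm : (connectedComponentIn Kᶜ x ∩ frontier L).Nonempty
  · left
    obtain ⟨z, hz, hzL⟩ := hm
    obtain ⟨y, hy, hzy⟩ := mem_iUnion₂.1 (ht hzL)
    exact ⟨y, hy, (connectedComponentIn_eq hzy).trans (connectedComponentIn_eq hz).symm⟩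
  · right
    have hpre : IsPreconnected (connectedComponentIn Kᶜ x) := isPreconnected_connectedComponentIn
    have hsub : connectedComponentIn Kᶜ x ⊆ interior L ∪ Lᶜ := by
      intro z hz
      by_contra hcon
      rw [mem_union, not_or] at hcon
      exact hm ⟨z, hz, subset_closure (not_not.1 hcon.2), hcon.1⟩
    have hLc : connectedComponentIn Kᶜ x ⊆ Lᶜ := by
      rcases hpre.subset_or_subset isOpen_interior hL.isClosed.isOpen_compl
        (disjoint_compl_right.mono_left interior_subset) hsub with h | h
      · exact absurd (h.trans interior_subset) hCL
      · exact h
    have hcl : closure (connectedComponentIn Kᶜ x) ⊆ Kᶜ := by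
      refine (closure_mono hLc).trans ?_
      rw [closure_compl]
      exact compl_subset_compl.2 hKL
    have hclosed : IsClosed (connectedComponentIn Kᶜ x) := by
      refine isClosed_of_closure_subset ?_
      exact hpre.closure.subset_connectedComponentIn
        (subset_closure (mem_connectedComponentIn hx)) hcl
    exact IsClopen.eq_univ ⟨hclosed, hKo.connectedComponentIn⟩ ⟨x, mem_connectedComponentIn hx⟩

variable [LocallyCompactSpace X]

lemma finite_unboundedComponents {K : Set X} (hK : IsCompact K) :
    (unboundedComponents Kᶜ).Finite := by
  obtain ⟨L, hL, hKL⟩ := exists_compact_superset hK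
  exact (finite_components_not_subset hK hL hKL).subset fun C hC => ⟨hC.1, hC.not_subset hL⟩

/-- Every unbounded component of the complement of a compact set contains one of the complement
of any larger compact set. -/
lemma IsUnboundedComponent.exists_subset {K K' V : Set X} (hK' : IsCompact K') (hKK' : K ⊆ K')
    (hV : IsUnboundedComponent Kᶜ V) : ∃ W, IsUnboundedComponent K'ᶜ W ∧ W ⊆ V := by
  by_contra! hcon
  obtain ⟨L, hL, hKL⟩ := exists_compact_superset hK'
  have hfin := finite_components_not_subset hK' hL hKL
  set S := {C : Set X | (∃ x ∈ K'ᶜ, C = connectedComponentIn K'ᶜ x) ∧ ¬ C ⊆ L} ∩ {C | C ⊆ V}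
  have hS : S.Finite := hfin.subset inter_subset_left
  -- If no unbounded component of `K'ᶜ` lay in `V`, then `V` would be covered by `L` and finitely
  -- many compact closures.
  have hcomp : IsCompact (L ∪ ⋃ C ∈ S, closure C) := by
    refine hL.union (hS.isCompact_biUnion fun C hC => ?_)
    by_contra hnc
    exact hcon C ⟨hC.1.1, hnc⟩ hC.2
  refine hV.not_subset hcomp fun x hx => ?_
  by_cases hxL : x ∈ L
  · exact Or.inl hxL
  have hxK' : x ∈ K'ᶜ := fun h => hxL (interior_subset (hKL h))
  refine Or.inr (mem_biUnion (x := connectedComponentIn K'ᶜ x) ⟨⟨⟨x, hxK', rfl⟩, fun h => hxL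
    (h (mem_connectedComponentIn hxK'))⟩, ?_⟩ (subset_closure (mem_connectedComponentIn hxK')))
  exact hV.subset_of_isPreconnected isPreconnected_connectedComponentIn
    ((connectedComponentIn_subset _ _).trans (compl_subset_compl.2 hKK')) hx
    (mem_connectedComponentIn hxK')

/-- This is the bonding map of the inverse system whose limit is the set of ends. Surjectivity says
that no unbounded component dies out further along the exhaustion. -/
lemma exists_surjective_unboundedComponents {K K' : Set X} (hK' : IsCompact K') (hKK' : K ⊆ K') :
    ∃ f : unboundedComponents K'ᶜ → unboundedComponents Kᶜ,
      Function.Surjective f ∧ ∀ W : unboundedComponents K'ᶜ, (W : Set X) ⊆ f W := by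
  have h : ∀ W : unboundedComponents K'ᶜ, ∃ V : unboundedComponents Kᶜ, (W : Set X) ⊆ V := by
    intro W
    obtain ⟨V, hV, hWV⟩ := IsUnboundedComponent.exists_superset (compl_subset_compl.2 hKK') W.2
    exact ⟨⟨V, hV⟩, hWV⟩
  choose f hf using h
  refine ⟨f, fun V => ?_, hf⟩
  obtain ⟨W, hW, hWV⟩ := IsUnboundedComponent.exists_subset hK' hKK' V.2
  obtain ⟨x, hx⟩ := hW.nonempty
  exact ⟨⟨W, hW⟩, Subtype.ext ((f ⟨W, hW⟩).2.eq_of_mem V.2 (hf ⟨W, hW⟩ hx) (hWV hx))⟩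

lemma encard_unboundedComponents_mono {K K' : Set X} (hK' : IsCompact K') (hKK' : K ⊆ K') :
    (unboundedComponents Kᶜ).encard ≤ (unboundedComponents K'ᶜ).encard := by
  obtain ⟨f, hf, -⟩ := exists_surjective_unboundedComponents hK' hKK'
  obtain ⟨g, hg⟩ := hf.hasRightInverse
  exact ENat.card_le_card_of_injective hg.injective

/-- Every unbounded component of the complement of a member of a compact exhaustion belongs to
an end. -/
lemma exists_end_eq (K : CompactExhaustion X) (i : ℕ) {V : Set X}
    (hV : IsUnboundedComponent (K i)ᶜ V) : ∃ e : Ends K, e.1 i = V := by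
  have hstep : ∀ k : ℕ, ∀ W : unboundedComponents (K (i + k))ᶜ,
      ∃ W' : unboundedComponents (K (i + (k + 1)))ᶜ, (W' : Set X) ⊆ W := fun k W => by
    obtain ⟨W', hW', h⟩ := IsUnboundedComponent.exists_subset (K.isCompact (i + (k + 1)))
      (K.subset (by omega)) W.2
    exact ⟨⟨W', hW'⟩, h⟩
  choose next hnext using hstep
  let s : ∀ k : ℕ, unboundedComponents (K (i + k))ᶜ := fun k =>
    Nat.rec (motive := fun k => unboundedComponents (K (i + k))ᶜ) ⟨V, hV⟩ next k
  have hs : ∀ k, (s (k + 1) : Set X) ⊆ s k := fun k => hnext k (s k)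
  have hs0 : ∀ k, (s k : Set X) ⊆ V := by
    intro k
    induction k with
    | zero => exact subset_rfl
    | succ k ih => exact (hs k).trans ih
  -- The sequence `s` starts at stage `i`, but `s j` also lies outside `K j`, because `j ≤ i + j`.
  -- The component of `(K j)ᶜ` around `s j` thus defines an end at every index, including those
  -- below `i`.
  have hpar : ∀ j, ∃ U, IsUnboundedComponent (K j)ᶜ U ∧ (s j : Set X) ⊆ U := fun j =>
    IsUnboundedComponent.exists_superset (compl_subset_compl.2 (K.subset (by omega))) (s j).2
  choose U hU hsU using hpar
  refine ⟨⟨U, hU, fun j => ?_⟩, ?_⟩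
  · obtain ⟨x, hx⟩ := (s (j + 1)).2.nonempty
    exact (hU j).subset_of_isPreconnected (hU (j + 1)).isPreconnected
      ((hU (j + 1)).subset.trans (compl_subset_compl.2 (K.subset (by omega))))
      (hsU j (hs j hx)) (hsU (j + 1) hx)
  · obtain ⟨x, hx⟩ := (s i).2.nonempty
    exact (hU i).eq_of_mem hV (hsU i hx) (hs0 i hx)

/-- In an inverse system of finite sets with surjective bonding maps, every stage is an image of the
limit. If the cardinalities are bounded, their supremum is attained at some stage `m`. Beyond it the
bonding maps are bijections, so an end is determined by its member at `m`. -/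
lemma numEnds_eq_iSup_nat (K : CompactExhaustion X) :
    numEnds K = ⨆ i, (unboundedComponents (K i)ᶜ).encard := by
  apply le_antisymm
  · by_cases htop : ⨆ i, (unboundedComponents (K i)ᶜ).encard < ⊤
    · obtain ⟨m, hm⟩ := ENat.exists_eq_iSup_of_lt_top htop
      rw [← hm]
      refine ENat.card_le_card_of_injective
        (f := fun e : Ends K => (⟨e.1 m, e.2.1 m⟩ : unboundedComponents (K m)ᶜ)) ?_
      intro e e' hee
      have hee : e.1 m = e'.1 m := congrArg Subtype.val hee
      refine Subtype.ext (funext fun j => ?_)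
      rcases le_total j m with hj | hj
      · obtain ⟨x, hx⟩ := (e.2.1 m).nonempty
        exact (e.2.1 j).eq_of_mem (e'.2.1 j) (e.antitone hj hx) (e'.antitone hj (hee ▸ hx))
      · obtain ⟨f, hf, hsub⟩ := exists_surjective_unboundedComponents (K.isCompact j) (K.subset hj)
        have : Finite (unboundedComponents (K j)ᶜ) := finite_unboundedComponents (K.isCompact j)
        have hle : (unboundedComponents (K j)ᶜ).ncard ≤ (unboundedComponents (K m)ᶜ).ncard := by
          rw [← Nat.cast_le (α := ℕ∞),
            (finite_unboundedComponents (K.isCompact j)).cast_ncard_eq,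
            (finite_unboundedComponents (K.isCompact m)).cast_ncard_eq, hm]
          exact le_iSup (fun i => (unboundedComponents (K i)ᶜ).encard) j
        have hinj := (hf.bijective_of_nat_card_le hle).injective
        have key : ∀ a : Ends K, f ⟨a.1 j, a.2.1 j⟩ = ⟨a.1 m, a.2.1 m⟩ := fun a => by
          obtain ⟨x, hx⟩ := (a.2.1 j).nonempty
          exact Subtype.ext ((f ⟨a.1 j, a.2.1 j⟩).2.eq_of_mem (a.2.1 m)
            (hsub ⟨a.1 j, a.2.1 j⟩ hx) (a.antitone hj hx))
        exact congrArg Subtype.val (hinj (((key e).trans (Subtype.ext hee)).trans (key e').symm))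
    · rw [not_lt, top_le_iff] at htop
      rw [htop]
      exact le_top
  · refine iSup_le fun i => ?_
    have hsur : Function.Surjective
        (fun e : Ends K => (⟨e.1 i, e.2.1 i⟩ : unboundedComponents (K i)ᶜ)) := by
      rintro ⟨V, hV⟩
      obtain ⟨e, he⟩ := exists_end_eq K i hV
      exact ⟨e, Subtype.ext he⟩
    obtain ⟨g, hg⟩ := hsur.hasRightInverse
    exact ENat.card_le_card_of_injective hg.injective

/-- The number of ends is the supremum over all compact sets of the number of unbounded
components of the complement; in particular it does not depend on the exhaustion. -/
lemma numEnds_eq_iSup_compacts (K : CompactExhaustion X) :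
    numEnds K = ⨆ C : TopologicalSpace.Compacts X,
      (unboundedComponents (C : Set X)ᶜ).encard := by
  rw [numEnds_eq_iSup_nat]
  apply le_antisymm
  · exact iSup_le fun i => le_iSup
      (fun C : TopologicalSpace.Compacts X => (unboundedComponents (C : Set X)ᶜ).encard)
      ⟨K i, K.isCompact i⟩
  · refine iSup_le fun C => ?_
    obtain ⟨i, hi⟩ := K.exists_superset_of_isCompact C.isCompact
    exact (encard_unboundedComponents_mono (K.isCompact i) hi).trans
      (le_iSup (fun i => (unboundedComponents (K i)ᶜ).encard) i)

end Counting

end EndTheory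
end

noncomputable section
namespace EndTheory

set_option linter.unusedSectionVars false

open Set Topology

/-! ### Recognizing components of a subspace -/

section ComponentLemmas

variable {X : Type*} [TopologicalSpace X]

lemma mem_of_mem_connectedComponentIn {F : Set X} {x y : X} (h : y ∈ connectedComponentIn F x) :
    y ∈ F :=
  connectedComponentIn_subset F x h

/-- A connected set that is open and relatively closed in `F` cannot be enlarged inside `F`. The
components before and after cutting or gluing are identified by this test. -/
lemma connectedComponentIn_eq_of_isOpen {F D : Set X} (hD : IsPreconnected D) (hDF : D ⊆ F)
    (ho : IsOpen D) (hc : closure D ∩ F ⊆ D) {x : X} (hx : x ∈ D) :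
    connectedComponentIn F x = D := by
  apply Subset.antisymm
  · have hpre : IsPreconnected (connectedComponentIn F x) := isPreconnected_connectedComponentIn
    have hsub : connectedComponentIn F x ⊆ D ∪ (closure D)ᶜ := by
      intro y hy
      by_cases h : y ∈ closure D
      · exact Or.inl (hc ⟨h, (mem_of_mem_connectedComponentIn hy :)⟩)
      · exact Or.inr h
    exact hpre.subset_left_of_subset_union ho isClosed_closure.isOpen_compl
      (disjoint_compl_right.mono_left subset_closure) hsub
      ⟨x, mem_connectedComponentIn (hDF hx), hx⟩
  · exact hD.subset_connectedComponentIn hx hDF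

lemma closure_connectedComponentIn_inter_subset (F : Set X) (x : X) :
    closure (connectedComponentIn F x) ∩ F ⊆ connectedComponentIn F x := by
  rintro y ⟨hy, hyF⟩
  have hx : x ∈ F := by
    by_contra h
    rw [connectedComponentIn_eq_empty h, closure_empty] at hy
    exact hy
  have hpre : IsPreconnected (insert y (connectedComponentIn F x)) :=
    isPreconnected_connectedComponentIn.subset_closure (subset_insert _ _)
      (insert_subset hy subset_closure)
  exact hpre.subset_connectedComponentIn (mem_insert_of_mem _ (mem_connectedComponentIn hx))
    (insert_subset hyF (connectedComponentIn_subset _ _)) (mem_insert _ _)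

end ComponentLemmas

/-! ### Cutting off a regular neighborhood -/

section Splitting

variable {X Z : Type*} [TopologicalSpace X] [TopologicalSpace Z]

/-- `K` is a compact set meeting the closed set `P = Aᶜ ∪ range α` nicely: `P \ K` is connected,
and the part outside of `K` of the common boundary `range α` of `P` and `A` lies in one
component of `A \ K`. -/
structure IsSplitBy (A : Set X) (α : Z → X) (K : Set X) (T : Set Z) : Prop where
  isCompact : IsCompact K
  preimage_eq : α ⁻¹' K = T
  isPreconnected : IsPreconnected ((Aᶜ ∪ range α) \ K)
  join : ∃ C ⊆ A \ K, IsPreconnected C ∧ α '' Tᶜ ⊆ C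

variable [T2Space X] [LocallyConnectedSpace X] {A : Set X} [LocallyConnectedSpace A]

/-- Let `V` be the component of `x` in `Kᶜ` and `P = Aᶜ ∪ range α`. If `V` misses `P`, it lies in
`A` and is a component there. Otherwise `V` contains all of the connected set `P \ K`. Every
component of `A \ K` inside `V` must then reach `range α`, and since `range α` outside `K` lies in
one connected subset of `A \ K`, there is only one such component. -/
lemma IsSplitBy.preimage_val_connectedComponentIn {α : Z → X} {K : Set X} {T : Set Z}
    (h : IsSplitBy A α K T) (hA : IsClosed A) (hαA : range α ⊆ A)
    (hP : IsClosed (Aᶜ ∪ range α)) (hT : Tᶜ.Nonempty) (x : A) (hxK : (x : X) ∉ K) :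
    ((connectedComponentIn Kᶜ (x : X) ∩ range α = ∅ ∧
        connectedComponentIn Kᶜ (x : X) ⊆ A) ∨ α '' Tᶜ ⊆ connectedComponentIn Kᶜ (x : X)) ∧
    (Subtype.val ⁻¹' connectedComponentIn Kᶜ (x : X) : Set A) =
      connectedComponentIn (Subtype.val ⁻¹' K)ᶜ x := by
  set V := connectedComponentIn Kᶜ (x : X)
  have hKo : IsOpen Kᶜ := h.isCompact.isClosed.isOpen_compl
  have hKAo : IsOpen (Subtype.val ⁻¹' K : Set A)ᶜ :=
    (h.isCompact.isClosed.preimage continuous_subtype_val).isOpen_compl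
  have hVpre : IsPreconnected V := isPreconnected_connectedComponentIn
  have hxV : (x : X) ∈ V := mem_connectedComponentIn hxK
  -- the component in `A` is contained in the component in `X`
  have hsub : ∀ y : A, (y : X) ∈ V →
      connectedComponentIn (Subtype.val ⁻¹' K : Set A)ᶜ y ⊆ Subtype.val ⁻¹' V := by
    intro y hyV z hz
    have hyK : (y : X) ∉ K := (mem_of_mem_connectedComponentIn hyV :)
    have him : IsPreconnected (Subtype.val '' connectedComponentIn (Subtype.val ⁻¹' K : Set A)ᶜ y) :=
      isPreconnected_connectedComponentIn.image _ continuous_subtype_val.continuousOn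
    have := him.subset_connectedComponentIn (F := Kᶜ) (x := (y : X))
      ⟨y, mem_connectedComponentIn hyK, rfl⟩ (by
        rintro _ ⟨w, hw, rfl⟩
        exact (mem_of_mem_connectedComponentIn hw :))
    rw [← connectedComponentIn_eq hyV] at this
    exact this ⟨z, hz, rfl⟩
  by_cases hm : (V ∩ (Aᶜ ∪ range α)).Nonempty
  · obtain ⟨w, hwV, hwP⟩ := hm
    have hNV : (Aᶜ ∪ range α) \ K ⊆ V := by
      have := h.isPreconnected.subset_connectedComponentIn (F := Kᶜ) (x := w)
        ⟨hwP, (mem_of_mem_connectedComponentIn hwV :)⟩ (fun y hy => hy.2)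
      rwa [← connectedComponentIn_eq hwV] at this
    have hTV : α '' Tᶜ ⊆ V := by
      rintro _ ⟨z, hz, rfl⟩
      refine hNV ⟨Or.inr ⟨z, rfl⟩, fun hzK => hz ?_⟩
      rw [← h.preimage_eq]
      exact hzK
    refine ⟨Or.inr hTV, ?_⟩
    obtain ⟨C, hCA, hC, hTC⟩ := h.join
    have hCpre : IsPreconnected (Subtype.val ⁻¹' C : Set A) := by
      rw [← IsInducing.subtypeVal.isPreconnected_image, Subtype.image_preimage_coe,
        inter_eq_right.2 fun y hy => (hCA hy).1]
      exact hC
    have hCK : (Subtype.val ⁻¹' C : Set A) ⊆ (Subtype.val ⁻¹' K : Set A)ᶜ :=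
      fun y hy => (hCA hy).2
    have key : ∀ y : A, (y : X) ∈ V →
        (Subtype.val ⁻¹' C : Set A) ⊆ connectedComponentIn (Subtype.val ⁻¹' K : Set A)ᶜ y := by
      intro y hyV
      have hyK : (y : X) ∉ K := (mem_of_mem_connectedComponentIn hyV :)
      set D := connectedComponentIn (Subtype.val ⁻¹' K : Set A)ᶜ y
      have hyD : y ∈ D := mem_connectedComponentIn hyK
      by_cases hD : ∃ z ∈ D, (z : X) ∈ range α
      · obtain ⟨z, hzD, t, ht⟩ := hD
        have hzC : z ∈ (Subtype.val ⁻¹' C : Set A) := by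
          refine hTC ⟨t, fun htT => ?_, ht⟩
          rw [← h.preimage_eq, mem_preimage, ht] at htT
          exact (mem_of_mem_connectedComponentIn hzD :) htT
        have := hCpre.subset_connectedComponentIn hzC hCK
        rwa [← connectedComponentIn_eq hzD] at this
      · exfalso
        push Not at hD
        -- A component `D` of `A \ K` that misses `range α` is open in `X`, because it avoids the
        -- closed set `P`. Then `D` would be all of `V`, although `V` contains points of `range α`.
        have hDeq : connectedComponentIn Kᶜ (y : X) = Subtype.val '' D := by
          refine connectedComponentIn_eq_of_isOpen
            (isPreconnected_connectedComponentIn.image _ continuous_subtype_val.continuousOn)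
            ?_ ?_ ?_ ⟨y, hyD, rfl⟩
          · rintro _ ⟨w, hw, rfl⟩
            exact (mem_of_mem_connectedComponentIn hw :)
          · obtain ⟨U, hU, hUD⟩ := isOpen_induced_iff.1 (hKAo.connectedComponentIn (x := y))
            have : Subtype.val '' D = U ∩ (Aᶜ ∪ range α)ᶜ := by
              ext w
              constructor
              · rintro ⟨v, hv, rfl⟩
                refine ⟨?_, ?_⟩
                · have : v ∈ Subtype.val ⁻¹' U := hUD ▸ hv
                  exact this
                · rintro (hvA | hvα)
                  · exact hvA v.2
                  · exact hD v hv hvα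
              · rintro ⟨hwU, hwP⟩
                have hwA : w ∈ A := by
                  by_contra hwA
                  exact hwP (Or.inl hwA)
                refine ⟨⟨w, hwA⟩, ?_, rfl⟩
                have : (⟨w, hwA⟩ : A) ∈ Subtype.val ⁻¹' U := hwU
                rwa [hUD] at this
            rw [this]
            exact hU.inter hP.isOpen_compl
          · rw [hA.isClosedEmbedding_subtypeVal.closure_image_eq]
            rintro _ ⟨⟨w, hw, rfl⟩, hwK⟩
            exact ⟨w, closure_connectedComponentIn_inter_subset _ _ ⟨hw, hwK⟩, rfl⟩
        obtain ⟨t, ht⟩ := hT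
        have htV : α t ∈ V := hTV ⟨t, ht, rfl⟩
        rw [show V = connectedComponentIn Kᶜ (y : X) from connectedComponentIn_eq hyV, hDeq] at htV
        obtain ⟨v, hv, hvt⟩ := htV
        exact hD v hv ⟨t, hvt.symm⟩
    obtain ⟨t, ht⟩ := hT
    have htC : (⟨α t, hαA ⟨t, rfl⟩⟩ : A) ∈ (Subtype.val ⁻¹' C : Set A) := hTC ⟨t, ht, rfl⟩
    refine Subset.antisymm (fun y hy => ?_) (hsub x hxV)
    have h1 := connectedComponentIn_eq (key y hy htC)
    have h2 := connectedComponentIn_eq (key x hxV htC)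
    rw [h2, ← h1]
    exact mem_connectedComponentIn (mem_of_mem_connectedComponentIn (F := Kᶜ) (x := (x : X)) hy :)
  · rw [not_nonempty_iff_eq_empty] at hm
    have hVA : V ⊆ A := by
      intro y hy
      by_contra hyA
      exact (hm ▸ (⟨hy, Or.inl hyA⟩ : y ∈ V ∩ (Aᶜ ∪ range α)) : y ∈ (∅ : Set X))
    refine ⟨Or.inl ⟨?_, hVA⟩, Subset.antisymm ?_ (hsub x hxV)⟩
    · rw [← subset_empty_iff, ← hm]
      exact inter_subset_inter_right _ subset_union_right
    · have hVpre' : IsPreconnected (Subtype.val ⁻¹' V : Set A) := by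
        rw [← IsInducing.subtypeVal.isPreconnected_image, Subtype.image_preimage_coe,
          inter_eq_right.2 hVA]
        exact hVpre
      exact hVpre'.subset_connectedComponentIn hxV
        fun y hy => (mem_of_mem_connectedComponentIn hy :)

/-- Cutting off the interior of `P = Aᶜ ∪ range α` does not change the number of unbounded
components of the complement of `K`. -/
lemma IsSplitBy.encard_unboundedComponents {α : Z → X} {K : Set X} {T : Set Z}
    (h : IsSplitBy A α K T) (hA : IsClosed A) (hαA : range α ⊆ A) (hα : IsClosedEmbedding α)
    (hP : IsClosed (Aᶜ ∪ range α)) (hT : ¬ IsCompact (closure Tᶜ)) :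
    (unboundedComponents (Subtype.val ⁻¹' K : Set A)ᶜ).encard =
      (unboundedComponents Kᶜ).encard := by
  have hTne : Tᶜ.Nonempty := by
    by_contra hne
    rw [not_nonempty_iff_eq_empty] at hne
    rw [hne, closure_empty] at hT
    exact hT isCompact_empty
  have hcl : IsClosedEmbedding (Subtype.val : A → X) := hA.isClosedEmbedding_subtypeVal
  -- The closed embedding `α` pulls compact sets back to compact sets, so no set with compact
  -- closure contains the image of `Tᶜ`.
  have hunb : ∀ {V : Set X}, α '' Tᶜ ⊆ V → ¬ IsCompact (closure V) := by
    intro V hV hc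
    refine hT ((hα.isCompact_preimage hc).of_isClosed_subset isClosed_closure
      (closure_minimal ?_ (isClosed_closure.preimage hα.continuous)))
    exact fun z hz => subset_closure (hV ⟨z, hz, rfl⟩)
  have himg : ∀ D : Set A, IsCompact (closure (Subtype.val '' D)) ↔ IsCompact (closure D) := by
    intro D
    rw [hcl.closure_image_eq, hcl.isInducing.isCompact_iff]
  -- A component with a point outside `A` contains the connected set `P \ K`, which reaches `range α
  -- ⊆ A`. Hence no unbounded component is lost by intersecting with `A`.
  have hinvol : ∀ V : Set X, IsUnboundedComponent Kᶜ V → ∃ x : A, (x : X) ∈ V := by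
    intro V hV
    obtain ⟨v, hv⟩ := hV.nonempty
    by_cases hvA : v ∈ A
    · exact ⟨⟨v, hvA⟩, hv⟩
    · obtain ⟨t, ht⟩ := hTne
      refine ⟨⟨α t, hαA ⟨t, rfl⟩⟩, ?_⟩
      refine hV.subset_of_isPreconnected h.isPreconnected (fun y hy => hy.2) hv
        ⟨Or.inl hvA, hV.subset hv⟩ ⟨Or.inr ⟨t, rfl⟩, fun htK => ht ?_⟩
      rw [← h.preimage_eq]
      exact htK
  symm
  refine Set.encard_congr (Equiv.ofBijective (fun V : unboundedComponents Kᶜ =>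
    (⟨Subtype.val ⁻¹' (V : Set X), ?_⟩ : unboundedComponents (Subtype.val ⁻¹' K : Set A)ᶜ))
      ⟨?_, ?_⟩)
  · obtain ⟨V, hV⟩ := V
    obtain ⟨x, hx⟩ := hinvol V hV
    have hxK : (x : X) ∉ K := hV.subset hx
    obtain ⟨h1, h2⟩ := h.preimage_val_connectedComponentIn hA hαA hP hTne x hxK
    refine ⟨⟨x, hxK, ?_⟩, ?_⟩
    · rw [← h2, ← hV.eq_connectedComponentIn hx]
    · rw [← himg, Subtype.image_preimage_coe]
      rw [← hV.eq_connectedComponentIn hx] at h1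
      rcases h1 with h1 | h1
      · rw [inter_eq_right.2 h1.2]
        exact hV.2
      · refine hunb (subset_inter ?_ h1)
        exact (image_subset_range _ _).trans hαA
  · rintro ⟨V, hV⟩ ⟨W, hW⟩ hVW
    have hVW : (Subtype.val ⁻¹' V : Set A) = Subtype.val ⁻¹' W := congrArg Subtype.val hVW
    obtain ⟨x, hx⟩ := hinvol V hV
    have hxW : x ∈ (Subtype.val ⁻¹' W : Set A) := hVW ▸ hx
    exact Subtype.ext (hV.eq_of_mem hW hx hxW)
  · rintro ⟨D, hD⟩
    obtain ⟨x, hx⟩ := hD.nonempty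
    have hxK : (x : X) ∉ K := hD.subset hx
    obtain ⟨h1, h2⟩ := h.preimage_val_connectedComponentIn hA hαA hP hTne x hxK
    rw [← hD.eq_connectedComponentIn hx] at h2
    refine ⟨⟨connectedComponentIn Kᶜ (x : X), isUnboundedComponent_connectedComponentIn
      (W := Subtype.val '' D) hxK ?_ ?_⟩, Subtype.ext h2⟩
    · rw [← h2]
      exact image_preimage_subset _ _
    · rw [himg]
      exact hD.2

end Splitting

/-! ### Topology of an adjunction space -/

section Gluing

variable {A B Z S : Type*} [TopologicalSpace A] [TopologicalSpace B] [TopologicalSpace Z]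
  [TopologicalSpace S]

/-- `S` is the adjunction space obtained from `A` and `B` by gluing `α z` to `β z`. -/
structure IsGluing (α : Z → A) (β : Z → B) (i : A → S) (j : B → S) : Prop where
  isOpen_iff : ∀ U : Set S, IsOpen U ↔ IsOpen (i ⁻¹' U) ∧ IsOpen (j ⁻¹' U)
  injective_left : Function.Injective i
  injective_right : Function.Injective j
  mem_range : ∀ s, s ∈ range i ∨ s ∈ range j
  glue : ∀ p q, i p = j q ↔ ∃ z, α z = p ∧ β z = q

namespace IsGluing

variable {α : Z → A} {β : Z → B} {i : A → S} {j : B → S}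

lemma symm (h : IsGluing α β i j) : IsGluing β α j i where
  isOpen_iff U := (h.isOpen_iff U).trans and_comm
  injective_left := h.injective_right
  injective_right := h.injective_left
  mem_range s := (h.mem_range s).symm
  glue p q := by rw [eq_comm, h.glue]; exact exists_congr fun z => and_comm

lemma isClosed_iff (h : IsGluing α β i j) (F : Set S) :
    IsClosed F ↔ IsClosed (i ⁻¹' F) ∧ IsClosed (j ⁻¹' F) := by
  simp only [← isOpen_compl_iff, h.isOpen_iff, preimage_compl]

lemma continuous_left (h : IsGluing α β i j) : Continuous i :=
  continuous_def.2 fun U hU => ((h.isOpen_iff U).1 hU).1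

lemma preimage_right_image_left (h : IsGluing α β i j) (V : Set A) :
    j ⁻¹' (i '' V) = β '' (α ⁻¹' V) := by
  ext q
  constructor
  · rintro ⟨p, hp, hpq⟩
    obtain ⟨z, rfl, rfl⟩ := (h.glue _ _).1 hpq
    exact ⟨z, hp, rfl⟩
  · rintro ⟨z, hz, rfl⟩
    exact ⟨α z, hz, (h.glue _ _).2 ⟨z, rfl, rfl⟩⟩

lemma isClosedEmbedding_left (h : IsGluing α β i j) (hα : Continuous α)
    (hβ : IsClosedEmbedding β) : IsClosedEmbedding i := by
  refine IsClosedEmbedding.of_continuous_injective_isClosedMap h.continuous_left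
    h.injective_left fun F hF => ?_
  rw [h.isClosed_iff, preimage_image_eq F h.injective_left, h.preimage_right_image_left]
  exact ⟨hF, hβ.isClosedMap _ (hF.preimage hα)⟩

/-- Real functions that agree along the seam glue to continuous functions on `S`. They serve to
separate points of `S`. -/
lemma exists_continuous (h : IsGluing α β i j) (f : C(A, ℝ)) (g : C(B, ℝ))
    (hfg : ∀ z, f (α z) = g (β z)) :
    ∃ k : C(S, ℝ), (∀ a, k (i a) = f a) ∧ ∀ b, k (j b) = g b := by
  have hex : ∀ s : S, ∃ r : ℝ, (∀ a, i a = s → r = f a) ∧ ∀ b, j b = s → r = g b := by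
    intro s
    rcases h.mem_range s with ⟨a, rfl⟩ | ⟨b, rfl⟩
    · refine ⟨f a, fun a' ha' => by rw [h.injective_left ha'], fun b hb => ?_⟩
      obtain ⟨z, rfl, rfl⟩ := (h.glue _ _).1 hb.symm
      exact hfg z
    · refine ⟨g b, fun a ha => ?_, fun b' hb' => by rw [h.injective_right hb']⟩
      obtain ⟨z, rfl, rfl⟩ := (h.glue _ _).1 ha
      exact (hfg z).symm
  choose k hk using hex
  have h1 : k ∘ i = f := funext fun a => (hk (i a)).1 a rfl
  have h2 : k ∘ j = g := funext fun b => (hk (j b)).2 b rfl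
  refine ⟨⟨k, continuous_def.2 fun U hU => (h.isOpen_iff _).2 ⟨?_, ?_⟩⟩, congrFun h1, congrFun h2⟩
  · rw [← preimage_comp, h1]
    exact hU.preimage f.continuous
  · rw [← preimage_comp, h2]
    exact hU.preimage g.continuous

/-- A Urysohn function on `A` separates the points. Its restriction to the seam extends over `B` by
Tietze, so it glues to a function on `S`. -/
lemma exists_continuous_ne_of_left [T1Space A] [NormalSpace A] [NormalSpace B]
    (h : IsGluing α β i j) (hα : Continuous α)
    (hβ : IsClosedEmbedding β) {a a' : A} (haa' : a ≠ a') : ∃ k : C(S, ℝ), k (i a) ≠ k (i a') := by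
  obtain ⟨f, hf0, hf1, -⟩ := exists_continuous_zero_one_of_isClosed (isClosed_singleton (x := a))
    (isClosed_singleton (x := a')) (by simpa using haa')
  obtain ⟨g, hg⟩ := ContinuousMap.exists_extension hβ (f.comp ⟨α, hα⟩)
  obtain ⟨k, hk, -⟩ := h.exists_continuous f g fun z => (DFunLike.congr_fun hg z).symm
  refine ⟨k, ?_⟩
  rw [hk, hk, hf0 rfl, hf1 rfl]
  simp

/-- Points of `S` are separated by real functions. For points on different sides, either one lies on
the seam and can be moved to the other side, or a Urysohn function that vanishes on the seam is
continued by zero. -/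
lemma t2Space [T1Space A] [NormalSpace A] [T1Space B] [NormalSpace B] (h : IsGluing α β i j)
    (hα : IsClosedEmbedding α) (hβ : IsClosedEmbedding β) : T2Space S := by
  suffices hsep : ∀ s t : S, s ≠ t → ∃ k : C(S, ℝ), k s ≠ k t by
    refine ⟨fun s t hst => ?_⟩
    obtain ⟨k, hk⟩ := hsep s t hst
    exact separated_by_continuous k.continuous hk
  have main : ∀ (a : A) (b : B), i a ≠ j b → ∃ k : C(S, ℝ), k (i a) ≠ k (j b) := by
    intro a b hab
    by_cases ha : a ∈ range α
    · obtain ⟨z, rfl⟩ := ha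
      rw [(h.glue _ _).2 ⟨z, rfl, rfl⟩] at hab ⊢
      exact h.symm.exists_continuous_ne_of_left hβ.continuous hα fun hb => hab (hb ▸ rfl)
    · obtain ⟨f, hf0, hf1, -⟩ := exists_continuous_zero_one_of_isClosed hα.isClosed_range
        (isClosed_singleton (x := a)) (by simpa using ha)
      obtain ⟨k, hk1, hk2⟩ := h.exists_continuous f 0 fun z => hf0 ⟨z, rfl⟩
      refine ⟨k, ?_⟩
      rw [hk1, hk2, hf1 rfl]
      simp
  intro s t hst
  rcases h.mem_range s with ⟨a, rfl⟩ | ⟨b, rfl⟩ <;> rcases h.mem_range t with ⟨a', rfl⟩ | ⟨b', rfl⟩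
  · exact h.exists_continuous_ne_of_left hα.continuous hβ fun e => hst (e ▸ rfl)
  · exact main a b' hst
  · obtain ⟨k, hk⟩ := main a' b hst.symm
    exact ⟨k, hk.symm⟩
  · exact h.symm.exists_continuous_ne_of_left hβ.continuous hα fun e => hst (e ▸ rfl)

lemma image_union_image_eq_univ (h : IsGluing α β i j) : range i ∪ range j = univ :=
  eq_univ_of_forall h.mem_range

lemma sigmaCompactSpace [SigmaCompactSpace A] [SigmaCompactSpace B] (h : IsGluing α β i j) :
    SigmaCompactSpace S := by
  rw [← isSigmaCompact_univ_iff]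
  have : range (Sum.elim i j) = univ := by rw [Sum.elim_range, h.image_union_image_eq_univ]
  rw [← this]
  exact isSigmaCompact_range (continuous_sumElim.2 ⟨h.continuous_left, h.symm.continuous_left⟩)

lemma weaklyLocallyCompactSpace [WeaklyLocallyCompactSpace A] [WeaklyLocallyCompactSpace B]
    (h : IsGluing α β i j) (hα : IsClosedEmbedding α) (hβ : IsClosedEmbedding β) :
    WeaklyLocallyCompactSpace S := by
  refine ⟨fun s => ?_⟩
  -- The preimages of `s` have at most one point and may be empty. Treating them as compact sets
  -- covers points on and off the seam at once.
  obtain ⟨K, hK, hsK⟩ := exists_compact_superset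
    (Set.Subsingleton.isCompact (s := i ⁻¹' {s}) fun a ha b hb => h.injective_left (ha.trans hb.symm))
  obtain ⟨L, hL, hsL⟩ := exists_compact_superset
    (Set.Subsingleton.isCompact (s := j ⁻¹' {s}) fun a ha b hb => h.injective_right (ha.trans hb.symm))
  refine ⟨i '' K ∪ j '' L, (hK.image h.continuous_left).union (hL.image h.symm.continuous_left), ?_⟩
  have hc : IsClosed (i '' (interior K)ᶜ ∪ j '' (interior L)ᶜ) :=
    ((h.isClosedEmbedding_left hα.continuous hβ).isClosedMap _ isOpen_interior.isClosed_compl).union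
    ((h.symm.isClosedEmbedding_left hβ.continuous hα).isClosedMap _ isOpen_interior.isClosed_compl)
  filter_upwards [hc.isOpen_compl.mem_nhds (x := s) (by
    rintro (⟨a, ha, has⟩ | ⟨b, hb, hbs⟩)
    · exact ha (hsK has)
    · exact hb (hsL hbs))] with t ht
  rcases h.mem_range t with ⟨a, rfl⟩ | ⟨b, rfl⟩
  · refine Or.inl ⟨a, ?_, rfl⟩
    by_contra ha
    exact ht (Or.inl ⟨a, fun ha' => ha (interior_subset ha'), rfl⟩)
  · refine Or.inr ⟨b, ?_, rfl⟩
    by_contra hb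
    exact ht (Or.inr ⟨b, fun hb' => hb (interior_subset hb'), rfl⟩)

lemma isOpen_preimage_connectedComponentIn [LocallyConnectedSpace A] (h : IsGluing α β i j)
    {F : Set S} (hF : IsOpen F) (s : S) : IsOpen (i ⁻¹' connectedComponentIn F s) := by
  rw [isOpen_iff_mem_nhds]
  intro a ha
  have haF : a ∈ i ⁻¹' F := (mem_of_mem_connectedComponentIn ha :)
  filter_upwards [(hF.preimage h.continuous_left).connectedComponentIn.mem_nhds
    (mem_connectedComponentIn haF)] with b hb
  have := (isPreconnected_connectedComponentIn.image i
    h.continuous_left.continuousOn).subset_connectedComponentIn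
    ⟨a, mem_connectedComponentIn haF, rfl⟩
    (image_subset_iff.2 (connectedComponentIn_subset (i ⁻¹' F) a))
  rw [← connectedComponentIn_eq ha] at this
  exact this ⟨b, hb, rfl⟩

lemma locallyConnectedSpace [LocallyConnectedSpace A] [LocallyConnectedSpace B]
    (h : IsGluing α β i j) : LocallyConnectedSpace S := by
  rw [locallyConnectedSpace_iff_connectedComponentIn_open]
  exact fun F hF s _ => (h.isOpen_iff _).2 ⟨h.isOpen_preimage_connectedComponentIn hF s,
    h.symm.isOpen_preimage_connectedComponentIn hF s⟩

lemma connectedSpace [ConnectedSpace A] [ConnectedSpace B] [Nonempty Z] (h : IsGluing α β i j) :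
    ConnectedSpace S := by
  rw [connectedSpace_iff_univ, ← h.image_union_image_eq_univ]
  obtain ⟨z⟩ := ‹Nonempty Z›
  exact IsConnected.union ⟨i (α z), ⟨α z, rfl⟩, ⟨β z, ((h.glue _ _).2 ⟨z, rfl, rfl⟩).symm⟩⟩
    (isConnected_range h.continuous_left) (isConnected_range h.symm.continuous_left)

/-! ### Unbounded components after gluing -/

section Count

variable {K : Set A} {L : Set B} {T : Set Z}

/-- Because `K` and `L` have the same trace `T` on the seam, removing `j '' L` from `S` removes
nothing from `A` beyond `K`. -/
lemma preimage_union_image (h : IsGluing α β i j) (hK : α ⁻¹' K = T) (hL : β ⁻¹' L = T) :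
    i ⁻¹' (i '' K ∪ j '' L) = K := by
  rw [preimage_union, preimage_image_eq K h.injective_left, h.symm.preimage_right_image_left, hL,
    ← hK]
  exact union_eq_left.2 (image_preimage_subset _ _)

lemma compl_preimage_left (h : IsGluing α β i j) (hK : α ⁻¹' K = T) (hL : β ⁻¹' L = T) {p : A} :
    i p ∈ (i '' K ∪ j '' L)ᶜ ↔ p ∈ Kᶜ := by
  rw [mem_compl_iff, mem_compl_iff, ← mem_preimage, h.preimage_union_image hK hL]

/-- A component that avoids the seam is not affected by gluing: its image has empty preimage on the
other side, so it is open in `S`. -/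
lemma connectedComponentIn_left [T2Space A] [LocallyConnectedSpace A] (h : IsGluing α β i j)
    (hα : IsClosedEmbedding α) (hβ : IsClosedEmbedding β) (hKc : IsCompact K)
    (hK : α ⁻¹' K = T) (hL : β ⁻¹' L = T) {p : A} (hp : p ∈ Kᶜ)
    (hd : Disjoint (connectedComponentIn Kᶜ p) (range α)) :
    connectedComponentIn (i '' K ∪ j '' L)ᶜ (i p) = i '' connectedComponentIn Kᶜ p := by
  have hcl := h.isClosedEmbedding_left hα.continuous hβ
  refine connectedComponentIn_eq_of_isOpen (isPreconnected_connectedComponentIn.image _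
    h.continuous_left.continuousOn) ?_ ?_ ?_ ⟨p, mem_connectedComponentIn hp, rfl⟩
  · rintro _ ⟨q, hq, rfl⟩
    exact (h.compl_preimage_left hK hL).2 (mem_of_mem_connectedComponentIn hq)
  · rw [h.isOpen_iff, preimage_image_eq _ h.injective_left, h.preimage_right_image_left]
    refine ⟨hKc.isClosed.isOpen_compl.connectedComponentIn, ?_⟩
    convert isOpen_empty
    rw [image_eq_empty, ← subset_empty_iff]
    exact fun z hz => hd.le_bot ⟨hz, z, rfl⟩
  · rw [hcl.closure_image_eq]
    rintro _ ⟨⟨q, hq, rfl⟩, hqJ⟩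
    exact ⟨q, closure_connectedComponentIn_inter_subset _ _
      ⟨hq, (h.compl_preimage_left hK hL).1 hqJ⟩, rfl⟩

/-- Both components meet the seam exactly in `Tᶜ`. Their union therefore has open preimages on both
sides, and it is connected through the point `z` of the seam. -/
lemma connectedComponentIn_glued [T2Space A] [LocallyConnectedSpace A] [T2Space B]
    [LocallyConnectedSpace B] (h : IsGluing α β i j)
    (hα : IsClosedEmbedding α) (hβ : IsClosedEmbedding β) (hKc : IsCompact K) (hLc : IsCompact L)
    (hK : α ⁻¹' K = T) (hL : β ⁻¹' L = T) {z : Z} (hz : z ∈ Tᶜ)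
    (hKj : α '' Tᶜ ⊆ connectedComponentIn Kᶜ (α z))
    (hLj : β '' Tᶜ ⊆ connectedComponentIn Lᶜ (β z)) {s : S}
    (hs : s ∈ i '' connectedComponentIn Kᶜ (α z) ∪ j '' connectedComponentIn Lᶜ (β z)) :
    connectedComponentIn (i '' K ∪ j '' L)ᶜ s =
      i '' connectedComponentIn Kᶜ (α z) ∪ j '' connectedComponentIn Lᶜ (β z) := by
  have hαz : α z ∈ connectedComponentIn Kᶜ (α z) := hKj ⟨z, hz, rfl⟩
  have hβz : β z ∈ connectedComponentIn Lᶜ (β z) := hLj ⟨z, hz, rfl⟩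
  have hcl := h.isClosedEmbedding_left hα.continuous hβ
  have hcr := h.symm.isClosedEmbedding_left hβ.continuous hα
  have hpre1 : α ⁻¹' connectedComponentIn Kᶜ (α z) = Tᶜ := by
    refine Subset.antisymm (fun w hw hwT => ?_) fun w hw => hKj ⟨w, hw, rfl⟩
    rw [← hK] at hwT
    exact (mem_of_mem_connectedComponentIn hw :) hwT
  have hpre2 : β ⁻¹' connectedComponentIn Lᶜ (β z) = Tᶜ := by
    refine Subset.antisymm (fun w hw hwT => ?_) fun w hw => hLj ⟨w, hw, rfl⟩
    rw [← hL] at hwT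
    exact (mem_of_mem_connectedComponentIn hw :) hwT
  refine connectedComponentIn_eq_of_isOpen ?_ ?_ ?_ ?_ hs
  · exact IsPreconnected.union (i (α z)) ⟨_, hαz, rfl⟩
      ⟨_, hβz, ((h.glue _ _).2 ⟨z, rfl, rfl⟩).symm⟩
      (isPreconnected_connectedComponentIn.image _ h.continuous_left.continuousOn)
      (isPreconnected_connectedComponentIn.image _ h.symm.continuous_left.continuousOn)
  · rintro _ (⟨q, hq, rfl⟩ | ⟨q, hq, rfl⟩)
    · exact (h.compl_preimage_left hK hL).2 (mem_of_mem_connectedComponentIn hq)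
    · rw [union_comm]
      exact (h.symm.compl_preimage_left hL hK).2 (mem_of_mem_connectedComponentIn hq)
  · rw [h.isOpen_iff, h.preimage_union_image hpre1 hpre2, union_comm,
      h.symm.preimage_union_image hpre2 hpre1]
    exact ⟨hKc.isClosed.isOpen_compl.connectedComponentIn,
      hLc.isClosed.isOpen_compl.connectedComponentIn⟩
  · rw [closure_union, hcl.closure_image_eq, hcr.closure_image_eq]
    rintro _ ⟨⟨q, hq, rfl⟩ | ⟨q, hq, rfl⟩, hqJ⟩
    · exact Or.inl ⟨q, closure_connectedComponentIn_inter_subset _ _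
        ⟨hq, (h.compl_preimage_left hK hL).1 hqJ⟩, rfl⟩
    · rw [union_comm] at hqJ
      exact Or.inr ⟨q, closure_connectedComponentIn_inter_subset _ _
        ⟨hq, (h.symm.compl_preimage_left hL hK).1 hqJ⟩, rfl⟩

/-- Exactly one component on each side, `V₀` and `W₀`, meets the seam. These two are unbounded since
`Tᶜ` is, and they become one component. All others survive unchanged, so one component is lost. The
statement adds 1 on the left to avoid subtraction of extended natural numbers. -/
lemma encard_unboundedComponents [T2Space A] [LocallyConnectedSpace A] [T2Space B]
    [LocallyConnectedSpace B] (h : IsGluing α β i j)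
    (hα : IsClosedEmbedding α) (hβ : IsClosedEmbedding β) (hKc : IsCompact K) (hLc : IsCompact L)
    (hK : α ⁻¹' K = T) (hL : β ⁻¹' L = T) (hT : ¬ IsCompact (closure Tᶜ))
    (hKj : ∃ C ⊆ Kᶜ, IsPreconnected C ∧ α '' Tᶜ ⊆ C)
    (hLj : ∃ C ⊆ Lᶜ, IsPreconnected C ∧ β '' Tᶜ ⊆ C) :
    (unboundedComponents (i '' K ∪ j '' L)ᶜ).encard + 1 =
      (unboundedComponents Kᶜ).encard + (unboundedComponents Lᶜ).encard := by
  have hcl := h.isClosedEmbedding_left hα.continuous hβ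
  have hcr := h.symm.isClosedEmbedding_left hβ.continuous hα
  obtain ⟨z, hz⟩ : Tᶜ.Nonempty := by
    by_contra hne
    rw [not_nonempty_iff_eq_empty] at hne
    rw [hne, closure_empty] at hT
    exact hT isCompact_empty
  replace hKj : α '' Tᶜ ⊆ connectedComponentIn Kᶜ (α z) := by
    obtain ⟨C, hCK, hC, hTC⟩ := hKj
    exact hTC.trans (hC.subset_connectedComponentIn (hTC ⟨z, hz, rfl⟩) hCK)
  replace hLj : β '' Tᶜ ⊆ connectedComponentIn Lᶜ (β z) := by
    obtain ⟨C, hCK, hC, hTC⟩ := hLj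
    exact hTC.trans (hC.subset_connectedComponentIn (hTC ⟨z, hz, rfl⟩) hCK)
  have hunb : ∀ {V : Set A}, α '' Tᶜ ⊆ V → ¬ IsCompact (closure V) := by
    intro V hV hc
    refine hT ((hα.isCompact_preimage hc).of_isClosed_subset isClosed_closure
      (closure_minimal ?_ (isClosed_closure.preimage hα.continuous)))
    exact fun w hw => subset_closure (hV ⟨w, hw, rfl⟩)
  have hunb' : ∀ {V : Set B}, β '' Tᶜ ⊆ V → ¬ IsCompact (closure V) := by
    intro V hV hc
    refine hT ((hβ.isCompact_preimage hc).of_isClosed_subset isClosed_closure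
      (closure_minimal ?_ (isClosed_closure.preimage hβ.continuous)))
    exact fun w hw => subset_closure (hV ⟨w, hw, rfl⟩)
  have hαz : α z ∈ Kᶜ := (mem_of_mem_connectedComponentIn (hKj ⟨z, hz, rfl⟩) :)
  have hβz : β z ∈ Lᶜ := (mem_of_mem_connectedComponentIn (hLj ⟨z, hz, rfl⟩) :)
  set V₀ := connectedComponentIn Kᶜ (α z)
  set W₀ := connectedComponentIn Lᶜ (β z)
  have hV₀ : V₀ ∈ unboundedComponents Kᶜ := ⟨⟨α z, hαz, rfl⟩, hunb hKj⟩
  have hW₀ : W₀ ∈ unboundedComponents Lᶜ := ⟨⟨β z, hβz, rfl⟩, hunb' hLj⟩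
  have hglued : ∀ s ∈ i '' V₀ ∪ j '' W₀,
      connectedComponentIn (i '' K ∪ j '' L)ᶜ s = i '' V₀ ∪ j '' W₀ := fun s hs =>
    h.connectedComponentIn_glued hα hβ hKc hLc hK hL hz hKj hLj hs
  have hdisj : ∀ p ∈ Kᶜ, connectedComponentIn Kᶜ p ≠ V₀ →
      Disjoint (connectedComponentIn Kᶜ p) (range α) := by
    intro p hp hne
    rw [Set.disjoint_left]
    rintro _ hw ⟨w, rfl⟩
    refine hne ((connectedComponentIn_eq hw).trans (connectedComponentIn_eq (hKj ⟨w, ?_, rfl⟩)).symm)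
    intro hwT
    rw [← hK] at hwT
    exact (mem_of_mem_connectedComponentIn hw :) hwT
  have hdisj' : ∀ p ∈ Lᶜ, connectedComponentIn Lᶜ p ≠ W₀ →
      Disjoint (connectedComponentIn Lᶜ p) (range β) := by
    intro p hp hne
    rw [Set.disjoint_left]
    rintro _ hw ⟨w, rfl⟩
    refine hne ((connectedComponentIn_eq hw).trans (connectedComponentIn_eq (hLj ⟨w, ?_, rfl⟩)).symm)
    intro hwT
    rw [← hL] at hwT
    exact (mem_of_mem_connectedComponentIn hw :) hwT
  have hleft : ∀ p ∈ Kᶜ, connectedComponentIn Kᶜ p ≠ V₀ →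
      connectedComponentIn (i '' K ∪ j '' L)ᶜ (i p) = i '' connectedComponentIn Kᶜ p :=
    fun p hp hne => h.connectedComponentIn_left hα hβ hKc hK hL hp (hdisj p hp hne)
  have hright : ∀ p ∈ Lᶜ, connectedComponentIn Lᶜ p ≠ W₀ →
      connectedComponentIn (i '' K ∪ j '' L)ᶜ (j p) = j '' connectedComponentIn Lᶜ p := by
    intro p hp hne
    rw [union_comm]
    exact h.symm.connectedComponentIn_left hβ hα hLc hL hK hp (hdisj' p hp hne)
  have hmemL : ∀ p, i p ∈ (i '' K ∪ j '' L)ᶜ ↔ p ∈ Kᶜ := fun p => h.compl_preimage_left hK hL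
  have hmemR : ∀ p, j p ∈ (i '' K ∪ j '' L)ᶜ ↔ p ∈ Lᶜ := fun p => by
    rw [union_comm]
    exact h.symm.compl_preimage_left hL hK
  have hcompL : ∀ V : Set A, IsCompact (closure (i '' V)) ↔ IsCompact (closure V) := fun V => by
    rw [hcl.closure_image_eq, hcl.isInducing.isCompact_iff]
  have hcompR : ∀ V : Set B, IsCompact (closure (j '' V)) ↔ IsCompact (closure V) := fun V => by
    rw [hcr.closure_image_eq, hcr.isInducing.isCompact_iff]
  have heq : unboundedComponents (i '' K ∪ j '' L)ᶜ =
      insert (i '' V₀ ∪ j '' W₀) (image i '' (unboundedComponents Kᶜ \ {V₀}) ∪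
        image j '' (unboundedComponents Lᶜ \ {W₀})) := by
    ext D
    constructor
    · rintro ⟨⟨s, hs, rfl⟩, hD⟩
      by_cases hs0 : s ∈ i '' V₀ ∪ j '' W₀
      · exact Or.inl (hglued s hs0)
      · rcases h.mem_range s with ⟨p, rfl⟩ | ⟨p, rfl⟩
        · have hp := (hmemL p).1 hs
          have hne : connectedComponentIn Kᶜ p ≠ V₀ := fun he =>
            hs0 (Or.inl ⟨p, he ▸ mem_connectedComponentIn hp, rfl⟩)
          rw [hleft p hp hne, hcompL] at hD
          exact Or.inr (Or.inl ⟨_, ⟨⟨⟨p, hp, rfl⟩, hD⟩, hne⟩, (hleft p hp hne).symm⟩)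
        · have hp := (hmemR p).1 hs
          have hne : connectedComponentIn Lᶜ p ≠ W₀ := fun he =>
            hs0 (Or.inr ⟨p, he ▸ mem_connectedComponentIn hp, rfl⟩)
          rw [hright p hp hne, hcompR] at hD
          exact Or.inr (Or.inr ⟨_, ⟨⟨⟨p, hp, rfl⟩, hD⟩, hne⟩, (hright p hp hne).symm⟩)
    · rintro (rfl | ⟨V, ⟨⟨⟨p, hp, rfl⟩, hV⟩, hne⟩, rfl⟩ | ⟨V, ⟨⟨⟨p, hp, rfl⟩, hV⟩, hne⟩, rfl⟩)
      · refine ⟨⟨i (α z), (hmemL _).2 hαz, (hglued _ (Or.inl ⟨α z, hKj ⟨z, hz, rfl⟩, rfl⟩)).symm⟩,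
          fun hc => ?_⟩
        refine hunb hKj ((hcompL V₀).1 (hc.of_isClosed_subset isClosed_closure ?_))
        exact closure_mono subset_union_left
      · exact ⟨⟨i p, (hmemL _).2 hp, (hleft p hp hne).symm⟩, fun hc => hV ((hcompL _).1 hc)⟩
      · exact ⟨⟨j p, (hmemR _).2 hp, (hright p hp hne).symm⟩, fun hc => hV ((hcompR _).1 hc)⟩
  have hnot : i '' V₀ ∪ j '' W₀ ∉ image i '' (unboundedComponents Kᶜ \ {V₀}) ∪
        image j '' (unboundedComponents Lᶜ \ {W₀}) := by
    rintro (⟨V, ⟨hV, hne⟩, he⟩ | ⟨V, ⟨hV, hne⟩, he⟩)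
    · obtain ⟨p, hp, hpe⟩ : i (α z) ∈ i '' V := he ▸ Or.inl ⟨α z, hKj ⟨z, hz, rfl⟩, rfl⟩
      rw [h.injective_left hpe] at hp
      exact hne (hV.eq_of_mem hV₀ hp (hKj ⟨z, hz, rfl⟩))
    · obtain ⟨p, hp, hpe⟩ : j (β z) ∈ j '' V := he ▸ Or.inr ⟨β z, hLj ⟨z, hz, rfl⟩, rfl⟩
      rw [h.injective_right hpe] at hp
      exact hne (hV.eq_of_mem hW₀ hp (hLj ⟨z, hz, rfl⟩))
  have hdis : Disjoint (image i '' (unboundedComponents Kᶜ \ {V₀}))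
        (image j '' (unboundedComponents Lᶜ \ {W₀})) := by
    rw [Set.disjoint_left]
    rintro _ ⟨V, ⟨⟨⟨p, hp, rfl⟩, hV⟩, hne⟩, rfl⟩ ⟨W, ⟨hW, hne'⟩, he⟩
    obtain ⟨q, hq, hqe⟩ : i p ∈ j '' W := he ▸ ⟨p, mem_connectedComponentIn hp, rfl⟩
    obtain ⟨w, hw, -⟩ := (h.glue _ _).1 hqe.symm
    exact (Set.disjoint_left.1 (hdisj p hp hne) (mem_connectedComponentIn hp)) ⟨w, hw⟩
  rw [heq, encard_insert_of_notMem hnot, encard_union_eq hdis,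
    h.injective_left.image_injective.encard_image, h.injective_right.image_injective.encard_image,
    ← encard_sdiff_singleton_add_one hV₀, ← encard_sdiff_singleton_add_one hW₀]
  ring

end Count

end IsGluing

end Gluing

end EndTheory
end

noncomputable section
namespace EndTheory

set_option linter.unusedSectionVars false

open Set Topology Filter

/-! ### The number of ends of a glued space -/

section EndSplitting

variable {X Y Z S : Type*} [TopologicalSpace X] [TopologicalSpace Y] [TopologicalSpace Z]
  [TopologicalSpace S]

/-- The closed set `A` in `X` is the complement of the interior of a regular neighborhood `P` of
a ray: `α` embeds `Z` as the common boundary of `A` and `P`, and arbitrarily large compact sets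
split `X` nicely, with prescribed traces `T R` on the boundary. -/
structure IsEndSplitting (A : Set X) (α : Z → X) (T : ℝ → Set Z) : Prop where
  isClosed : IsClosed A
  isClosedEmbedding : IsClosedEmbedding α
  range_subset : range α ⊆ A
  isClosed_nbhd : IsClosed (Aᶜ ∪ range α)
  locallyConnectedSpace : LocallyConnectedSpace A
  connectedSpace : ConnectedSpace A
  split : ∀ K, IsCompact K → ∀ᶠ R in atTop, ∃ K', K ⊆ K' ∧ IsSplitBy A α K' (T R)

variable {A : Set X} {B : Set Y} {α : Z → X} {β : Z → Y} {T : ℝ → Set Z}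

/-- The embedding of the boundary as a map into `A`. -/
def IsEndSplitting.toSubtype (h : IsEndSplitting A α T) (z : Z) : A :=
  ⟨α z, h.range_subset ⟨z, rfl⟩⟩

lemma IsEndSplitting.isClosedEmbedding_toSubtype (h : IsEndSplitting A α T) :
    IsClosedEmbedding h.toSubtype :=
  (h.isClosed.isClosedEmbedding_subtypeVal.of_comp_iff).1 h.isClosedEmbedding

lemma IsSplitBy.join_subtype {K : Set X} {T : Set Z} (h : IsSplitBy A α K T) {a : Z → A}
    (ha : ∀ z, (a z : X) = α z) :
    ∃ C ⊆ (Subtype.val ⁻¹' K : Set A)ᶜ, IsPreconnected C ∧ a '' Tᶜ ⊆ C := by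
  obtain ⟨C, hCA, hC, hTC⟩ := h.join
  refine ⟨Subtype.val ⁻¹' C, fun y hy => (hCA hy).2, ?_, ?_⟩
  · rw [← IsInducing.subtypeVal.isPreconnected_image, Subtype.image_preimage_coe,
      inter_eq_right.2 fun y hy => (hCA hy).1]
    exact hC
  · rintro _ ⟨z, hz, rfl⟩
    rw [mem_preimage, ha]
    exact hTC ⟨z, hz, rfl⟩

variable [T2Space X] [SecondCountableTopology X] [LocallyCompactSpace X]
  [LocallyConnectedSpace X] [ConnectedSpace X] [T2Space Y] [SecondCountableTopology Y]
  [LocallyCompactSpace Y] [LocallyConnectedSpace Y] [ConnectedSpace Y]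

/-- The number of ends of two spaces glued along regular neighborhoods of rays. -/
theorem numEnds_gluing [Nonempty Z] (hA : IsEndSplitting A α T) (hB : IsEndSplitting B β T)
    (hT : ∀ R, ¬ IsCompact (closure (T R)ᶜ)) {i : A → S} {j : B → S}
    (h : IsGluing hA.toSubtype hB.toSubtype i j) :
    Nonempty (CompactExhaustion S) ∧
    ∀ (KX : CompactExhaustion X) (KY : CompactExhaustion Y) (KS : CompactExhaustion S),
      numEnds KS + 1 = numEnds KX + numEnds KY := by
  have := hA.locallyConnectedSpace
  have := hB.locallyConnectedSpace
  have := hA.connectedSpace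
  have := hB.connectedSpace
  have := hA.isClosed.locallyCompactSpace
  have := hB.isClosed.locallyCompactSpace
  have hα := hA.isClosedEmbedding_toSubtype
  have hβ := hB.isClosedEmbedding_toSubtype
  have := h.t2Space hα hβ
  have := h.weaklyLocallyCompactSpace hα hβ
  have := h.sigmaCompactSpace
  have := h.locallyConnectedSpace
  have := h.connectedSpace
  refine ⟨⟨CompactExhaustion.choice S⟩, fun KX KY KS => ?_⟩
  -- The exact count holds for cofinally many triples of compact sets. Enlarging arbitrary `K`, `L`
  -- and `J₀` simultaneously lets the suprema be compared in both directions.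
  have key : ∀ (K : TopologicalSpace.Compacts X) (L : TopologicalSpace.Compacts Y)
      (J₀ : TopologicalSpace.Compacts S), ∃ (K' : TopologicalSpace.Compacts X)
      (L' : TopologicalSpace.Compacts Y) (J : TopologicalSpace.Compacts S),
      (K : Set X) ⊆ K' ∧ (L : Set Y) ⊆ L' ∧ (J₀ : Set S) ⊆ J ∧
      (unboundedComponents (J : Set S)ᶜ).encard + 1 =
        (unboundedComponents (K' : Set X)ᶜ).encard +
          (unboundedComponents (L' : Set Y)ᶜ).encard := by
    intro K L J₀
    have hK₀ : IsCompact (Subtype.val '' (i ⁻¹' J₀)) :=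
      ((h.isClosedEmbedding_left hα.continuous hβ).isCompact_preimage J₀.isCompact).image
        continuous_subtype_val
    have hL₀ : IsCompact (Subtype.val '' (j ⁻¹' J₀)) :=
      ((h.symm.isClosedEmbedding_left hβ.continuous hα).isCompact_preimage J₀.isCompact).image
        continuous_subtype_val
    -- A splitting exists for all large `R`, so a single `R` serves both sides. This makes the two
    -- traces on the seam equal.
    obtain ⟨R, ⟨K', hKK', hK'⟩, ⟨L', hLL', hL'⟩⟩ := ((hA.split _ (K.isCompact.union hK₀)).and
      (hB.split _ (L.isCompact.union hL₀))).exists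
    have hK'A : IsCompact (Subtype.val ⁻¹' K' : Set A) :=
      hA.isClosed.isClosedEmbedding_subtypeVal.isCompact_preimage hK'.isCompact
    have hL'B : IsCompact (Subtype.val ⁻¹' L' : Set B) :=
      hB.isClosed.isClosedEmbedding_subtypeVal.isCompact_preimage hL'.isCompact
    refine ⟨⟨K', hK'.isCompact⟩, ⟨L', hL'.isCompact⟩, ⟨i '' (Subtype.val ⁻¹' K') ∪
      j '' (Subtype.val ⁻¹' L'), (hK'A.image h.continuous_left).union
        (hL'B.image h.symm.continuous_left)⟩, subset_union_left.trans hKK',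
        subset_union_left.trans hLL', ?_, ?_⟩
    · intro s hs
      rcases h.mem_range s with ⟨a, rfl⟩ | ⟨b, rfl⟩
      · exact Or.inl ⟨a, hKK' (Or.inr ⟨a, hs, rfl⟩), rfl⟩
      · exact Or.inr ⟨b, hLL' (Or.inr ⟨b, hs, rfl⟩), rfl⟩
    · have e1 := hK'.encard_unboundedComponents hA.isClosed hA.range_subset hA.isClosedEmbedding
        hA.isClosed_nbhd (hT R)
      have e2 := hL'.encard_unboundedComponents hB.isClosed hB.range_subset hB.isClosedEmbedding
        hB.isClosed_nbhd (hT R)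
      have e3 := h.encard_unboundedComponents hα hβ hK'A hL'B hK'.preimage_eq hL'.preimage_eq (hT R)
        (hK'.join_subtype fun _ => rfl) (hL'.join_subtype fun _ => rfl)
      rw [e1, e2] at e3
      exact e3
  simp only [numEnds_eq_iSup_compacts]
  apply le_antisymm
  · rw [ENat.iSup_add]
    refine iSup_le fun J₀ => ?_
    obtain ⟨K', L', J, -, -, hJ, he⟩ := key ⊥ ⊥ J₀
    calc _ ≤ (unboundedComponents (J : Set S)ᶜ).encard + 1 :=
          add_le_add (encard_unboundedComponents_mono J.isCompact hJ) le_rfl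
      _ = _ := he
      _ ≤ _ := add_le_add
        (le_iSup (fun C : TopologicalSpace.Compacts X => (unboundedComponents (C : Set X)ᶜ).encard) K')
        (le_iSup (fun C : TopologicalSpace.Compacts Y => (unboundedComponents (C : Set Y)ᶜ).encard) L')
  · refine ENat.iSup_add_iSup_le fun K L => ?_
    obtain ⟨K', L', J, hK, hL, -, he⟩ := key K L ⊥
    calc _ ≤ (unboundedComponents (K' : Set X)ᶜ).encard +
          (unboundedComponents (L' : Set Y)ᶜ).encard :=
          add_le_add (encard_unboundedComponents_mono K'.isCompact hK)
            (encard_unboundedComponents_mono L'.isCompact hL)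
      _ = _ := he.symm
      _ ≤ _ := add_le_add (le_iSup (fun C : TopologicalSpace.Compacts S =>
          (unboundedComponents (C : Set S)ᶜ).encard) J) le_rfl

end EndSplitting

end EndTheory
end

noncomputable section
namespace EndTheory

set_option linter.unusedSectionVars false

open Set Topology Filter

/-! ### C¹ extension across the boundary of the half-space -/

section Reflection

variable {m : ℕ} [NeZero m]

/-- The closed half-space `{x | 0 ≤ x 0}` as a subset of Euclidean space. -/
def halfSpace (m : ℕ) [NeZero m] : Set (EuclideanSpace ℝ (Fin m)) := {x | 0 ≤ x 0}

lemma convex_halfSpace : Convex ℝ (halfSpace m) := EuclideanHalfSpace.convex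

lemma range_modelWithCorners_halfSpace : range (𝓡∂ m) = halfSpace m :=
  range_euclideanHalfSpace m

lemma uniqueDiffOn_halfSpace : UniqueDiffOn ℝ (halfSpace m) := by
  rw [← range_modelWithCorners_halfSpace]
  exact (𝓡∂ m).uniqueDiffOn

/-- The point `x + c • max (-x 0) 0 • e₀`; for `c = 1` this is the projection to the half-space
and for `c = 2` the reflection into it. -/
def pushHalf (c : ℝ) (x : EuclideanSpace ℝ (Fin m)) : EuclideanSpace ℝ (Fin m) :=
  x + (c * max (-x 0) 0) • EuclideanSpace.single 0 1

lemma pushHalf_apply_zero (c : ℝ) (x : EuclideanSpace ℝ (Fin m)) :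
    pushHalf c x 0 = x 0 + c * max (-x 0) 0 := by
  simp [pushHalf]

lemma pushHalf_mem {c : ℝ} (hc : 1 ≤ c) (x : EuclideanSpace ℝ (Fin m)) :
    pushHalf c x ∈ halfSpace m := by
  change 0 ≤ pushHalf c x 0
  rw [pushHalf_apply_zero]
  nlinarith [le_max_left (-x 0) 0, le_max_right (-x 0) 0]

lemma pushHalf_of_mem (c : ℝ) {x : EuclideanSpace ℝ (Fin m)} (hx : x ∈ halfSpace m) :
    pushHalf c x = x := by
  have : max (-x 0) 0 = 0 := max_eq_right (neg_nonpos.2 hx)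
  simp [pushHalf, this]

lemma norm_pushHalf_sub_le {c : ℝ} (hc : 0 ≤ c) (x y : EuclideanSpace ℝ (Fin m)) :
    ‖pushHalf c x - pushHalf c y‖ ≤ (1 + c) * ‖x - y‖ := by
  have h1 : pushHalf c x - pushHalf c y =
      (x - y) + (c * (max (-x 0) 0 - max (-y 0) 0)) • EuclideanSpace.single 0 1 := by
    simp only [pushHalf, mul_sub, sub_smul]
    abel
  have h2 : |max (-x 0) 0 - max (-y 0) 0| ≤ ‖x - y‖ := by
    calc _ ≤ |(-x 0) - (-y 0)| := abs_max_sub_max_le_abs _ _ _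
      _ = ‖(x - y) 0‖ := by
        rw [Real.norm_eq_abs, ← abs_neg]
        congr 1
        simp
        ring
      _ ≤ ‖x - y‖ := PiLp.norm_apply_le _ _
  rw [h1]
  calc _ ≤ ‖x - y‖ + ‖(c * (max (-x 0) 0 - max (-y 0) 0)) •
        (EuclideanSpace.single 0 1 : EuclideanSpace ℝ (Fin m))‖ := norm_add_le _ _
    _ = ‖x - y‖ + c * |max (-x 0) 0 - max (-y 0) 0| := by
        rw [norm_smul, PiLp.norm_single, norm_one, mul_one, Real.norm_eq_abs, abs_mul,
          abs_of_nonneg hc]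
    _ ≤ _ := by nlinarith

variable {F : Type*} [NormedAddCommGroup F] [NormedSpace ℝ F]

/-- The extension of a function on the half-space by reflection in value and argument. -/
def reflectExtend (f : EuclideanSpace ℝ (Fin m) → F) (x : EuclideanSpace ℝ (Fin m)) : F :=
  (2 : ℝ) • f (pushHalf 1 x) - f (pushHalf 2 x)

lemma reflectExtend_of_mem (f : EuclideanSpace ℝ (Fin m) → F) {x : EuclideanSpace ℝ (Fin m)}
    (hx : x ∈ halfSpace m) : reflectExtend f x = f x := by
  rw [reflectExtend, pushHalf_of_mem _ hx, pushHalf_of_mem _ hx, two_smul, add_sub_cancel_right]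

/-- A `C¹` function on the half-space is strictly differentiable within the half-space. -/
lemma exists_ball_norm_sub_sub_le {f : EuclideanSpace ℝ (Fin m) → F}
    {p : EuclideanSpace ℝ (Fin m)} (hp : p ∈ halfSpace m)
    (hf : ContDiffWithinAt ℝ 1 f (halfSpace m) p) {ε : ℝ} (hε : 0 < ε) :
    ∃ δ > 0, ∀ u ∈ halfSpace m ∩ Metric.ball p δ, ∀ v ∈ halfSpace m ∩ Metric.ball p δ,
      ‖f u - f v - fderivWithin ℝ f (halfSpace m) p (u - v)‖ ≤ ε * ‖u - v‖ := by
  obtain ⟨s, hs, -, f', hf', hc⟩ :=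
    (contDiffWithinAt_succ_iff_hasFDerivWithinAt (n := 0) (by simp)).1 (by simpa using hf)
  rw [insert_eq_of_mem hp] at hs
  have hps : p ∈ s := mem_of_mem_nhdsWithin hp hs
  have hD : f' p = fderivWithin ℝ f (halfSpace m) p :=
    (((hf' p hps).mono_of_mem_nhdsWithin hs).fderivWithin (uniqueDiffOn_halfSpace p hp)).symm
  have hcont : ContinuousWithinAt f' (halfSpace m) p :=
    hc.continuousWithinAt.mono_of_mem_nhdsWithin hs
  have hev : ∀ᶠ x in 𝓝[halfSpace m] p, x ∈ s ∧ ‖f' x - f' p‖ ≤ ε := by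
    filter_upwards [hs, hcont (Metric.closedBall_mem_nhds _ hε)] with x hx hx'
    exact ⟨hx, by simpa [dist_eq_norm] using hx'⟩
  obtain ⟨δ, hδ, hball⟩ := Metric.mem_nhdsWithin_iff.1 hev
  refine ⟨δ, hδ, fun u hu v hv => ?_⟩
  rw [← hD]
  refine Convex.norm_image_sub_le_of_norm_hasFDerivWithin_le' (𝕜 := ℝ) (f' := f')
    (s := halfSpace m ∩ Metric.ball p δ) (fun x hx => ?_) (fun x hx => ?_)
    (convex_halfSpace.inter (convex_ball _ _)) hv hu
  · exact (hf' x (hball ⟨hx.2, hx.1⟩).1).mono fun y hy => (hball ⟨hy.2, hy.1⟩).1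
  · exact (hball ⟨hx.2, hx.1⟩).2

/-- The maps `pushHalf 1` and `pushHalf 2` are only Lipschitz, but twice the first minus the second
is the identity. The linear parts of the two terms therefore add up to the derivative of `f`
exactly, and the remainders are controlled by strict differentiability on the half-space. -/
lemma hasStrictFDerivAt_reflectExtend {f : EuclideanSpace ℝ (Fin m) → F}
    {p : EuclideanSpace ℝ (Fin m)} (hp : p ∈ halfSpace m)
    (hf : ContDiffWithinAt ℝ 1 f (halfSpace m) p) :
    HasStrictFDerivAt (reflectExtend f) (fderivWithin ℝ f (halfSpace m) p) p := by
  refine HasStrictFDerivAt.of_isLittleO (Asymptotics.isLittleO_iff.2 fun ε hε => ?_)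
  -- The Lipschitz constants of `pushHalf 1` and `pushHalf 2` are at most 2 and 3. The total error
  -- factor is 2 · 2 + 3 = 7, and points within `δ / 3` of `p` are pushed to points within `δ`.
  obtain ⟨δ, hδ, h⟩ := exists_ball_norm_sub_sub_le hp hf (ε := ε / 7) (by positivity)
  have hnear : ∀ x ∈ Metric.ball p (δ / 3), ∀ c : ℝ, 1 ≤ c → c ≤ 2 →
      pushHalf c x ∈ halfSpace m ∩ Metric.ball p δ := by
    intro x hx c hc hc'
    refine ⟨pushHalf_mem hc x, ?_⟩
    rw [Metric.mem_ball, dist_eq_norm] at hx ⊢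
    have := norm_pushHalf_sub_le (zero_le_one.trans hc) x p
    rw [pushHalf_of_mem c hp] at this
    nlinarith [norm_nonneg (x - p)]
  have hmem : Metric.ball p (δ / 3) ×ˢ Metric.ball p (δ / 3) ∈ 𝓝 (p, p) :=
    prod_mem_nhds (Metric.ball_mem_nhds _ (by positivity)) (Metric.ball_mem_nhds _ (by positivity))
  filter_upwards [hmem] with ⟨x, y⟩ ⟨hx, hy⟩
  set D := fderivWithin ℝ f (halfSpace m) p
  have hsplit : reflectExtend f x - reflectExtend f y - D (x - y) =
      (2 : ℝ) • (f (pushHalf 1 x) - f (pushHalf 1 y) - D (pushHalf 1 x - pushHalf 1 y)) -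
        (f (pushHalf 2 x) - f (pushHalf 2 y) - D (pushHalf 2 x - pushHalf 2 y)) := by
    have hlin : x - y = (2 : ℝ) • (pushHalf 1 x - pushHalf 1 y) -
        (pushHalf 2 x - pushHalf 2 y) := by
      simp only [pushHalf]
      module
    conv_lhs => rw [hlin]
    rw [map_sub, map_smul]
    simp only [reflectExtend]
    module
  change ‖reflectExtend f x - reflectExtend f y - D (x - y)‖ ≤ ε * ‖x - y‖
  rw [hsplit]
  have h1 := h _ (hnear x hx 1 le_rfl one_le_two) _ (hnear y hy 1 le_rfl one_le_two)
  have h2 := h _ (hnear x hx 2 one_le_two le_rfl) _ (hnear y hy 2 one_le_two le_rfl)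
  have n1 := norm_pushHalf_sub_le zero_le_one x y
  have n2 := norm_pushHalf_sub_le zero_le_two x y
  calc _ ≤ ‖(2 : ℝ) • (f (pushHalf 1 x) - f (pushHalf 1 y) - D (pushHalf 1 x - pushHalf 1 y))‖ +
        ‖f (pushHalf 2 x) - f (pushHalf 2 y) - D (pushHalf 2 x - pushHalf 2 y)‖ := norm_sub_le _ _
    _ ≤ 2 * (ε / 7 * ((1 + 1) * ‖x - y‖)) + ε / 7 * ((1 + 2) * ‖x - y‖) := by
        rw [norm_smul, Real.norm_eq_abs, abs_two]
        refine add_le_add (mul_le_mul_of_nonneg_left (h1.trans ?_) zero_le_two) (h2.trans ?_)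
        · exact mul_le_mul_of_nonneg_left n1 (by positivity)
        · exact mul_le_mul_of_nonneg_left n2 (by positivity)
    _ = _ := by ring

end Reflection

/-! ### Local structure of the complement of the neighborhood -/

section Collar

variable {m : ℕ} [NeZero m] {M : Type*} [TopologicalSpace M]
  [ChartedSpace (EuclideanHalfSpace m) M]

/-- The chart at `c`, restricted to the points mapped to the interior of the half-space. -/
def interiorChart (m : ℕ) [NeZero m] {M : Type*} [TopologicalSpace M]
    [ChartedSpace (EuclideanHalfSpace m) M] (c : M) :
    OpenPartialHomeomorph M (EuclideanSpace ℝ (Fin m)) where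
  toFun := extChartAt (𝓡∂ m) c
  invFun := (extChartAt (𝓡∂ m) c).symm
  source := (chartAt (EuclideanHalfSpace m) c).source ∩
    extChartAt (𝓡∂ m) c ⁻¹' interior (extChartAt (𝓡∂ m) c).target
  target := interior (extChartAt (𝓡∂ m) c).target
  map_source' _ hx := hx.2
  map_target' x hx := ⟨by
    rw [← extChartAt_source (𝓡∂ m)]
    exact (extChartAt (𝓡∂ m) c).map_target (interior_subset hx), by
    rw [mem_preimage, (extChartAt (𝓡∂ m) c).right_inv (interior_subset hx)]
    exact hx⟩
  left_inv' x hx := (extChartAt (𝓡∂ m) c).left_inv (by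
    rw [extChartAt_source]
    exact hx.1)
  right_inv' x hx := (extChartAt (𝓡∂ m) c).right_inv (interior_subset hx)
  open_source := isOpen_extChartAt_preimage c isOpen_interior
  open_target := isOpen_interior
  continuousOn_toFun := (continuousOn_extChartAt c).mono fun x hx => by
    rw [extChartAt_source]
    exact hx.1
  continuousOn_invFun := (continuousOn_extChartAt_symm c).mono interior_subset

lemma mem_interiorChart_source {c : M} (hc : c ∈ (𝓡∂ m).interior M) :
    c ∈ (interiorChart m c).source :=
  ⟨mem_chart_source _ c, ModelWithCorners.isInteriorPoint_iff.1 hc⟩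

lemma IsSmoothProperEmbedding.isClosedEmbedding {k : ℕ} [NeZero k] {Φ : EuclideanHalfSpace k → M}
    (hΦ : IsSmoothProperEmbedding k m Φ) : IsClosedEmbedding Φ :=
  IsClosedEmbedding.of_continuous_injective_isClosedMap hΦ.isProperMap.continuous hΦ.injective
    hΦ.isProperMap.isClosedMap

/-- The expression of `Φ` in the chart at `Φ p`. -/
def chartExpr (Φ : EuclideanHalfSpace m → M) (p : EuclideanHalfSpace m)
    (x : EuclideanSpace ℝ (Fin m)) : EuclideanSpace ℝ (Fin m) :=
  extChartAt (𝓡∂ m) (Φ p) (Φ ((𝓡∂ m).symm x))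

lemma halfSpace_symm_coe (p : EuclideanHalfSpace m) : (𝓡∂ m).symm p.1 = p :=
  (𝓡∂ m).left_inv p

variable [IsManifold (𝓡∂ m) ∞ M]

lemma IsSmoothProperEmbedding.contDiffWithinAt_chartExpr {Φ : EuclideanHalfSpace m → M}
    (hΦ : IsSmoothProperEmbedding m m Φ) (p : EuclideanHalfSpace m) :
    ContDiffWithinAt ℝ ∞ (chartExpr Φ p) (halfSpace m) p.1 := by
  have h := (contMDiffAt_iff.1 (hΦ.contMDiff p)).2
  rw [range_modelWithCorners_halfSpace] at h
  exact h

lemma IsSmoothProperEmbedding.exists_equiv_fderivWithin {Φ : EuclideanHalfSpace m → M}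
    (hΦ : IsSmoothProperEmbedding m m Φ) (p : EuclideanHalfSpace m) :
    ∃ D : EuclideanSpace ℝ (Fin m) ≃L[ℝ] EuclideanSpace ℝ (Fin m),
      (D : EuclideanSpace ℝ (Fin m) →L[ℝ] EuclideanSpace ℝ (Fin m)) =
        fderivWithin ℝ (chartExpr Φ p) (halfSpace m) p.1 := by
  have hd : MDifferentiableAt (𝓡∂ m) (𝓡∂ m) Φ p :=
    (hΦ.contMDiff p).mdifferentiableAt (by simp)
  have hinj := hΦ.mfderiv_injective p
  have he : mfderiv (𝓡∂ m) (𝓡∂ m) Φ p = fderivWithin ℝ (chartExpr Φ p) (halfSpace m) p.1 := by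
    rw [hd.mfderiv, range_modelWithCorners_halfSpace]
    rfl
  have hinj' : Function.Injective (fderivWithin ℝ (chartExpr Φ p) (halfSpace m) p.1) := by
    have : ⇑(fderivWithin ℝ (chartExpr Φ p) (halfSpace m) p.1) =
      ⇑(mfderiv (𝓡∂ m) (𝓡∂ m) Φ p) := by rw [he]; rfl
    rw [this]
    exact hinj
  refine ⟨(LinearEquiv.ofInjectiveEndo _ hinj').toContinuousLinearEquiv, ?_⟩
  ext x
  rfl

/-- Near any point of the half-space, `Φ` extends to a local homeomorphism. -/
theorem IsSmoothProperEmbedding.exists_openPartialHomeomorph {Φ : EuclideanHalfSpace m → M}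
    (hΦ : IsSmoothProperEmbedding m m Φ) (p : EuclideanHalfSpace m) :
    ∃ G : OpenPartialHomeomorph (EuclideanSpace ℝ (Fin m)) M, p.1 ∈ G.source ∧
      (∀ q : EuclideanHalfSpace m, q.1 ∈ G.source → G q.1 = Φ q) ∧
      ∀ q : EuclideanHalfSpace m, Φ q ∈ G.target → q.1 ∈ G.source := by
  obtain ⟨D, hD⟩ := hΦ.exists_equiv_fderivWithin p
  have hstrict := hasStrictFDerivAt_reflectExtend p.2
    ((hΦ.contDiffWithinAt_chartExpr p).of_le (by exact_mod_cast le_top))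
  rw [show (fderivWithin ℝ (chartExpr Φ p) (halfSpace m) p.1) = D from hD.symm] at hstrict
  -- The inverse function theorem needs only a strict derivative at the single point `p`, which the
  -- reflected extension has even on the boundary hyperplane.
  set h := hstrict.toOpenPartialHomeomorph
  set c := interiorChart m (Φ p)
  have hval : reflectExtend (chartExpr Φ p) p.1 = c (Φ p) := by
    rw [reflectExtend_of_mem _ p.2, chartExpr, halfSpace_symm_coe]
    rfl
  -- Restricting to `W` keeps `Φ q` in the source of the chart, where the chart can be undone and
  -- the extension really agrees with `Φ`.
  obtain ⟨W, hW, hWΦ⟩ := isOpen_induced_iff.1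
    ((chartAt (EuclideanHalfSpace m) (Φ p)).open_source.preimage hΦ.isProperMap.continuous)
  set G₀ := (h.trans c.symm).restrOpen W hW
  have hmemG₀ : ∀ x, x ∈ G₀.source ↔ (x ∈ h.source ∧ reflectExtend (chartExpr Φ p) x ∈ c.target) ∧
    x ∈ W := fun x => Iff.rfl
  have hpG₀ : p.1 ∈ G₀.source := by
    refine (hmemG₀ _).2 ⟨⟨hstrict.mem_toOpenPartialHomeomorph_source, ?_⟩, ?_⟩
    · rw [hval]
      exact c.map_source (mem_interiorChart_source (hΦ.mem_interior p))
    · have : p ∈ Subtype.val ⁻¹' W := by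
        rw [hWΦ]
        exact mem_chart_source _ _
      exact this
  have hG₀ : ∀ q : EuclideanHalfSpace m, q.1 ∈ G₀.source → G₀ q.1 = Φ q := by
    intro q hq
    have hqW : q ∈ Φ ⁻¹' (chartAt (EuclideanHalfSpace m) (Φ p)).source := by
      rw [← hWΦ]
      exact ((hmemG₀ _).1 hq).2
    change (extChartAt (𝓡∂ m) (Φ p)).symm (reflectExtend (chartExpr Φ p) q.1) = Φ q
    rw [reflectExtend_of_mem _ q.2, chartExpr, halfSpace_symm_coe]
    exact (extChartAt (𝓡∂ m) (Φ p)).left_inv (by rw [extChartAt_source]; exact hqW)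
  -- Since `Φ` is an embedding, the target can be shrunk so that no distant part of `Φ` returns to
  -- it.
  obtain ⟨U, hU, hUG⟩ := hΦ.isClosedEmbedding.isInducing.isOpen_iff.1
    (G₀.open_source.preimage continuous_subtype_val)
  refine ⟨(G₀.symm.restrOpen U hU).symm, ?_, ?_, ?_⟩
  · refine ⟨hpG₀, ?_⟩
    change G₀ p.1 ∈ U
    rw [hG₀ p hpG₀]
    have : p ∈ Φ ⁻¹' U := hUG ▸ hpG₀
    exact this
  · exact fun q hq => hG₀ q hq.1
  · intro q hq
    have hqU : Φ q ∈ U := hq.2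
    have hqG : q.1 ∈ G₀.source := by
      have : q ∈ Φ ⁻¹' U := hqU
      rw [hUG] at this
      exact this
    refine ⟨hqG, ?_⟩
    change G₀ q.1 ∈ U
    rwa [hG₀ q hqG]

/-- `Φ` maps the open half-space to an open set. -/
lemma IsSmoothProperEmbedding.isOpen_image_interior {Φ : EuclideanHalfSpace m → M}
    (hΦ : IsSmoothProperEmbedding m m Φ) : IsOpen (Φ '' {x | 0 < x.1 0}) := by
  rw [isOpen_iff_mem_nhds]
  rintro _ ⟨p, hp, rfl⟩
  obtain ⟨G, hpG, hG, -⟩ := hΦ.exists_openPartialHomeomorph p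
  have ho : IsOpen {x : EuclideanSpace ℝ (Fin m) | 0 < x 0} :=
    isOpen_lt continuous_const (EuclideanSpace.proj (𝕜 := ℝ) (0 : Fin m)).continuous
  have himg := G.isOpen_image_of_subset_source (G.open_source.inter ho) inter_subset_left
  refine mem_of_superset (himg.mem_nhds ⟨p.1, ⟨hpG, hp⟩, hG p hpG⟩) ?_
  rintro _ ⟨x, ⟨hxG, hx⟩, rfl⟩
  exact ⟨⟨x, le_of_lt hx⟩, hx, (hG ⟨x, le_of_lt hx⟩ hxG).symm⟩

/-- The complement of the image of the open half-space is locally connected. -/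
lemma IsSmoothProperEmbedding.locallyConnectedSpace_compl [LocallyConnectedSpace M]
    {Φ : EuclideanHalfSpace m → M} (hΦ : IsSmoothProperEmbedding m m Φ) :
    LocallyConnectedSpace ((Φ '' {x | 0 < x.1 0})ᶜ : Set M) := by
  set A := (Φ '' {x | 0 < x.1 0})ᶜ
  rw [locallyConnectedSpace_iff_connected_subsets]
  rintro ⟨z, hz⟩ U hU
  rw [nhds_subtype, mem_comap] at hU
  obtain ⟨V, hV, hVU⟩ := hU
  -- it suffices to find a connected subset of `A ∩ V` that is a neighborhood of `z` in `A`
  suffices hsuff : ∃ C ⊆ A ∩ V, IsPreconnected C ∧ ∃ O ∈ 𝓝 z, O ∩ A ⊆ C by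
    obtain ⟨C, hCV, hC, O, hO, hOC⟩ := hsuff
    refine ⟨Subtype.val ⁻¹' C, ?_, ?_, fun y hy => hVU (hCV hy).2⟩
    · rw [nhds_subtype, mem_comap]
      exact ⟨O, hO, fun y hy => hOC ⟨hy, y.2⟩⟩
    · rw [← IsInducing.subtypeVal.isPreconnected_image, Subtype.image_preimage_coe,
        inter_eq_right.2 fun y hy => (hCV hy).1]
      exact hC
  by_cases hzΦ : z ∈ range Φ
  · obtain ⟨p, rfl⟩ := hzΦ
    obtain ⟨G, hpG, hG, hG'⟩ := hΦ.exists_openPartialHomeomorph p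
    have hp0 : p.1 0 ≤ 0 := not_lt.1 fun h => hz ⟨p, h, rfl⟩
    have hVG : G ⁻¹' V ∩ G.source ∈ 𝓝 p.1 :=
      inter_mem (G.continuousAt hpG (by rwa [hG p hpG])) (G.open_source.mem_nhds hpG)
    -- In the coordinates `G` near a boundary point, the complement is `{x 0 ≤ 0}`. Its trace on a
    -- ball is convex, hence connected.
    obtain ⟨ε, hε, hball⟩ := Metric.mem_nhds_iff.1 hVG
    have hsub : Metric.ball p.1 ε ⊆ G.source := fun x hx => (hball hx).2
    have hconv : Convex ℝ (Metric.ball p.1 ε ∩ {x : EuclideanSpace ℝ (Fin m) | x 0 ≤ 0}) :=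
      (convex_ball _ _).inter (convex_halfSpace_le
        (EuclideanSpace.proj (𝕜 := ℝ) (0 : Fin m)).toLinearMap.isLinear _)
    refine ⟨G '' (Metric.ball p.1 ε ∩ {x | x 0 ≤ 0}), ?_, hconv.isPreconnected.image _
      (G.continuousOn.mono (inter_subset_left.trans hsub)), G '' Metric.ball p.1 ε, ?_, ?_⟩
    · rintro _ ⟨x, ⟨hx, hx0⟩, rfl⟩
      refine ⟨?_, (hball hx).1⟩
      rintro ⟨q, hq, hqx⟩
      have hqG : q.1 ∈ G.source := hG' q (hqx ▸ G.map_source (hsub hx))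
      have : q.1 = x := G.injOn hqG (hsub hx) ((hG q hqG).trans hqx)
      rw [mem_ofPred_eq, this] at hq
      exact absurd hq (not_lt.2 hx0)
    · refine (G.isOpen_image_of_subset_source Metric.isOpen_ball hsub).mem_nhds ?_
      exact ⟨p.1, Metric.mem_ball_self hε, hG p hpG⟩
    · rintro _ ⟨⟨x, hx, rfl⟩, hxA⟩
      refine ⟨x, ⟨hx, show x 0 ≤ 0 from not_lt.1 fun hx0 => hxA ?_⟩, rfl⟩
      exact ⟨⟨x, hx0.le⟩, hx0, (hG ⟨x, hx0.le⟩ (hsub hx)).symm⟩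
  · obtain ⟨C, hC, hCpre, hCV⟩ := locallyConnectedSpace_iff_connected_subsets.1 ‹_› z
      (V ∩ (range Φ)ᶜ) (inter_mem hV (hΦ.isClosedEmbedding.isClosed_range.isOpen_compl.mem_nhds hzΦ))
    refine ⟨C, fun y hy => ⟨?_, (hCV hy).1⟩, hCpre, C, hC, inter_subset_left⟩
    rintro ⟨q, -, rfl⟩
    exact (hCV hy).2 ⟨q, rfl⟩

end Collar

end EndTheory
end

noncomputable section
namespace EndTheory

set_option linter.unusedSectionVars false

open Set Topology Filter

/-- If a connected space is the union of the closed sets `A` and `P`, where `A ∩ P` is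
connected, then `A` is preconnected. -/
lemma isPreconnected_of_union_eq_univ {X : Type*} [TopologicalSpace X] [PreconnectedSpace X]
    {A P : Set X} (hA : IsClosed A) (hP : IsClosed P) (hAP : A ∪ P = univ)
    (hI : IsPreconnected (A ∩ P)) (hne : (A ∩ P).Nonempty) :
    IsPreconnected A := by
  rw [isPreconnected_closed_iff]
  intro s t hs ht hst hAs hAt
  by_contra hcon
  rw [not_nonempty_iff_eq_empty] at hcon
  -- one of the two parts contains `A ∩ P`, and the other one is clopen in `X`
  have key : ∀ s t : Set X, IsClosed s → IsClosed t → A ⊆ s ∪ t → (A ∩ t).Nonempty →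
      A ∩ (s ∩ t) = ∅ → A ∩ P ⊆ s → False := by
    intro s t hs ht hst hAt hcon hIs
    obtain ⟨x, hxA, hxt⟩ := hAt
    obtain ⟨y, hyI⟩ := hne
    have huniv : (univ : Set X) ⊆ (A ∩ t) ∪ (A ∩ s ∪ P) := by
      intro z _
      rcases hAP.symm ▸ mem_univ z with hz | hz
      · rcases hst hz with h | h
        · exact Or.inr (Or.inl ⟨hz, h⟩)
        · exact Or.inl ⟨hz, h⟩
      · exact Or.inr (Or.inr hz)
    obtain ⟨z, -, ⟨hzA, hzt⟩, hz⟩ := isPreconnected_closed_iff.1 isPreconnected_univ (A ∩ t)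
      (A ∩ s ∪ P) (hA.inter ht) ((hA.inter hs).union hP) huniv ⟨x, trivial, hxA, hxt⟩
      ⟨y, trivial, Or.inr hyI.2⟩
    have hzs : z ∈ s := by
      rcases hz with h | h
      · exact h.2
      · exact hIs ⟨hzA, h⟩
    have : z ∈ A ∩ (s ∩ t) := ⟨hzA, hzs, hzt⟩
    rw [hcon] at this
    exact this
  have hI' : A ∩ P ⊆ s ∨ A ∩ P ⊆ t := by
    refine isPreconnected_iff_subset_of_disjoint_closed.1 hI s t hs ht
      (inter_subset_left.trans hst) ?_
    rw [← subset_empty_iff, ← hcon]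
    exact fun x hx => ⟨hx.1.1, hx.2⟩
  rcases hI' with h | h
  · exact key s t hs ht hst hAt hcon h
  · exact key t s ht hs (by rwa [union_comm]) hAs (by rwa [inter_comm t s]) h

/-! ### Cylinders in the half-space -/

section HalfSpaceCoordinates

variable (n : ℕ)

/-- The point of Euclidean space with first coordinate `t` and remaining coordinates `y`. -/
def consPoint (t : ℝ) (y : EuclideanSpace ℝ (Fin n)) : EuclideanSpace ℝ (Fin (n + 1)) :=
  WithLp.toLp 2 (Fin.cons t fun i => y i)

/-- The vector of all coordinates but the first. -/
def tailPoint (x : EuclideanSpace ℝ (Fin (n + 1))) : EuclideanSpace ℝ (Fin n) :=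
  WithLp.toLp 2 fun i => x i.succ

variable {n}

@[simp] lemma consPoint_zero (t : ℝ) (y : EuclideanSpace ℝ (Fin n)) : consPoint n t y 0 = t := rfl

@[simp] lemma tailPoint_consPoint (t : ℝ) (y : EuclideanSpace ℝ (Fin n)) :
    tailPoint n (consPoint n t y) = y := by
  ext i
  simp [tailPoint, consPoint]

@[simp] lemma consPoint_tailPoint (x : EuclideanSpace ℝ (Fin (n + 1))) :
    consPoint n (x 0) (tailPoint n x) = x := by
  ext i
  refine Fin.cases ?_ (fun i => ?_) i <;> simp [tailPoint, consPoint]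

lemma continuous_consPoint :
    Continuous fun q : ℝ × EuclideanSpace ℝ (Fin n) => consPoint n q.1 q.2 := by
  refine (PiLp.continuous_toLp 2 _).comp (continuous_pi fun i => ?_)
  refine Fin.cases ?_ (fun i => ?_) i
  · exact continuous_fst
  · simp only [Fin.cons_succ]
    exact (EuclideanSpace.proj (𝕜 := ℝ) i).continuous.comp continuous_snd

lemma continuous_tailPoint : Continuous (tailPoint n) :=
  (PiLp.continuous_toLp 2 _).comp
    (continuous_pi fun i => (EuclideanSpace.proj (𝕜 := ℝ) i.succ).continuous)

lemma continuous_coord_zero : Continuous fun x : EuclideanSpace ℝ (Fin (n + 1)) => x 0 :=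
  (EuclideanSpace.proj (𝕜 := ℝ) (0 : Fin (n + 1))).continuous

lemma bdry_val (y : EuclideanSpace ℝ (Fin n)) : (bdry n y).1 = consPoint n 0 y := rfl

lemma isClosedEmbedding_halfSpace_val :
    IsClosedEmbedding (Subtype.val : EuclideanHalfSpace (n + 1) → EuclideanSpace ℝ (Fin (n + 1))) :=
  (isClosed_le continuous_const continuous_coord_zero).isClosedEmbedding_subtypeVal

lemma continuous_halfSpace_coord : Continuous fun p : EuclideanHalfSpace (n + 1) => p.1 0 :=
  continuous_coord_zero.comp isClosedEmbedding_halfSpace_val.continuous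

lemma continuous_halfSpace_tail :
    Continuous fun p : EuclideanHalfSpace (n + 1) => tailPoint n p.1 :=
  continuous_tailPoint.comp isClosedEmbedding_halfSpace_val.continuous

lemma isClosedEmbedding_bdry : IsClosedEmbedding (bdry n) := by
  have hc : Continuous (bdry n) := Continuous.subtype_mk
    (continuous_consPoint.comp (Continuous.prodMk continuous_const continuous_id)) _
  have : T2Space (EuclideanHalfSpace (n + 1)) := inferInstanceAs (T2Space {x // _})
  refine Function.LeftInverse.isClosedEmbedding (f := fun p => tailPoint n p.1) (fun y => ?_)
    continuous_halfSpace_tail hc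
  exact tailPoint_consPoint 0 y

lemma eq_bdry_or_pos (p : EuclideanHalfSpace (n + 1)) :
    p = bdry n (tailPoint n p.1) ∨ 0 < p.1 0 := by
  rcases p.2.eq_or_lt with h | h
  · left
    refine Subtype.ext ?_
    rw [bdry_val]
    exact ((consPoint_tailPoint p.1).symm.trans
      (congrArg (fun t => consPoint n t (tailPoint n p.1)) h.symm))
  · exact Or.inr h

/-- The cylinder over the image under `g` of a ball. -/
def halfCylinder (g : EuclideanSpace ℝ (Fin n) ≃ₜ EuclideanSpace ℝ (Fin n)) (R : ℝ) :
    Set (EuclideanHalfSpace (n + 1)) :=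
  {p | p.1 0 ≤ R ∧ ‖g.symm (tailPoint n p.1)‖ ≤ R}

lemma isCompact_halfCylinder (g : EuclideanSpace ℝ (Fin n) ≃ₜ EuclideanSpace ℝ (Fin n)) (R : ℝ) :
    IsCompact (halfCylinder g R) := by
  have hc : IsCompact ((fun q : ℝ × EuclideanSpace ℝ (Fin n) => consPoint n q.1 (g q.2)) ''
      (Icc 0 R ×ˢ Metric.closedBall 0 R)) := by
    refine (isCompact_Icc.prod (isCompact_closedBall _ _)).image ?_
    exact continuous_consPoint.comp (continuous_fst.prodMk (g.continuous.comp continuous_snd))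
  refine (isClosedEmbedding_halfSpace_val.isCompact_preimage hc).of_isClosed_subset ?_ ?_
  · exact (isClosed_le continuous_halfSpace_coord continuous_const).inter
      (isClosed_le (g.symm.continuous.comp continuous_halfSpace_tail).norm continuous_const)
  · rintro p ⟨hp0, hp⟩
    refine ⟨(p.1 0, g.symm (tailPoint n p.1)), ⟨⟨p.2, hp0⟩, by simpa using hp⟩, ?_⟩
    simp

/-- Moving in the direction of increasing first coordinate never enters the cylinder and ends in the
convex region where that coordinate exceeds `R`. -/
lemma isPreconnected_compl_halfCylinder
    (g : EuclideanSpace ℝ (Fin n) ≃ₜ EuclideanSpace ℝ (Fin n)) (R : ℝ) :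
    IsPreconnected (halfCylinder g R)ᶜ := by
  set b : EuclideanHalfSpace (n + 1) := ⟨consPoint n (|R| + 1) 0, by
    rw [consPoint_zero]
    positivity⟩
  set U : Set (EuclideanHalfSpace (n + 1)) := {p | R < p.1 0}
  have hbU : b ∈ U := by
    change R < consPoint n (|R| + 1) 0 0
    rw [consPoint_zero]
    linarith [le_abs_self R]
  have hU : IsPreconnected U := by
    rw [← isClosedEmbedding_halfSpace_val.isInducing.isPreconnected_image]
    have : Subtype.val '' U = {x : EuclideanSpace ℝ (Fin (n + 1)) | 0 ≤ x 0} ∩ {x | R < x 0} := by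
      ext x
      constructor
      · rintro ⟨p, hp, rfl⟩
        exact ⟨p.2, hp⟩
      · rintro ⟨hx, hx'⟩
        exact ⟨⟨x, hx⟩, hx', rfl⟩
    rw [this]
    exact (convex_halfSpace.inter (convex_halfSpace_gt
      (EuclideanSpace.proj (𝕜 := ℝ) (0 : Fin (n + 1))).toLinearMap.isLinear R)).isPreconnected
  have hUD : U ⊆ (halfCylinder g R)ᶜ := fun p hp hpD => absurd hpD.1 (not_le.2 hp)
  refine isPreconnected_of_forall b fun p hp => ?_
  set γ : ℝ → EuclideanHalfSpace (n + 1) := fun s =>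
    ⟨consPoint n (p.1 0 + max s 0) (tailPoint n p.1), by
      rw [consPoint_zero]
      exact add_nonneg p.2 (le_max_right _ _)⟩
  have hγ : Continuous γ := Continuous.subtype_mk (continuous_consPoint.comp
    ((continuous_const.add (continuous_id.max continuous_const)).prodMk continuous_const)) _
  have hγ0 : γ 0 = p := Subtype.ext (by simp [γ])
  have hγ1 : γ (|R| + 1) ∈ U := by
    change R < consPoint n _ _ 0
    rw [consPoint_zero]
    have h1 : 0 ≤ p.1 0 := p.2
    linarith [le_abs_self R, le_max_left (|R| + 1) 0]
  have hγD : range γ ⊆ (halfCylinder g R)ᶜ := by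
    rintro _ ⟨s, rfl⟩ ⟨h1, h2⟩
    refine hp ⟨?_, ?_⟩
    · change consPoint n _ _ 0 ≤ R at h1
      rw [consPoint_zero] at h1
      linarith [le_max_right s 0]
    · rwa [tailPoint_consPoint] at h2
  exact ⟨U ∪ range γ, union_subset hUD hγD, Or.inl hbU, Or.inr ⟨0, hγ0⟩,
    IsPreconnected.union _ hγ1 ⟨_, rfl⟩ hU (isPreconnected_range hγ)⟩

end HalfSpaceCoordinates

/-! ### Regular neighborhoods give end splittings -/

section Splitting

variable {n : ℕ} {M : Type*} [TopologicalSpace M] [ChartedSpace (EuclideanHalfSpace (n + 1)) M]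
  [IsManifold (𝓡∂ (n + 1)) ∞ M]

/-- The boundary of the regular neighborhood parametrized by `Φ` is connected at infinity in the
complement of the neighborhood. -/
def IsConnectedAtInfinity (n : ℕ) {M : Type*} [TopologicalSpace M]
    (Φ : EuclideanHalfSpace (n + 1) → M) : Prop :=
  ∀ K : Set M, IsCompact K → ∃ T : Set (EuclideanSpace ℝ (Fin n)), IsCompact T ∧
    ∀ y ∉ T, ∀ y' ∉ T, ∃ C ⊆ hat n Φ \ K, IsPreconnected C ∧ Φ (bdry n y) ∈ C ∧ Φ (bdry n y') ∈ C

lemma IsSmoothProperEmbedding.bdry_mem_hat {Φ : EuclideanHalfSpace (n + 1) → M}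
    (hΦ : IsSmoothProperEmbedding (n + 1) (n + 1) Φ) (y : EuclideanSpace ℝ (Fin n)) :
    Φ (bdry n y) ∈ hat n Φ := by
  rintro ⟨p, hp, hpy⟩
  rw [hΦ.injective hpy] at hp
  exact lt_irrefl _ (show (0 : ℝ) < 0 from hp)

lemma compl_hat_union_range (Φ : EuclideanHalfSpace (n + 1) → M) :
    (hat n Φ)ᶜ ∪ range (fun y => Φ (bdry n y)) = range Φ := by
  rw [hat, compl_compl]
  apply Subset.antisymm
  · rintro _ (⟨p, -, rfl⟩ | ⟨y, rfl⟩)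
    · exact ⟨p, rfl⟩
    · exact ⟨_, rfl⟩
  · rintro _ ⟨p, rfl⟩
    rcases eq_bdry_or_pos p with h | h
    · exact Or.inr ⟨_, congrArg Φ h.symm⟩
    · exact Or.inl ⟨p, h, rfl⟩

lemma IsSmoothProperEmbedding.hat_inter_range {Φ : EuclideanHalfSpace (n + 1) → M}
    (hΦ : IsSmoothProperEmbedding (n + 1) (n + 1) Φ) :
    hat n Φ ∩ range Φ = range fun y => Φ (bdry n y) := by
  apply Subset.antisymm
  · rintro _ ⟨hA, p, rfl⟩
    rcases eq_bdry_or_pos p with h | h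
    · exact ⟨_, congrArg Φ h.symm⟩
    · exact absurd ⟨p, h, rfl⟩ hA
  · rintro _ ⟨y, rfl⟩
    exact ⟨hΦ.bdry_mem_hat y, _, rfl⟩

/-- The connected space `M` is the union of the closed sets `hat n Φ` and `range Φ`, which meet in a
connected copy of ℝⁿ. -/
lemma IsSmoothProperEmbedding.isPreconnected_hat [ConnectedSpace M]
    {Φ : EuclideanHalfSpace (n + 1) → M} (hΦ : IsSmoothProperEmbedding (n + 1) (n + 1) Φ) :
    IsPreconnected (hat n Φ) := by
  refine isPreconnected_of_union_eq_univ (P := range Φ) hΦ.isOpen_image_interior.isClosed_compl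
    hΦ.isClosedEmbedding.isClosed_range ?_ ?_ ?_
  · rw [← compl_hat_union_range, ← union_assoc, union_compl_self, univ_union]
  · rw [hΦ.hat_inter_range]
    exact isPreconnected_range (hΦ.isProperMap.continuous.comp isClosedEmbedding_bdry.continuous)
  · rw [hΦ.hat_inter_range]
    exact range_nonempty _

/-- Once the cylinder contains `Φ ⁻¹' K`, the enlarged compact set meets the neighborhood exactly in
the cylinder, and the seam in a ball of the parameter `y`. To join two seam points outside the ball,
move each radially until connectedness at infinity applies. The homeomorphism `g` allows both sides
of the end sum to be parametrized so that glued points have the same parameter. -/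
lemma IsSmoothProperEmbedding.isSplitBy
    {Φ : EuclideanHalfSpace (n + 1) → M} (hΦ : IsSmoothProperEmbedding (n + 1) (n + 1) Φ)
    (hinf : IsConnectedAtInfinity n Φ)
    (g : EuclideanSpace ℝ (Fin n) ≃ₜ EuclideanSpace ℝ (Fin n)) {K : Set M} (hK : IsCompact K)
    {R : ℝ} (hR0 : 0 ≤ R) (hKD : Φ ⁻¹' K ⊆ halfCylinder g R) :
    IsSplitBy (hat n Φ) (fun y => Φ (bdry n (g y))) (K ∪ Φ '' halfCylinder g R)
      (Metric.closedBall 0 R) := by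
  have hα : IsClosedEmbedding fun y => Φ (bdry n (g y)) :=
    hΦ.isClosedEmbedding.comp (isClosedEmbedding_bdry.comp g.isClosedEmbedding)
  have hrange : range (fun y => Φ (bdry n (g y))) = range fun y => Φ (bdry n y) :=
    g.surjective.range_comp fun y => Φ (bdry n y)
  have hK' : IsCompact (K ∪ Φ '' halfCylinder g R) :=
    hK.union ((isCompact_halfCylinder g R).image hΦ.isProperMap.continuous)
  have hmem : ∀ p, Φ p ∈ K ∪ Φ '' halfCylinder g R ↔ p ∈ halfCylinder g R := by
    intro p
    constructor
    · rintro (h | ⟨q, hq, hqp⟩)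
      · exact hKD h
      · rwa [← hΦ.injective hqp]
    · exact fun h => Or.inr ⟨p, h, rfl⟩
  have hpre : (fun y => Φ (bdry n (g y))) ⁻¹' (K ∪ Φ '' halfCylinder g R) =
      Metric.closedBall 0 R := by
    ext y
    rw [mem_preimage, hmem, halfCylinder, mem_ofPred_eq, bdry_val, tailPoint_consPoint,
      consPoint_zero, g.symm_apply_apply, mem_closedBall_zero_iff]
    exact ⟨fun h => h.2, fun h => ⟨(norm_nonneg y).trans h, h⟩⟩
  refine ⟨hK', hpre, ?_, ?_⟩
  · have : ((hat n Φ)ᶜ ∪ range fun y => Φ (bdry n (g y))) \ (K ∪ Φ '' halfCylinder g R) =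
        Φ '' (halfCylinder g R)ᶜ := by
      rw [hrange, compl_hat_union_range]
      ext x
      constructor
      · rintro ⟨⟨p, rfl⟩, hp⟩
        exact ⟨p, fun h => hp ((hmem p).2 h), rfl⟩
      · rintro ⟨p, hp, rfl⟩
        exact ⟨⟨p, rfl⟩, fun h => hp ((hmem p).1 h)⟩
    rw [this]
    exact (isPreconnected_compl_halfCylinder g R).image _ hΦ.isProperMap.continuous.continuousOn
  · obtain ⟨T, hT, hTC⟩ := hinf _ hK'
    obtain ⟨ρ, hρ⟩ := (hT.image g.symm.continuous).isBounded.subset_closedBall 0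
    set A' := hat n Φ \ (K ∪ Φ '' halfCylinder g R)
    have hA' : ∀ y, R < ‖y‖ → Φ (bdry n (g y)) ∈ A' := by
      intro y hy
      refine ⟨hΦ.bdry_mem_hat _, fun h => ?_⟩
      have : y ∈ Metric.closedBall 0 R := hpre ▸ h
      rw [mem_closedBall_zero_iff] at this
      exact absurd this (not_le.2 hy)
    -- every point of the boundary outside of the ball can be moved radially to infinity
    have hray : ∀ y, R < ‖y‖ → ∃ y', y' ∉ T ∧ ∃ C ⊆ A', IsPreconnected C ∧
        Φ (bdry n (g y)) ∈ C ∧ Φ (bdry n y') ∈ C := by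
      intro y hy
      have hy0 : 0 < ‖y‖ := hR0.trans_lt hy
      set γ : ℝ → EuclideanSpace ℝ (Fin n) := fun s => (1 + max s 0) • y
      have hγ : Continuous γ :=
        (continuous_const.add (continuous_id.max continuous_const)).smul continuous_const
      have hγn : ∀ s, ‖γ s‖ = (1 + max s 0) * ‖y‖ := fun s => by
        rw [norm_smul, Real.norm_of_nonneg (by positivity)]
      -- At this time the norm is `‖y‖ + |ρ|`, which exceeds the bound `ρ` for the compact set `T`
      -- in the parameter.
      refine ⟨g (γ (|ρ| / ‖y‖)), fun h => ?_, range fun s => Φ (bdry n (g (γ s))), ?_,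
        isPreconnected_range (hα.continuous.comp hγ), ⟨0, by simp [γ]⟩, ⟨_, rfl⟩⟩
      · have h1 := hρ ⟨_, h, rfl⟩
        rw [g.symm_apply_apply, mem_closedBall_zero_iff, hγn, max_eq_left (by positivity),
          add_mul, div_mul_cancel₀ _ hy0.ne'] at h1
        linarith [le_abs_self ρ]
      · rintro _ ⟨s, rfl⟩
        refine hA' _ (hy.trans_le ?_)
        rw [hγn]
        nlinarith [le_max_right s 0]
    -- Such a point is missing only for n = 0, where the seam has nothing outside the ball and `∅`
    -- will do.
    by_cases hne : ∃ y₀ : EuclideanSpace ℝ (Fin n), R < ‖y₀‖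
    · obtain ⟨y₀, hy₀⟩ := hne
      refine ⟨connectedComponentIn A' (Φ (bdry n (g y₀))), connectedComponentIn_subset _ _,
        isPreconnected_connectedComponentIn, ?_⟩
      rintro _ ⟨y, hy, rfl⟩
      rw [mem_compl_iff, mem_closedBall_zero_iff, not_le] at hy
      obtain ⟨y₁, hy₁, C₁, hC₁, hp₁, h₁, h₁'⟩ := hray y hy
      obtain ⟨y₂, hy₂, C₂, hC₂, hp₂, h₂, h₂'⟩ := hray y₀ hy₀
      obtain ⟨C₃, hC₃, hp₃, h₃, h₃'⟩ := hTC y₁ hy₁ y₂ hy₂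
      have e₁ := connectedComponentIn_eq (hp₁.subset_connectedComponentIn h₁ hC₁ h₁')
      have e₂ := connectedComponentIn_eq (hp₂.subset_connectedComponentIn h₂ hC₂ h₂')
      have e₃ := connectedComponentIn_eq (hp₃.subset_connectedComponentIn h₃ hC₃ h₃')
      rw [e₂, ← e₃, ← e₁]
      exact mem_connectedComponentIn (hA' y hy)
    · refine ⟨∅, empty_subset _, isPreconnected_empty, ?_⟩
      rintro _ ⟨y, hy, rfl⟩
      rw [mem_compl_iff, mem_closedBall_zero_iff, not_le] at hy
      exact hne ⟨y, hy⟩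

theorem IsSmoothProperEmbedding.isEndSplitting [T2Space M] [LocallyConnectedSpace M]
    [ConnectedSpace M] {Φ : EuclideanHalfSpace (n + 1) → M}
    (hΦ : IsSmoothProperEmbedding (n + 1) (n + 1) Φ) (hinf : IsConnectedAtInfinity n Φ)
    (g : EuclideanSpace ℝ (Fin n) ≃ₜ EuclideanSpace ℝ (Fin n)) :
    IsEndSplitting (hat n Φ) (fun y => Φ (bdry n (g y))) (fun R => Metric.closedBall 0 R) := by
  have hα : IsClosedEmbedding fun y => Φ (bdry n (g y)) :=
    hΦ.isClosedEmbedding.comp (isClosedEmbedding_bdry.comp g.isClosedEmbedding)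
  have hrange : range (fun y => Φ (bdry n (g y))) = range fun y => Φ (bdry n y) :=
    g.surjective.range_comp fun y => Φ (bdry n y)
  refine ⟨hΦ.isOpen_image_interior.isClosed_compl, hα, ?_, ?_,
    hΦ.locallyConnectedSpace_compl, ?_, fun K hK => ?_⟩
  · rintro _ ⟨y, rfl⟩
    exact hΦ.bdry_mem_hat _
  · rw [hrange, compl_hat_union_range]
    exact hΦ.isClosedEmbedding.isClosed_range
  · exact isConnected_iff_connectedSpace.1 ⟨⟨_, hΦ.bdry_mem_hat 0⟩, hΦ.isPreconnected_hat⟩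
  have hKΦ : IsCompact (Φ ⁻¹' K) := hΦ.isClosedEmbedding.isCompact_preimage hK
  obtain ⟨R₁, hR₁⟩ : ∃ R₁ : ℝ, ∀ p ∈ Φ ⁻¹' K, p.1 0 ≤ R₁ := by
    obtain ⟨R₁, h⟩ := (hKΦ.image continuous_halfSpace_coord).bddAbove
    exact ⟨R₁, fun p hp => h (mem_image_of_mem _ hp)⟩
  obtain ⟨R₂, hR₂⟩ : ∃ R₂ : ℝ, ∀ p ∈ Φ ⁻¹' K, ‖g.symm (tailPoint n p.1)‖ ≤ R₂ := by
    obtain ⟨R₂, h⟩ :=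
      (hKΦ.image (g.symm.continuous.comp continuous_halfSpace_tail).norm).bddAbove
    exact ⟨R₂, fun p hp => h (mem_image_of_mem _ hp)⟩
  filter_upwards [eventually_ge_atTop R₁, eventually_ge_atTop R₂, eventually_ge_atTop 0]
    with R hR hR' hR0
  exact ⟨K ∪ Φ '' halfCylinder g R, subset_union_left, hΦ.isSplitBy hinf g hK hR0
    fun p hp => ⟨(hR₁ p hp).trans hR, (hR₂ p hp).trans hR'⟩⟩

end Splitting

end EndTheory
end

noncomputable section
namespace EndTheory

set_option linter.unusedSectionVars false

open Set Topology Filter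

/-! ### The end sum as an adjunction space -/

section Quotient

variable {A B Z : Type*} [TopologicalSpace A] [TopologicalSpace B] [TopologicalSpace Z]

/-- The quotient of a disjoint union which identifies `α z` and `β z` is a gluing. -/
lemma isGluing_quot {α : Z → A} {β : Z → B} (hα : Function.Injective α) (hβ : Function.Injective β)
    {r : A ⊕ B → A ⊕ B → Prop}
    (hr : ∀ x y, r x y ↔ ∃ z, x = Sum.inl (α z) ∧ y = Sum.inr (β z)) :
    IsGluing α β (fun a => Quot.mk r (Sum.inl a)) (fun b => Quot.mk r (Sum.inr b)) := by
  -- Elementary identifications only go from left to right and `α`, `β` are injective, so adding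
  -- reflexivity and symmetry already gives an equivalence relation.
  have hequiv : Equivalence fun x y => x = y ∨ r x y ∨ r y x := by
    refine ⟨fun x => Or.inl rfl, ?_, ?_⟩
    · rintro x y (h | h | h)
      · exact Or.inl h.symm
      · exact Or.inr (Or.inr h)
      · exact Or.inr (Or.inl h)
    · rintro x y w (rfl | h | h) (rfl | h' | h')
      · exact Or.inl rfl
      · exact Or.inr (Or.inl h')
      · exact Or.inr (Or.inr h')
      · exact Or.inr (Or.inl h)
      · obtain ⟨z, -, h1⟩ := (hr _ _).1 h
        obtain ⟨z', h2, -⟩ := (hr _ _).1 h'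
        simp [h1] at h2
      · obtain ⟨z, h1, h2⟩ := (hr _ _).1 h
        obtain ⟨z', h3, h4⟩ := (hr _ _).1 h'
        rw [h2, Sum.inr.injEq] at h4
        rw [h1, h3, hβ h4]
        exact Or.inl rfl
      · exact Or.inr (Or.inr h)
      · obtain ⟨z, h1, h2⟩ := (hr _ _).1 h
        obtain ⟨z', h3, h4⟩ := (hr _ _).1 h'
        rw [h1, Sum.inl.injEq] at h3
        rw [h2, h4, hα h3]
        exact Or.inl rfl
      · obtain ⟨z, h1, -⟩ := (hr _ _).1 h
        obtain ⟨z', -, h2⟩ := (hr _ _).1 h'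
        simp [h1] at h2
  have heq : ∀ x y, Quot.mk r x = Quot.mk r y ↔ x = y ∨ r x y ∨ r y x := by
    intro x y
    constructor
    · intro h
      have h := Relation.EqvGen.mono (r := r) (p := fun x y => x = y ∨ r x y ∨ r y x)
        (fun a b hab => Or.inr (Or.inl hab)) _ _ (Quot.eqvGen_exact h)
      rwa [hequiv.eqvGen_iff] at h
    · rintro (h | h | h)
      · rw [h]
      · exact Quot.sound h
      · exact (Quot.sound h).symm
  refine ⟨fun U => ?_, fun a a' h => ?_, fun b b' h => ?_, ?_, fun p q => ?_⟩
  · rw [← isQuotientMap_quot_mk.isOpen_preimage, isOpen_sum_iff]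
    rfl
  · rcases (heq _ _).1 h with h | h | h
    · exact Sum.inl_injective h
    · obtain ⟨z, -, h⟩ := (hr _ _).1 h
      simp at h
    · obtain ⟨z, -, h⟩ := (hr _ _).1 h
      simp at h
  · rcases (heq _ _).1 h with h | h | h
    · exact Sum.inr_injective h
    · obtain ⟨z, h, -⟩ := (hr _ _).1 h
      simp at h
    · obtain ⟨z, h, -⟩ := (hr _ _).1 h
      simp at h
  · rintro ⟨a | b⟩
    · exact Or.inl ⟨a, rfl⟩
    · exact Or.inr ⟨b, rfl⟩
  · change Quot.mk r (Sum.inl p) = Quot.mk r (Sum.inr q) ↔ _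
    rw [heq]
    constructor
    · rintro (h | h | h)
      · simp at h
      · obtain ⟨z, h1, h2⟩ := (hr _ _).1 h
        exact ⟨z, (Sum.inl_injective h1).symm, (Sum.inr_injective h2).symm⟩
      · obtain ⟨z, h1, h2⟩ := (hr _ _).1 h
        simp at h1
    · rintro ⟨z, rfl, rfl⟩
      exact Or.inr (Or.inl ((hr _ _).2 ⟨z, rfl, rfl⟩))

end Quotient

/-- The map that adds `R` to the norm of every vector carries the connected punctured space onto the
complement of the ball. -/
lemma isPreconnected_compl_closedBall {E : Type*} [NormedAddCommGroup E] [NormedSpace ℝ E]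
    (hE : 1 < Module.rank ℝ E) {R : ℝ} (hR : 0 ≤ R) :
    IsPreconnected (Metric.closedBall (0 : E) R)ᶜ := by
  have h := (isConnected_compl_singleton_of_one_lt_rank hE (0 : E)).isPreconnected
  have hc : ContinuousOn (fun x : E => (1 + R / ‖x‖) • x) {0}ᶜ := by
    refine ContinuousOn.smul (continuousOn_const.add (continuousOn_const.div
      continuous_norm.continuousOn fun x hx => norm_ne_zero_iff.2 hx)) continuousOn_id
  convert h.image _ hc using 1
  ext y
  rw [mem_compl_iff, mem_closedBall_zero_iff, not_le]
  constructor
  · intro hy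
    have hy0 : 0 < ‖y‖ := hR.trans_lt hy
    have h1 : 0 < 1 - R / ‖y‖ := by
      rw [sub_pos, div_lt_one hy0]
      exact hy
    have hn : ‖(1 - R / ‖y‖) • y‖ = ‖y‖ - R := by
      rw [norm_smul, Real.norm_of_nonneg h1.le]
      field_simp
    refine ⟨(1 - R / ‖y‖) • y, ?_, ?_⟩
    · rw [mem_compl_iff, mem_singleton_iff, ← norm_eq_zero, hn]
      exact (sub_pos.2 hy).ne'
    · change (1 + R / ‖(1 - R / ‖y‖) • y‖) • (1 - R / ‖y‖) • y = y
      have h2 : ‖y‖ - R ≠ 0 := (sub_pos.2 hy).ne'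
      rw [hn, smul_smul]
      have : (1 + R / (‖y‖ - R)) * (1 - R / ‖y‖) = 1 := by
        field_simp
        ring
      rw [this, one_smul]
  · rintro ⟨x, hx, rfl⟩
    have hx0 : 0 < ‖x‖ := norm_pos_iff.2 hx
    rw [norm_smul, Real.norm_of_nonneg (by positivity), add_mul, div_mul_cancel₀ _ hx0.ne']
    linarith

/-- Here the seam itself connects: outside a ball that contains the trace of `K` it is a copy of ℝⁿ
minus a ball. -/
lemma IsSmoothProperEmbedding.isConnectedAtInfinity_of_two_le {n : ℕ} (hn : 2 ≤ n) {M : Type*}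
    [TopologicalSpace M] [ChartedSpace (EuclideanHalfSpace (n + 1)) M]
    {Φ : EuclideanHalfSpace (n + 1) → M} (hΦ : IsSmoothProperEmbedding (n + 1) (n + 1) Φ) :
    IsConnectedAtInfinity n Φ := by
  intro K hK
  have hα : IsClosedEmbedding fun y => Φ (bdry n y) :=
    hΦ.isClosedEmbedding.comp isClosedEmbedding_bdry
  obtain ⟨R, hR⟩ := (hα.isCompact_preimage hK).isBounded.subset_closedBall 0
  refine ⟨Metric.closedBall 0 (max R 0), isCompact_closedBall _ _, fun y hy y' hy' =>
    ⟨(fun y => Φ (bdry n y)) '' (Metric.closedBall 0 (max R 0))ᶜ, ?_, ?_, ⟨y, hy, rfl⟩,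
      ⟨y', hy', rfl⟩⟩⟩
  · rintro _ ⟨w, hw, rfl⟩
    refine ⟨?_, fun h => hw (Metric.closedBall_subset_closedBall (le_max_left _ _) (hR h))⟩
    rintro ⟨p, hp, hpy⟩
    rw [hΦ.injective hpy] at hp
    exact lt_irrefl _ (show (0 : ℝ) < 0 from hp)
  · refine (isPreconnected_compl_closedBall ?_ (le_max_right _ _)).image _
      hα.continuous.continuousOn
    rw [← Module.finrank_eq_rank, finrank_euclideanSpace, Fintype.card_fin]
    exact_mod_cast hn

/-- The number of ends of the end sum, if both boundaries are connected at infinity. -/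
theorem numEnds_endSum {n : ℕ} (hn : 1 ≤ n)
    {M : Type*} [TopologicalSpace M] [ChartedSpace (EuclideanHalfSpace (n + 1)) M]
    [IsManifold (𝓡∂ (n + 1)) ∞ M]
    {N : Type*} [TopologicalSpace N] [ChartedSpace (EuclideanHalfSpace (n + 1)) N]
    [IsManifold (𝓡∂ (n + 1)) ∞ N] [T2Space M] [SecondCountableTopology M] [ConnectedSpace M]
    [T2Space N] [SecondCountableTopology N] [ConnectedSpace N]
    {Φ : EuclideanHalfSpace (n + 1) → M} (hΦ : IsSmoothProperEmbedding (n + 1) (n + 1) Φ)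
    {Ψ : EuclideanHalfSpace (n + 1) → N} (hΨ : IsSmoothProperEmbedding (n + 1) (n + 1) Ψ)
    (hΦi : IsConnectedAtInfinity n Φ) (hΨi : IsConnectedAtInfinity n Ψ)
    (g : EuclideanSpace ℝ (Fin n) ≃ₜ EuclideanSpace ℝ (Fin n)) :
    Nonempty (CompactExhaustion (EndSum n Φ Ψ g)) ∧
    ∀ (KM : CompactExhaustion M) (KN : CompactExhaustion N)
      (KS : CompactExhaustion (EndSum n Φ Ψ g)),
      numEnds KS + 1 = numEnds KM + numEnds KN := by
  have : LocallyConnectedSpace M :=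
    ChartedSpace.locallyConnectedSpace (EuclideanHalfSpace (n + 1)) M
  have : LocallyConnectedSpace N :=
    ChartedSpace.locallyConnectedSpace (EuclideanHalfSpace (n + 1)) N
  have : LocallyCompactSpace M := Manifold.locallyCompact_of_finiteDimensional (𝓡∂ (n + 1))
  have : LocallyCompactSpace N := Manifold.locallyCompact_of_finiteDimensional (𝓡∂ (n + 1))
  -- The seam is parametrized by the identity on one side and by the gluing map on the other, so
  -- points with equal parameter are the ones identified.
  have hA := hΦ.isEndSplitting hΦi (Homeomorph.refl _)
  have hB := hΨ.isEndSplitting hΨi g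
  refine numEnds_gluing hA hB (fun R hc => ?_) (isGluing_quot (r := endSumRel n Φ Ψ g)
    hA.isClosedEmbedding_toSubtype.injective hB.isClosedEmbedding_toSubtype.injective
    fun x y => ?_)
  · have hnt : Nontrivial (EuclideanSpace ℝ (Fin n)) := by
      rw [← Module.finrank_pos_iff (R := ℝ), finrank_euclideanSpace, Fintype.card_fin]
      exact hn
    have hcomp : IsCompact (univ : Set (EuclideanSpace ℝ (Fin n))) := by
      refine ((isCompact_closedBall 0 R).union hc).of_isClosed_subset isClosed_univ fun y _ => ?_
      by_cases hy : y ∈ Metric.closedBall 0 R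
      · exact Or.inl hy
      · exact Or.inr (subset_closure hy)
    exact noncompact_univ _ hcomp
  · constructor
    · rintro ⟨z, p, q, hp, hq, rfl, rfl⟩
      exact ⟨z, congrArg Sum.inl (Subtype.ext hp), congrArg Sum.inr (Subtype.ext hq)⟩
    · rintro ⟨z, rfl, rfl⟩
      exact ⟨z, _, _, rfl, rfl, rfl, rfl⟩

end EndTheory
end

noncomputable section
namespace EndTheory

set_option linter.unusedSectionVars false

open Set Topology Filter MeasureTheory

/-! ### Integration of `u da ∧ db` over a chart of a surface -/

section Wedge

/-- The value of `α ∧ β` on the standard basis of the plane. -/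
def wedge (α β : EuclideanSpace ℝ (Fin 2) →L[ℝ] ℝ) : ℝ :=
  α (EuclideanSpace.single 0 1) * β (EuclideanSpace.single 1 1) -
    α (EuclideanSpace.single 1 1) * β (EuclideanSpace.single 0 1)

lemma wedge_comp (α β : EuclideanSpace ℝ (Fin 2) →L[ℝ] ℝ)
    (T : EuclideanSpace ℝ (Fin 2) →L[ℝ] EuclideanSpace ℝ (Fin 2)) :
    wedge (α.comp T) (β.comp T) = T.det * wedge α β := by
  have hT : ∀ v : EuclideanSpace ℝ (Fin 2), v = v 0 • EuclideanSpace.single 0 1 +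
      v 1 • EuclideanSpace.single 1 1 := by
    intro v
    ext i
    fin_cases i <;> simp
  have hdet : T.det = T (EuclideanSpace.single 0 1) 0 * T (EuclideanSpace.single 1 1) 1 -
      T (EuclideanSpace.single 1 1) 0 * T (EuclideanSpace.single 0 1) 1 := by
    change LinearMap.det (T : EuclideanSpace ℝ (Fin 2) →ₗ[ℝ] EuclideanSpace ℝ (Fin 2)) = _
    rw [← LinearMap.det_toMatrix (EuclideanSpace.basisFun (Fin 2) ℝ).toBasis, Matrix.det_fin_two]
    simp [LinearMap.toMatrix_apply]
  simp only [wedge, ContinuousLinearMap.comp_apply]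
  rw [hdet, hT (T (EuclideanSpace.single 0 1)), hT (T (EuclideanSpace.single 1 1))]
  simp only [map_add, map_smul, smul_eq_mul]
  simp
  ring

lemma wedge_add_left (α α' β : EuclideanSpace ℝ (Fin 2) →L[ℝ] ℝ) :
    wedge (α + α') β = wedge α β + wedge α' β := by
  simp [wedge]
  ring

lemma wedge_smul_left (c : ℝ) (α β : EuclideanSpace ℝ (Fin 2) →L[ℝ] ℝ) :
    wedge (c • α) β = c * wedge α β := by
  simp [wedge]
  ring

lemma wedge_sum_left {ι : Type*} (s : Finset ι) (α : ι → EuclideanSpace ℝ (Fin 2) →L[ℝ] ℝ)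
    (β : EuclideanSpace ℝ (Fin 2) →L[ℝ] ℝ) :
    wedge (∑ i ∈ s, α i) β = ∑ i ∈ s, wedge (α i) β := by
  simp [wedge, Finset.sum_mul, Finset.sum_sub_distrib]

@[simp] lemma wedge_zero_left (β : EuclideanSpace ℝ (Fin 2) →L[ℝ] ℝ) : wedge 0 β = 0 := by
  simp [wedge]

@[simp] lemma wedge_zero_right (α : EuclideanSpace ℝ (Fin 2) →L[ℝ] ℝ) : wedge α 0 = 0 := by
  simp [wedge]

end Wedge

/-! ### Extension by zero and integrals of derivatives -/

section ZeroExtension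

variable {E : Type*} [NormedAddCommGroup E] [NormedSpace ℝ E]

lemma contDiff_indicator {U C : Set E} {w : E → ℝ} {k : ℕ∞} (hU : IsOpen U) (hC : IsCompact C)
    (hw : ContDiffOn ℝ k w U) (h0 : ∀ x ∈ U, x ∉ C → w x = 0) (hCU : C ⊆ U) :
    ContDiff ℝ k (U.indicator w) ∧ HasCompactSupport (U.indicator w) := by
  have hz : ∀ x ∉ C, U.indicator w x = 0 := by
    intro x hx
    by_cases hxU : x ∈ U
    · rw [indicator_of_mem hxU, h0 x hxU hx]
    · rw [indicator_of_notMem hxU]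
  refine ⟨contDiff_iff_contDiffAt.2 fun x => ?_, HasCompactSupport.intro hC hz⟩
  by_cases hxU : x ∈ U
  · refine (hw.contDiffAt (hU.mem_nhds hxU)).congr_of_eventuallyEq ?_
    filter_upwards [hU.mem_nhds hxU] with y hy
    exact indicator_of_mem hy w
  · refine contDiffAt_const (c := (0 : ℝ)) |>.congr_of_eventuallyEq ?_
    filter_upwards [hC.isClosed.isOpen_compl.mem_nhds fun h => hxU (hCU h)] with y hy
    exact hz y hy

lemma integrableOn_of_continuousOn_of_compact [MeasurableSpace E] [BorelSpace E]
    {μ : Measure E} [IsFiniteMeasureOnCompacts μ] {U C : Set E} {w : E → ℝ} (hU : IsOpen U)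
    (hC : IsCompact C) (hw : ContinuousOn w U) (h0 : ∀ x ∈ U, x ∉ C → w x = 0) (hCU : C ⊆ U) :
    IntegrableOn w U μ :=
  ((hw.mono hCU).integrableOn_compact hC).of_forall_sdiff_eq_zero hU.measurableSet
    fun x hx => h0 x hx.1 hx.2

/-- This is integration by parts against the constant function 1. -/
lemma integral_fderiv_apply_eq_zero [MeasurableSpace E] [BorelSpace E] [FiniteDimensional ℝ E]
    {μ : Measure E} [μ.IsAddHaarMeasure] {w : E → ℝ} (hw : ContDiff ℝ 1 w)
    (hc : HasCompactSupport w) (v : E) : ∫ x, fderiv ℝ w x v ∂μ = 0 := by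
  have hcont : Continuous fun x => fderiv ℝ w x v :=
    (hw.continuous_fderiv one_ne_zero).clm_apply continuous_const
  have hsupp : HasCompactSupport fun x => fderiv ℝ w x v := hc.fderiv_apply (𝕜 := ℝ) v
  have h := integral_mul_fderiv_eq_neg_fderiv_mul_of_integrable (μ := μ) (𝕜 := ℝ) (v := v)
    (f := fun _ => (1 : ℝ)) (g := w) (by simp)
    (by simpa using hcont.integrable_of_hasCompactSupport hsupp)
    (by simpa using hw.continuous.integrable_of_hasCompactSupport hc)
    (by fun_prop) (fun x _ => hw.differentiable one_ne_zero x)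
  simpa using h

end ZeroExtension

/-! ### Change of variables between charts -/

section ChartIntegral

variable {M : Type*} [TopologicalSpace M]

/-- The integrand of `∫ σ u da ∧ db` in the chart `e`. -/
def formIntegrand (e : OpenPartialHomeomorph M (EuclideanSpace ℝ (Fin 2))) (σ u a b : M → ℝ)
    (x : EuclideanSpace ℝ (Fin 2)) : ℝ :=
  σ (e.symm x) * u (e.symm x) * wedge (fderiv ℝ (a ∘ e.symm) x) (fderiv ℝ (b ∘ e.symm) x)

/-- The integral of `σ u da ∧ db` over the chart `e`. -/
def formIntegral (e : OpenPartialHomeomorph M (EuclideanSpace ℝ (Fin 2))) (σ u a b : M → ℝ) : ℝ :=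
  ∫ x in e.target, formIntegrand e σ u a b x

/-- The charts `e` and `e'` with orientation signs `σ` and `σ'` are compatible. -/
def IsOrientedTransition (e e' : OpenPartialHomeomorph M (EuclideanSpace ℝ (Fin 2)))
    (σ σ' : M → ℝ) : Prop :=
  ∀ z ∈ e.source ∩ e'.source, ∃ T : EuclideanSpace ℝ (Fin 2) →L[ℝ] EuclideanSpace ℝ (Fin 2),
    HasFDerivAt (e' ∘ e.symm) T (e z) ∧ σ z * T.det = |T.det| * σ' z

/-- Change of variables. -/
lemma formIntegral_eq_of_isOrientedTransition
    {e e' : OpenPartialHomeomorph M (EuclideanSpace ℝ (Fin 2))} {σ σ' u a b : M → ℝ}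
    (h : IsOrientedTransition e e' σ σ')
    (ha : ∀ x ∈ e'.target, DifferentiableAt ℝ (a ∘ e'.symm) x)
    (hb : ∀ x ∈ e'.target, DifferentiableAt ℝ (b ∘ e'.symm) x)
    (h0 : ∀ x ∈ e.target, e.symm x ∉ e'.source → formIntegrand e σ u a b x = 0)
    (h0' : ∀ x ∈ e'.target, e'.symm x ∉ e.source → formIntegrand e' σ' u a b x = 0) :
    formIntegral e σ u a b = formIntegral e' σ' u a b := by
  set U := e.target ∩ e.symm ⁻¹' e'.source
  set U' := e'.target ∩ e'.symm ⁻¹' e.source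
  have hU : IsOpen U := e.symm.isOpen_inter_preimage e'.open_source
  have hz : ∀ x ∈ U, e.symm x ∈ e.source ∩ e'.source := fun x hx =>
    ⟨e.map_target hx.1, hx.2⟩
  have himg : (e' ∘ e.symm) '' U = U' := by
    ext y
    constructor
    · rintro ⟨x, hx, rfl⟩
      refine ⟨e'.map_source hx.2, ?_⟩
      change e'.symm (e' (e.symm x)) ∈ e.source
      rw [e'.left_inv hx.2]
      exact (hz x hx).1
    · rintro ⟨hy, hy'⟩
      refine ⟨e (e'.symm y), ⟨e.map_source hy', ?_⟩, ?_⟩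
      · change e.symm (e (e'.symm y)) ∈ e'.source
        rw [e.left_inv hy']
        exact e'.map_target hy
      · change e' (e.symm (e (e'.symm y))) = y
        rw [e.left_inv hy', e'.right_inv hy]
  have hinj : InjOn (e' ∘ e.symm) U := by
    intro x hx y hy hxy
    have := e'.injOn (hz x hx).2 (hz y hy).2 hxy
    exact e.symm.injOn hx.1 hy.1 this
  have hT : ∀ x ∈ U, ∃ T : EuclideanSpace ℝ (Fin 2) →L[ℝ] EuclideanSpace ℝ (Fin 2),
      HasFDerivAt (e' ∘ e.symm) T x ∧ σ (e.symm x) * T.det = |T.det| * σ' (e.symm x) := by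
    intro x hx
    obtain ⟨T, hT, hT'⟩ := h _ (hz x hx)
    rw [e.right_inv hx.1] at hT
    exact ⟨T, hT, hT'⟩
  choose! T hT hσ using hT
  have hpt : ∀ x ∈ U, formIntegrand e σ u a b x =
      |(T x).det| • formIntegrand e' σ' u a b ((e' ∘ e.symm) x) := by
    intro x hx
    have hsymm : e'.symm ((e' ∘ e.symm) x) = e.symm x := e'.left_inv hx.2
    have hcomp : ∀ f : M → ℝ, (∀ y ∈ e'.target, DifferentiableAt ℝ (f ∘ e'.symm) y) →
        fderiv ℝ (f ∘ e.symm) x =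
          (fderiv ℝ (f ∘ e'.symm) ((e' ∘ e.symm) x)).comp (T x) := by
      intro f hf
      have h1 := (hf _ (e'.map_source hx.2)).hasFDerivAt.comp x (hT x hx)
      refine (h1.congr_of_eventuallyEq ?_).fderiv
      filter_upwards [hU.mem_nhds hx] with y hy
      change f (e.symm y) = f (e'.symm (e' (e.symm y)))
      rw [e'.left_inv hy.2]
    -- Pulling back the 2-form produces the signed determinant, while the change of variables
    -- formula contains its absolute value. The signs `σ` and `σ'` make up the difference.
    rw [formIntegrand, formIntegrand, hcomp a ha, hcomp b hb, wedge_comp, hsymm, smul_eq_mul]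
    linear_combination (u (e.symm x) * wedge (fderiv ℝ (a ∘ e'.symm) ((e' ∘ e.symm) x))
      (fderiv ℝ (b ∘ e'.symm) ((e' ∘ e.symm) x))) * hσ x hx
  calc formIntegral e σ u a b = ∫ x in U, formIntegrand e σ u a b x :=
        (setIntegral_eq_of_subset_of_forall_sdiff_eq_zero e.open_target.measurableSet
          inter_subset_left fun x hx => h0 x hx.1 fun hx' => hx.2 ⟨hx.1, hx'⟩)
    _ = ∫ x in U, |(T x).det| • formIntegrand e' σ' u a b ((e' ∘ e.symm) x) :=
        setIntegral_congr_fun hU.measurableSet hpt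
    _ = ∫ x in U', formIntegrand e' σ' u a b x := by
        rw [← himg]
        exact (integral_image_eq_integral_abs_det_fderiv_smul volume hU.measurableSet
          (fun x hx => (hT x hx).hasFDerivWithinAt) hinj _).symm
    _ = formIntegral e' σ' u a b :=
        (setIntegral_eq_of_subset_of_forall_sdiff_eq_zero e'.open_target.measurableSet
          inter_subset_left fun x hx => h0' x hx.1 fun hx' => hx.2 ⟨hx.1, hx'⟩).symm

end ChartIntegral

end EndTheory
end

noncomputable section
namespace EndTheory

set_option linter.unusedSectionVars false

open Set Topology Filter MeasureTheory

/-! ### Stokes' theorem in one chart -/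

section Stokes

variable {M : Type*} [TopologicalSpace M]
  {e : OpenPartialHomeomorph M (EuclideanSpace ℝ (Fin 2))} {σ u a b : M → ℝ} {Q : Set M}

lemma eventuallyEq_comp_symm {f : M → ℝ} (hf : ∀ z ∈ e.source, ∀ᶠ w in 𝓝 z, f w = f z)
    {x : EuclideanSpace ℝ (Fin 2)} (hx : x ∈ e.target) :
    f ∘ e.symm =ᶠ[𝓝 x] fun _ => f (e.symm x) :=
  (e.symm.continuousAt hx).eventually (hf _ (e.map_target hx))

lemma isCompact_image_of_subset_source (hQ : IsCompact Q) (hQe : Q ⊆ e.source) :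
    IsCompact (e '' Q) := hQ.image_of_continuousOn (e.continuousOn.mono hQe)

lemma image_subset_target (hQe : Q ⊆ e.source) : e '' Q ⊆ e.target :=
  (image_mono hQe).trans e.image_source_eq_target.subset

lemma notMem_of_notMem_image {x : EuclideanSpace ℝ (Fin 2)} (hx : x ∈ e.target)
    (hxQ : x ∉ e '' Q) : e.symm x ∉ Q := fun h => hxQ ⟨_, h, e.right_inv hx⟩

/-- Stokes' theorem in a chart: the integral of `da ∧ db` vanishes if `a` has compact support. -/
lemma formIntegral_one_eq_zero (hQ : IsCompact Q) (hQe : Q ⊆ e.source)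
    (h0 : ∀ z ∈ e.source, z ∉ Q → a z = 0) (hσ : ∀ z ∈ e.source, ∀ᶠ w in 𝓝 z, σ w = σ z)
    (ha : ContDiffOn ℝ ∞ (a ∘ e.symm) e.target) (hb : ContDiffOn ℝ ∞ (b ∘ e.symm) e.target) :
    formIntegral e σ 1 a b = 0 := by
  -- These are the components of `σ a db`, a primitive of `σ da ∧ db` since `σ` is locally constant.
  -- In its exterior derivative the second derivatives of `b` cancel by symmetry.
  set w : EuclideanSpace ℝ (Fin 2) → EuclideanSpace ℝ (Fin 2) → ℝ := fun v x =>
    (σ ∘ e.symm) x * ((a ∘ e.symm) x * fderiv ℝ (b ∘ e.symm) x v) with hw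
  have hσe : ContDiffOn ℝ 1 (σ ∘ e.symm) e.target := fun x hx =>
    (contDiffAt_const.congr_of_eventuallyEq (eventuallyEq_comp_symm hσ hx)).contDiffWithinAt
  have hwc : ∀ v, ContDiffOn ℝ ((1 : ℕ∞) : WithTop ℕ∞) (w v) e.target := fun v =>
    hσe.mul ((ha.of_le (by simp)).mul
      ((hb.fderiv_of_isOpen e.open_target (m := 1) (by norm_cast)).clm_apply contDiffOn_const))
  have hind := fun v => contDiff_indicator e.open_target (isCompact_image_of_subset_source hQ hQe)
    (hwc v) (fun x hx hxQ => by
      simp [hw, h0 _ (e.map_target hx) (notMem_of_notMem_image hx hxQ)])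
    (image_subset_target hQe)
  set P := fun v => e.target.indicator (w v) with hP
  have hPd : ∀ v v' : EuclideanSpace ℝ (Fin 2), ∀ x ∈ e.target, fderiv ℝ (P v) x v' =
      σ (e.symm x) * (fderiv ℝ (a ∘ e.symm) x v' * fderiv ℝ (b ∘ e.symm) x v +
        a (e.symm x) * fderiv ℝ (fderiv ℝ (b ∘ e.symm)) x v' v) := by
    intro v v' x hx
    have hnx := e.open_target.mem_nhds hx
    have hda : HasFDerivAt (a ∘ e.symm) (fderiv ℝ (a ∘ e.symm) x) x :=
      ((ha.contDiffAt hnx).differentiableAt (by simp)).hasFDerivAt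
    have hdb : HasFDerivAt (fderiv ℝ (b ∘ e.symm)) (fderiv ℝ (fderiv ℝ (b ∘ e.symm)) x) x :=
      (((hb.fderiv_of_isOpen e.open_target (m := 1) (by norm_cast)).contDiffAt
        hnx).differentiableAt one_ne_zero).hasFDerivAt
    have h1 := (hda.mul (hdb.clm_apply (hasFDerivAt_const v x))).const_mul (σ (e.symm x))
    have h2 : P v =ᶠ[𝓝 x] fun y => σ (e.symm x) *
        ((a ∘ e.symm) y * fderiv ℝ (b ∘ e.symm) y v) := by
      filter_upwards [hnx, eventuallyEq_comp_symm hσ hx] with y hy hy'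
      simp only [hP, indicator_of_mem hy, hw, hy']
    rw [(h1.congr_of_eventuallyEq h2).fderiv]
    simp
    ring
  have hzero : ∀ v, ∀ x ∉ e.target, fderiv ℝ (P v) x = 0 := by
    intro v x hx
    by_contra hne
    have h1 := support_fderiv_subset ℝ hne
    have h2 : tsupport (P v) ⊆ e '' Q := by
      refine closure_minimal (fun y hy => ?_)
        (isCompact_image_of_subset_source hQ hQe).isClosed
      by_contra hyQ
      refine hy ?_
      by_cases hyt : y ∈ e.target
      · simp [hP, hw, indicator_of_mem hyt,
          h0 _ (e.map_target hyt) (notMem_of_notMem_image hyt hyQ)]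
      · simp [hP, indicator_of_notMem hyt]
    exact hx (image_subset_target hQe (h2 h1))
  set e₀ : EuclideanSpace ℝ (Fin 2) := EuclideanSpace.single 0 1
  set e₁ : EuclideanSpace ℝ (Fin 2) := EuclideanSpace.single 1 1
  have hint : ∀ v v', Integrable fun x => fderiv ℝ (P v) x v' := fun v v' =>
    (((hind v).1.continuous_fderiv one_ne_zero).clm_apply
      continuous_const).integrable_of_hasCompactSupport ((hind v).2.fderiv_apply (𝕜 := ℝ) v')
  calc formIntegral e σ 1 a b
      = ∫ x in e.target, (fderiv ℝ (P e₁) x e₀ - fderiv ℝ (P e₀) x e₁) := by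
        refine setIntegral_congr_fun e.open_target.measurableSet fun x hx => ?_
        have hsymm := (hb.contDiffAt (e.open_target.mem_nhds hx)).isSymmSndFDerivAt
          (by simpa using WithTop.coe_le_coe.2 (le_top : (2 : ℕ∞) ≤ ⊤)) e₀ e₁
        simp only [hPd _ _ x hx, formIntegrand, wedge, hsymm, Pi.one_apply]
        ring
    _ = ∫ x, (fderiv ℝ (P e₁) x e₀ - fderiv ℝ (P e₀) x e₁) :=
        setIntegral_eq_integral_of_forall_compl_eq_zero fun x hx => by simp [hzero _ x hx]
    _ = 0 := by
        rw [integral_sub (hint _ _) (hint _ _), integral_fderiv_apply_eq_zero (hind _).1 (hind _).2,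
          integral_fderiv_apply_eq_zero (hind _).1 (hind _).2, sub_zero]

lemma continuousOn_formIntegrand (hσ : ∀ z ∈ e.source, ∀ᶠ w in 𝓝 z, σ w = σ z)
    (hu : ContinuousOn (u ∘ e.symm) e.target)
    (ha : ContDiffOn ℝ ∞ (a ∘ e.symm) e.target) (hb : ContDiffOn ℝ ∞ (b ∘ e.symm) e.target) :
    ContinuousOn (formIntegrand e σ u a b) e.target := by
  have hσe : ContinuousOn (σ ∘ e.symm) e.target := fun x hx =>
    (continuousAt_const.congr (eventuallyEq_comp_symm hσ hx).symm).continuousWithinAt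
  have hd : ∀ {f : M → ℝ}, ContDiffOn ℝ ∞ (f ∘ e.symm) e.target → ∀ v,
      ContinuousOn (fun x => fderiv ℝ (f ∘ e.symm) x v) e.target := fun hf v =>
    (hf.continuousOn_fderiv_of_isOpen e.open_target (by simp)).clm_apply continuousOn_const
  exact (hσe.mul hu).mul (((hd ha _).mul (hd hb _)).sub ((hd ha _).mul (hd hb _)))

lemma fderiv_comp_symm_eq_zero {f : M → ℝ} {c : ℝ} {x : EuclideanSpace ℝ (Fin 2)}
    (hx : x ∈ e.target) (hf : ∀ᶠ w in 𝓝 (e.symm x), f w = c) : fderiv ℝ (f ∘ e.symm) x = 0 := by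
  have : f ∘ e.symm =ᶠ[𝓝 x] fun _ => c := (e.symm.continuousAt hx).eventually hf
  rw [this.fderiv_eq]
  simp

/-- The integrand vanishes where one of the factors does. -/
lemma formIntegrand_eq_zero {x : EuclideanSpace ℝ (Fin 2)} (hx : x ∈ e.target)
    (h : u (e.symm x) = 0 ∨ (∃ c, ∀ᶠ w in 𝓝 (e.symm x), a w = c) ∨
      ∃ c, ∀ᶠ w in 𝓝 (e.symm x), b w = c) : formIntegrand e σ u a b x = 0 := by
  rcases h with h | ⟨c, h⟩ | ⟨c, h⟩
  · simp [formIntegrand, h]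
  · simp [formIntegrand, fderiv_comp_symm_eq_zero hx h]
  · simp [formIntegrand, fderiv_comp_symm_eq_zero hx h]

lemma integrableOn_formIntegrand (hQ : IsCompact Q) (hQe : Q ⊆ e.source)
    (h0 : ∀ z ∈ e.source, z ∉ Q → u z = 0 ∨ (∃ c, ∀ᶠ w in 𝓝 z, a w = c) ∨
      ∃ c, ∀ᶠ w in 𝓝 z, b w = c)
    (hσ : ∀ z ∈ e.source, ∀ᶠ w in 𝓝 z, σ w = σ z)
    (hu : ContinuousOn (u ∘ e.symm) e.target)
    (ha : ContDiffOn ℝ ∞ (a ∘ e.symm) e.target) (hb : ContDiffOn ℝ ∞ (b ∘ e.symm) e.target) :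
    IntegrableOn (formIntegrand e σ u a b) e.target :=
  integrableOn_of_continuousOn_of_compact e.open_target (isCompact_image_of_subset_source hQ hQe)
    (continuousOn_formIntegrand hσ hu ha hb)
    (fun _ hx hxQ => formIntegrand_eq_zero hx
      (h0 _ (e.map_target hx) (notMem_of_notMem_image hx hxQ))) (image_subset_target hQe)

lemma fderiv_mul_comp_symm {f g : M → ℝ} {x : EuclideanSpace ℝ (Fin 2)}
    (hf : DifferentiableAt ℝ (f ∘ e.symm) x) (hg : DifferentiableAt ℝ (g ∘ e.symm) x) :
    fderiv ℝ ((f * g) ∘ e.symm) x =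
      f (e.symm x) • fderiv ℝ (g ∘ e.symm) x + g (e.symm x) • fderiv ℝ (f ∘ e.symm) x := by
  rw [show (f * g) ∘ e.symm = (f ∘ e.symm) * (g ∘ e.symm) from rfl, fderiv_mul hf hg]
  rfl

end Stokes

/-! ### Stokes' theorem with a partition of unity -/

section Cancellation

variable {M : Type*} [TopologicalSpace M] [T2Space M] {ι : Type*} [Fintype ι]
  {e : ι → OpenPartialHomeomorph M (EuclideanSpace ℝ (Fin 2))} {σ ρ : ι → M → ℝ} {Q : ι → Set M}
  {F h : M → ℝ}

/-- The integral of `dF ∧ dh` over a surface, computed with a partition of unity `ρ` over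
compatible charts, vanishes if `h` is locally constant where `ρ` does not add up to `1`. -/
lemma sum_formIntegral_eq_zero (hQ : ∀ i, IsCompact (Q i)) (hQe : ∀ i, Q i ⊆ (e i).source)
    (h0 : ∀ i, ∀ z ∉ Q i, ρ i z = 0) (hσ : ∀ i, ∀ z ∈ (e i).source, ∀ᶠ w in 𝓝 z, σ i w = σ i z)
    (hT : ∀ i j, IsOrientedTransition (e i) (e j) (σ i) (σ j))
    (hρ : ∀ i j, ContDiffOn ℝ ∞ (ρ j ∘ (e i).symm) (e i).target)
    (hF : ∀ i, ContDiffOn ℝ ∞ (F ∘ (e i).symm) (e i).target)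
    (hh : ∀ i, ContDiffOn ℝ ∞ (h ∘ (e i).symm) (e i).target)
    (hcov : ∀ z, (∃ c, ∀ᶠ w in 𝓝 z, h w = c) ∨ ∀ᶠ w in 𝓝 z, ∑ i, ρ i w = 1) :
    ∑ i, formIntegral (e i) (σ i) (ρ i) F h = 0 := by
  have hdiff : ∀ {f : M → ℝ} {i : ι}, ContDiffOn ℝ ∞ (f ∘ (e i).symm) (e i).target →
      ∀ x ∈ (e i).target, DifferentiableAt ℝ (f ∘ (e i).symm) x := fun hf x hx =>
    (hf.contDiffAt ((e _).open_target.mem_nhds hx)).differentiableAt (by simp)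
  have h0' : ∀ i, ∀ z ∉ Q i, ∀ᶠ w in 𝓝 z, ρ i w = 0 := fun i z hz => by
    filter_upwards [(hQ i).isClosed.isOpen_compl.mem_nhds hz] with w hw using h0 i w hw
  have hint1 : ∀ i, IntegrableOn (formIntegrand (e i) (σ i) (ρ i) F h) (e i).target := fun i =>
    integrableOn_formIntegrand (hQ i) (hQe i) (fun z _ hz => Or.inl (h0 i z hz)) (hσ i)
      (hρ i i).continuousOn (hF i) (hh i)
  have hint2 : ∀ i, IntegrableOn (formIntegrand (e i) (σ i) F (ρ i) h) (e i).target := fun i =>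
    integrableOn_formIntegrand (hQ i) (hQe i) (fun z _ hz => Or.inr (Or.inl ⟨0, h0' i z hz⟩))
      (hσ i) (hF i).continuousOn (hρ i i) (hh i)
  have hint3 : ∀ i j, IntegrableOn (formIntegrand (e i) (σ i) (ρ j * F) (ρ i) h) (e i).target :=
    fun i j => integrableOn_formIntegrand (hQ i) (hQe i)
      (fun z _ hz => Or.inr (Or.inl ⟨0, h0' i z hz⟩))
      (hσ i) ((hρ i j).continuousOn.mul (hF i).continuousOn) (hρ i i) (hh i)
  have hint4 : ∀ i j, IntegrableOn (formIntegrand (e j) (σ j) (ρ j * F) (ρ i) h) (e j).target :=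
    fun i j => integrableOn_formIntegrand (hQ j) (hQe j)
      (fun z _ hz => Or.inl (by simp [h0 j z hz]))
      (hσ j) ((hρ j j).continuousOn.mul (hF j).continuousOn) (hρ j i) (hh j)
  -- By Leibniz, `ρ dF ∧ dh + F dρ ∧ dh = d(ρ F) ∧ dh`, which integrates to zero in the chart
  -- because `ρ F` has compact support there.
  have hleibniz : ∀ i, formIntegral (e i) (σ i) (ρ i) F h +
      formIntegral (e i) (σ i) F (ρ i) h = 0 := by
    intro i
    rw [formIntegral, formIntegral, ← integral_add (hint1 i) (hint2 i),
      ← formIntegral_one_eq_zero (a := ρ i * F) (b := h) (hQ i) (hQe i)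
        (fun z _ hz => by simp [h0 i z hz]) (hσ i) ((hρ i i).mul (hF i)) (hh i)]
    refine setIntegral_congr_fun (e i).open_target.measurableSet fun x hx => ?_
    simp only [formIntegrand, fderiv_mul_comp_symm (hdiff (hρ i i) x hx) (hdiff (hF i) x hx),
      wedge_add_left, wedge_smul_left, Pi.one_apply]
    ring
  -- Inserting `∑ j, ρ j = 1` and moving each term from chart `i` to chart `j` allows the sum over
  -- `i` to be taken first, in one chart, where `∑ i, dρ i = 0`. Where the sum is not known to be 1,
  -- `dh` vanishes.
  have hsplit : ∀ i, formIntegral (e i) (σ i) F (ρ i) h =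
      ∑ j, formIntegral (e i) (σ i) (ρ j * F) (ρ i) h := by
    intro i
    simp only [formIntegral]
    rw [← integral_finsetSum _ fun j _ => hint3 i j]
    refine setIntegral_congr_fun (e i).open_target.measurableSet fun x hx => ?_
    rcases hcov ((e i).symm x) with hc | hc
    · simp only [formIntegrand_eq_zero hx (Or.inr (Or.inr hc)), Finset.sum_const_zero]
    · have h1 := hc.self_of_nhds
      simp only [formIntegrand, Pi.mul_apply]
      rw [← Finset.sum_mul, ← Finset.mul_sum, ← Finset.sum_mul, h1, one_mul]
  have hchange : ∀ i j, formIntegral (e i) (σ i) (ρ j * F) (ρ i) h =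
      formIntegral (e j) (σ j) (ρ j * F) (ρ i) h := fun i j =>
    formIntegral_eq_of_isOrientedTransition (hT i j) (hdiff (hρ j i)) (hdiff (hh j))
      (fun x hx hz => formIntegrand_eq_zero hx
        (Or.inl (by simp [h0 j _ fun hq => hz (hQe j hq)])))
      (fun x hx hz => formIntegrand_eq_zero hx
        (Or.inr (Or.inl ⟨0, h0' i _ fun hq => hz (hQe i hq)⟩)))
  have hconst : ∀ j, ∑ i, formIntegral (e j) (σ j) (ρ j * F) (ρ i) h = 0 := by
    intro j
    simp only [formIntegral]
    rw [← integral_finsetSum _ fun i _ => hint4 i j]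
    refine setIntegral_eq_zero_of_forall_eq_zero fun x hx => ?_
    rcases hcov ((e j).symm x) with hc | hc
    · simp only [formIntegrand_eq_zero hx (Or.inr (Or.inr hc)), Finset.sum_const_zero]
    · have h1 : ∑ i, fderiv ℝ (ρ i ∘ (e j).symm) x = 0 := by
        rw [← fderiv_fun_sum fun i _ => hdiff (hρ j i) x hx]
        have : (fun y => ∑ i, (ρ i ∘ (e j).symm) y) =ᶠ[𝓝 x] fun _ => 1 :=
          ((e j).symm.continuousAt hx).eventually hc
        rw [this.fderiv_eq]
        simp
      simp only [formIntegrand]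
      rw [← Finset.mul_sum, ← wedge_sum_left, h1, wedge_zero_left, mul_zero]
  have htotal : ∑ i, formIntegral (e i) (σ i) F (ρ i) h = 0 := by
    simp only [hsplit]
    rw [Finset.sum_congr rfl fun i _ => Finset.sum_congr rfl fun j _ => hchange i j,
      Finset.sum_comm]
    exact Finset.sum_eq_zero fun j _ => hconst j
  have := Finset.sum_add_distrib (s := Finset.univ)
    (f := fun i => formIntegral (e i) (σ i) (ρ i) F h)
    (g := fun i => formIntegral (e i) (σ i) F (ρ i) h)
  simp only [hleibniz, Finset.sum_const_zero, htotal, add_zero] at this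
  exact this.symm

/-- Under the same hypotheses, the integral over a further chart outside of which `F` or `h` is
locally constant vanishes. -/
lemma formIntegral_one_eq_zero_of_cover (hQ : ∀ i, IsCompact (Q i))
    (hQe : ∀ i, Q i ⊆ (e i).source)
    (h0 : ∀ i, ∀ z ∉ Q i, ρ i z = 0) (hσ : ∀ i, ∀ z ∈ (e i).source, ∀ᶠ w in 𝓝 z, σ i w = σ i z)
    (hT : ∀ i j, IsOrientedTransition (e i) (e j) (σ i) (σ j))
    (hρ : ∀ i j, ContDiffOn ℝ ∞ (ρ j ∘ (e i).symm) (e i).target)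
    (hF : ∀ i, ContDiffOn ℝ ∞ (F ∘ (e i).symm) (e i).target)
    (hh : ∀ i, ContDiffOn ℝ ∞ (h ∘ (e i).symm) (e i).target)
    (hcov : ∀ z, (∃ c, ∀ᶠ w in 𝓝 z, h w = c) ∨ ∀ᶠ w in 𝓝 z, ∑ i, ρ i w = 1)
    {e' : OpenPartialHomeomorph M (EuclideanSpace ℝ (Fin 2))} {σ' : M → ℝ}
    (hσ' : ∀ z ∈ e'.source, ∀ᶠ w in 𝓝 z, σ' w = σ' z)
    (hT' : ∀ i, IsOrientedTransition (e i) e' (σ i) σ')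
    (hρ' : ∀ j, ContDiffOn ℝ ∞ (ρ j ∘ e'.symm) e'.target)
    (hF' : ContDiffOn ℝ ∞ (F ∘ e'.symm) e'.target) (hh' : ContDiffOn ℝ ∞ (h ∘ e'.symm) e'.target)
    (hout : ∀ z ∉ e'.source, (∃ c, ∀ᶠ w in 𝓝 z, F w = c) ∨ ∃ c, ∀ᶠ w in 𝓝 z, h w = c) :
    formIntegral e' σ' 1 F h = 0 := by
  set G : Set M := {z | (∃ c, ∀ᶠ w in 𝓝 z, F w = c) ∨ ∃ c, ∀ᶠ w in 𝓝 z, h w = c}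
  have hG : IsOpen G := by
    refine isOpen_iff_mem_nhds.2 fun z hz => ?_
    rcases hz with ⟨c, hc⟩ | ⟨c, hc⟩
    · filter_upwards [hc.eventually_nhds] with w hw using Or.inl ⟨c, hw⟩
    · filter_upwards [hc.eventually_nhds] with w hw using Or.inr ⟨c, hw⟩
  -- The set `Q i` need not lie in `e'.source`. Outside that source `F` or `h` is locally constant,
  -- so the integrand lives on the compact set `Q i \ G`, which does lie there.
  have hint : ∀ i, IntegrableOn (formIntegrand e' σ' (ρ i) F h) e'.target := by
    intro i
    refine integrableOn_formIntegrand (Q := Q i \ G) ((hQ i).diff hG)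
      (fun z hz => by_contra fun hz' => hz.2 (hout z hz')) (fun z _ hz => ?_) hσ'
      (hρ' i).continuousOn hF' hh'
    by_cases hzQ : z ∈ Q i
    · exact Or.inr (by_contra fun hzG => hz ⟨hzQ, hzG⟩)
    · exact Or.inl (h0 i z hzQ)
  have hdiff : ∀ {f : M → ℝ}, ContDiffOn ℝ ∞ (f ∘ e'.symm) e'.target →
      ∀ x ∈ e'.target, DifferentiableAt ℝ (f ∘ e'.symm) x := fun hf x hx =>
    (hf.contDiffAt (e'.open_target.mem_nhds hx)).differentiableAt (by simp)
  rw [← sum_formIntegral_eq_zero hQ hQe h0 hσ hT hρ hF hh hcov]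
  have hchange : ∀ i, formIntegral (e i) (σ i) (ρ i) F h = formIntegral e' σ' (ρ i) F h :=
    fun i => formIntegral_eq_of_isOrientedTransition (hT' i) (hdiff hF') (hdiff hh')
      (fun x hx hz => formIntegrand_eq_zero hx (Or.inr (hout _ hz)))
      (fun x hx hz => formIntegrand_eq_zero hx
        (Or.inl (h0 i _ fun hq => hz (hQe i hq))))
  simp only [hchange]
  simp only [formIntegral]
  rw [← integral_finsetSum _ fun i _ => hint i]
  refine setIntegral_congr_fun e'.open_target.measurableSet fun x hx => ?_
  rcases hcov (e'.symm x) with hc | hc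
  · simp only [formIntegrand_eq_zero hx (Or.inr (Or.inr hc)), Finset.sum_const_zero]
  · have h1 := hc.self_of_nhds
    simp only [formIntegrand, Pi.one_apply]
    rw [← Finset.sum_mul, ← Finset.mul_sum, h1]

end Cancellation

end EndTheory
end

noncomputable section
namespace EndTheory

set_option linter.unusedSectionVars false

open Set Topology Filter

/-! ### Smooth charts and their orientation signs -/

section SmoothChart

variable {m : ℕ} [NeZero m] {M : Type*} [TopologicalSpace M]
  [ChartedSpace (EuclideanHalfSpace m) M]

/-- A chart of `M` with values in Euclidean space that is a diffeomorphism onto its image. -/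
structure IsSmoothChart (e : OpenPartialHomeomorph M (EuclideanSpace ℝ (Fin m))) : Prop where
  contMDiffOn : ContMDiffOn (𝓡∂ m) 𝓘(ℝ, EuclideanSpace ℝ (Fin m)) ∞ e e.source
  contMDiffOn_symm : ContMDiffOn 𝓘(ℝ, EuclideanSpace ℝ (Fin m)) (𝓡∂ m) ∞ e.symm e.target

variable {e e' : OpenPartialHomeomorph M (EuclideanSpace ℝ (Fin m))}

lemma IsSmoothChart.contDiffOn_comp_symm (he : IsSmoothChart e) {f : M → ℝ}
    (hf : ContMDiff (𝓡∂ m) 𝓘(ℝ, ℝ) ∞ f) : ContDiffOn ℝ ∞ (f ∘ e.symm) e.target :=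
  contMDiffOn_iff_contDiffOn.1 (hf.comp_contMDiffOn he.contMDiffOn_symm)

lemma IsSmoothChart.contDiffAt_transition (he : IsSmoothChart e) (he' : IsSmoothChart e')
    {z : M} (hz : z ∈ e.source) (hz' : z ∈ e'.source) : ContDiffAt ℝ ∞ (e' ∘ e.symm) (e z) := by
  refine contMDiffAt_iff_contDiffAt.1 (ContMDiffAt.comp (I' := 𝓡∂ m) (e z) ?_
    (he.contMDiffOn_symm.contMDiffAt (e.open_target.mem_nhds (e.map_source hz))))
  rw [e.left_inv hz]
  exact he'.contMDiffOn.contMDiffAt (e'.open_source.mem_nhds hz')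

/-- The derivative of a chart, as an endomorphism of Euclidean space. -/
def chartDeriv (e : OpenPartialHomeomorph M (EuclideanSpace ℝ (Fin m))) (z : M) :
    EuclideanSpace ℝ (Fin m) →L[ℝ] EuclideanSpace ℝ (Fin m) :=
  mfderiv (𝓡∂ m) 𝓘(ℝ, EuclideanSpace ℝ (Fin m)) e z

lemma IsSmoothChart.mdifferentiableAt (he : IsSmoothChart e) {z : M} (hz : z ∈ e.source) :
    MDifferentiableAt (𝓡∂ m) 𝓘(ℝ, EuclideanSpace ℝ (Fin m)) e z :=
  (he.contMDiffOn.contMDiffAt (e.open_source.mem_nhds hz)).mdifferentiableAt (by simp)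

lemma IsSmoothChart.det_chartDeriv_ne_zero (he : IsSmoothChart e) {z : M} (hz : z ∈ e.source) :
    (chartDeriv e z).det ≠ 0 := by
  have h1 := (he.mdifferentiableAt hz).hasMFDerivAt
  have h2 : MDifferentiableAt 𝓘(ℝ, EuclideanSpace ℝ (Fin m)) (𝓡∂ m) e.symm (e z) :=
    (he.contMDiffOn_symm.contMDiffAt
      (e.open_target.mem_nhds (e.map_source hz))).mdifferentiableAt (by simp)
  have h3 := h2.hasMFDerivAt.comp z h1
  have h4 : e.symm ∘ e =ᶠ[𝓝 z] id := by
    filter_upwards [e.open_source.mem_nhds hz] with w hw using e.left_inv hw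
  have h5 : HasMFDerivAt (𝓡∂ m) (𝓡∂ m) (e.symm ∘ e) z (ContinuousLinearMap.id ℝ _) :=
    (hasMFDerivAt_id z).congr_of_eventuallyEq h4
  have h6 := hasMFDerivAt_unique h3 h5
  intro h0
  set B : EuclideanSpace ℝ (Fin m) →L[ℝ] EuclideanSpace ℝ (Fin m) :=
    mfderiv 𝓘(ℝ, EuclideanSpace ℝ (Fin m)) (𝓡∂ m) e.symm (e z)
  have h7 : B.comp (chartDeriv e z) = ContinuousLinearMap.id ℝ _ := h6
  have h8 := congrArg ContinuousLinearMap.det h7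
  have h9 : (B.comp (chartDeriv e z)).det = B.det * (chartDeriv e z).det :=
    LinearMap.det_comp (B : EuclideanSpace ℝ (Fin m) →ₗ[ℝ] EuclideanSpace ℝ (Fin m))
      (chartDeriv e z : EuclideanSpace ℝ (Fin m) →ₗ[ℝ] EuclideanSpace ℝ (Fin m))
  rw [h9, h0, mul_zero] at h8
  have h10 : (ContinuousLinearMap.id ℝ (EuclideanSpace ℝ (Fin m))).det = 1 := LinearMap.det_id
  rw [h10] at h8
  exact zero_ne_one h8

lemma IsSmoothChart.det_chartDeriv_eq (he : IsSmoothChart e) (he' : IsSmoothChart e')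
    {z : M} (hz : z ∈ e.source) (hz' : z ∈ e'.source) :
    (chartDeriv e' z).det = (fderiv ℝ (e' ∘ e.symm) (e z)).det * (chartDeriv e z).det := by
  have h1 := (he.mdifferentiableAt hz).hasMFDerivAt
  have h2 : HasMFDerivAt 𝓘(ℝ, EuclideanSpace ℝ (Fin m)) 𝓘(ℝ, EuclideanSpace ℝ (Fin m))
      (e' ∘ e.symm) (e z) (fderiv ℝ (e' ∘ e.symm) (e z)) :=
    ((he.contDiffAt_transition he' hz hz').differentiableAt
      (by simp)).hasFDerivAt.hasMFDerivAt
  have h3 := h2.comp z h1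
  have h4 : e' =ᶠ[𝓝 z] (e' ∘ e.symm) ∘ e := by
    filter_upwards [e.open_source.mem_nhds hz] with w hw
    exact congrArg e' (e.left_inv hw).symm
  have h5 := hasMFDerivAt_unique (he'.mdifferentiableAt hz').hasMFDerivAt
    (h3.congr_of_eventuallyEq h4)
  have h6 : chartDeriv e' z = (fderiv ℝ (e' ∘ e.symm) (e z)).comp (chartDeriv e z) := h5
  rw [h6]
  exact LinearMap.det_comp
    (fderiv ℝ (e' ∘ e.symm) (e z) : EuclideanSpace ℝ (Fin m) →ₗ[ℝ] EuclideanSpace ℝ (Fin m))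
    (chartDeriv e z : EuclideanSpace ℝ (Fin m) →ₗ[ℝ] EuclideanSpace ℝ (Fin m))

/-- The sign of an orientation of Euclidean space. -/
def orientationSign (o : Orientation ℝ (EuclideanSpace ℝ (Fin m)) (Fin m)) : ℝ :=
  open scoped Classical in
  if o = (EuclideanSpace.basisFun (Fin m) ℝ).toBasis.orientation then 1 else -1

lemma orientationSign_map (o : Orientation ℝ (EuclideanSpace ℝ (Fin m)) (Fin m))
    (f : EuclideanSpace ℝ (Fin m) ≃ₗ[ℝ] EuclideanSpace ℝ (Fin m)) :
    orientationSign (Orientation.map (Fin m) f o) = orientationSign o *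
      SignType.sign (LinearMap.det (f : EuclideanSpace ℝ (Fin m) →ₗ[ℝ] _)) := by
  have hcard : Fintype.card (Fin m) = Module.finrank ℝ (EuclideanSpace ℝ (Fin m)) := by simp
  set b := (EuclideanSpace.basisFun (Fin m) ℝ).toBasis.orientation
  have hb : ∀ o : Orientation ℝ (EuclideanSpace ℝ (Fin m)) (Fin m), o = b ∨ o = -b := fun o =>
    o.eq_or_eq_neg b hcard
  have hneg : ∀ o : Orientation ℝ (EuclideanSpace ℝ (Fin m)) (Fin m),
      orientationSign (-o) = -orientationSign o := by
    intro o
    rcases hb o with rfl | rfl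
    · simp [orientationSign, b, (Module.Ray.ne_neg_self _).symm]
    · rw [show -(-b) = b from neg_neg (G := Module.Ray ℝ _) b]
      simp [orientationSign, b, (Module.Ray.ne_neg_self _).symm]
  have hdet : LinearMap.det (f : EuclideanSpace ℝ (Fin m) →ₗ[ℝ] EuclideanSpace ℝ (Fin m)) ≠ 0 :=
    f.isUnit_det'.ne_zero
  rcases hdet.lt_or_gt with h | h
  · rw [(Orientation.map_eq_neg_iff_det_neg o f hcard).2 h, hneg, sign_neg h]
    simp
  · rw [(Orientation.map_eq_iff_det_pos o f hcard).2 h, sign_pos h]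
    simp

/-- The sign of a chart relative to a family of orientations of the tangent spaces. -/
def chartSign (o : ∀ x : M, Orientation ℝ (TangentSpace (𝓡∂ m) x) (Fin m))
    (e : OpenPartialHomeomorph M (EuclideanSpace ℝ (Fin m))) (z : M) : ℝ :=
  orientationSign (o z : Orientation ℝ (EuclideanSpace ℝ (Fin m)) (Fin m)) *
    SignType.sign (chartDeriv e z).det

variable {o : ∀ x : M, Orientation ℝ (TangentSpace (𝓡∂ m) x) (Fin m)}

lemma IsSmoothChart.chartSign_ne_zero (he : IsSmoothChart e) {z : M} (hz : z ∈ e.source) :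
    chartSign o e z ≠ 0 := by
  refine mul_ne_zero ?_ ?_
  · unfold orientationSign
    split_ifs <;> norm_num
  · rcases (he.det_chartDeriv_ne_zero hz).lt_or_gt with h | h
    · simp [sign_neg h]
    · simp [sign_pos h]

lemma IsSmoothChart.chartSign_eq (he : IsSmoothChart e) (he' : IsSmoothChart e')
    {z : M} (hz : z ∈ e.source) (hz' : z ∈ e'.source) :
    chartSign o e' z =
      chartSign o e z * SignType.sign (fderiv ℝ (e' ∘ e.symm) (e z)).det := by
  simp only [chartSign]
  rw [he.det_chartDeriv_eq he' hz hz', sign_mul]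
  push_cast
  ring

/-- Both signs compare a chart with the same orientation at `z`, so they differ by the sign of the
Jacobian determinant `d`, and `d * sign d = |d|`. -/
lemma IsSmoothChart.isOrientedTransition {M : Type*} [TopologicalSpace M]
    [ChartedSpace (EuclideanHalfSpace 2) M]
    {o : ∀ x : M, Orientation ℝ (TangentSpace (𝓡∂ 2) x) (Fin 2)}
    {e e' : OpenPartialHomeomorph M (EuclideanSpace ℝ (Fin 2))}
    (he : IsSmoothChart e) (he' : IsSmoothChart e') :
    IsOrientedTransition e e' (chartSign o e) (chartSign o e') := by
  rintro z ⟨hz, hz'⟩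
  refine ⟨_, ((he.contDiffAt_transition he' hz hz').differentiableAt (by simp)).hasFDerivAt, ?_⟩
  rw [he.chartSign_eq he' hz hz']
  set d := (fderiv ℝ (e' ∘ e.symm) (e z)).det
  rw [mul_left_comm, abs_mul_sign]

variable [IsManifold (𝓡∂ m) ∞ M]

lemma isSmoothChart_interiorChart (c : M) : IsSmoothChart (interiorChart m c) where
  contMDiffOn := contMDiffOn_extChartAt.mono fun _ hx => hx.1
  contMDiffOn_symm := (contMDiffOn_extChartAt_symm c).mono interior_subset

/-- The derivative of the chart is the tangent bundle trivialization at `c`. The chart sign is thus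
the sign of the orientation read in that trivialization, where it is locally constant by definition.
-/
lemma IsManifoldOrientation.eventually_chartSign_interiorChart
    (ho : IsManifoldOrientation m o) (c : M) {z : M} (hz : z ∈ (interiorChart m c).source) :
    ∀ᶠ w in 𝓝 z, chartSign o (interiorChart m c) w = chartSign o (interiorChart m c) z := by
  have hmem : ∀ w ∈ (interiorChart m c).source, w ∈ (trivializationAt (EuclideanSpace ℝ (Fin m))
      (TangentSpace (𝓡∂ m) : M → Type) c).baseSet := fun w hw => hw.1
  have hsign : ∀ w (hw : w ∈ (interiorChart m c).source), chartSign o (interiorChart m c) w =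
      orientationSign (Orientation.map (Fin m) ((trivializationAt (EuclideanSpace ℝ (Fin m))
        (TangentSpace (𝓡∂ m) : M → Type) c).continuousLinearEquivAt ℝ w
          (hmem w hw)).toLinearEquiv (o w)) := by
    intro w hw
    have h1 := TangentBundle.continuousLinearMapAt_trivializationAt (I := 𝓡∂ m) hw.1
    set f := ((trivializationAt (EuclideanSpace ℝ (Fin m))
        (TangentSpace (𝓡∂ m) : M → Type) c).continuousLinearEquivAt ℝ w
          (hmem w hw))
    set g : EuclideanSpace ℝ (Fin m) ≃ₗ[ℝ] EuclideanSpace ℝ (Fin m) := f.toLinearEquiv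
    have h2 : (g : EuclideanSpace ℝ (Fin m) →ₗ[ℝ] EuclideanSpace ℝ (Fin m)) =
        (chartDeriv (interiorChart m c) w :
          EuclideanSpace ℝ (Fin m) →ₗ[ℝ] EuclideanSpace ℝ (Fin m)) := by
      ext v : 1
      exact (congrFun (Bundle.Trivialization.coe_continuousLinearEquivAt_eq _ (hmem w hw)) v).trans
        (congrArg (fun g => g v) h1)
    have h3 := orientationSign_map (o w : Orientation ℝ (EuclideanSpace ℝ (Fin m)) (Fin m))
      g
    refine Eq.trans ?_ h3.symm
    rw [chartSign]
    congr 3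
    exact congrArg LinearMap.det h2.symm
  filter_upwards [ho c z (hmem z hz), (interiorChart m c).open_source.mem_nhds hz] with w hw hwc
  rw [hsign w hwc, hsign z hz, hw (hmem w hwc)]

/-- The sign of a smooth chart is locally constant. -/
lemma IsManifoldOrientation.eventually_chartSign (ho : IsManifoldOrientation m o)
    (he : IsSmoothChart e) {z : M} (hz : z ∈ e.source) (hzi : z ∈ (𝓡∂ m).interior M) :
    ∀ᶠ w in 𝓝 z, chartSign o e w = chartSign o e z := by
  set c := interiorChart m z
  have hzc : z ∈ c.source := mem_interiorChart_source hzi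
  have hc : IsSmoothChart c := isSmoothChart_interiorChart z
  have hcont : ContinuousAt (fun w => (fderiv ℝ (e ∘ c.symm) (c w)).det) z := by
    have h1 : ContinuousAt (fderiv ℝ (e ∘ c.symm)) (c z) :=
      ((hc.contDiffAt_transition he hzc hz).fderiv_right (m := 0) (by simp)).continuousAt
    exact ContinuousLinearMap.continuous_det.continuousAt.comp
      (ContinuousAt.comp (f := c) h1 (c.continuousAt hzc))
  have hne : (fderiv ℝ (e ∘ c.symm) (c z)).det ≠ 0 := fun h0 => by
    have := hc.det_chartDeriv_eq he hzc hz
    rw [h0, zero_mul] at this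
    exact he.det_chartDeriv_ne_zero hz this
  have hsign : ∀ᶠ w in 𝓝 z, SignType.sign (fderiv ℝ (e ∘ c.symm) (c w)).det =
      SignType.sign (fderiv ℝ (e ∘ c.symm) (c z)).det := by
    rcases hne.lt_or_gt with h | h
    · filter_upwards [hcont.eventually (gt_mem_nhds h)] with w hw
      rw [sign_neg h, sign_neg hw]
    · filter_upwards [hcont.eventually (lt_mem_nhds h)] with w hw
      rw [sign_pos h, sign_pos hw]
  filter_upwards [hsign, ho.eventually_chartSign_interiorChart z hzc,
    c.open_source.mem_nhds hzc, e.open_source.mem_nhds hz] with w h1 h2 h3 h4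
  rw [hc.chartSign_eq he h3 h4, hc.chartSign_eq he hzc hz, h1, h2]

end SmoothChart

/-! ### The open regular neighborhood as a chart -/

section EmbeddingChart

variable {m : ℕ} [NeZero m] {M : Type*} [TopologicalSpace M]
  [ChartedSpace (EuclideanHalfSpace m) M] [IsManifold (𝓡∂ m) ∞ M] {Φ : EuclideanHalfSpace m → M}

/-- The inverse of the restriction of `Φ` to the open half-space, as a chart. -/
def IsSmoothProperEmbedding.chart (hΦ : IsSmoothProperEmbedding m m Φ) :
    OpenPartialHomeomorph M (EuclideanSpace ℝ (Fin m)) where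
  toFun z := (Function.invFun Φ z).1
  invFun x := Φ ((𝓡∂ m).symm x)
  source := Φ '' {p | 0 < p.1 0}
  target := {x | 0 < x 0}
  map_source' := by
    rintro _ ⟨p, hp, rfl⟩
    rw [Function.leftInverse_invFun hΦ.injective p]
    exact hp
  map_target' x hx := by
    refine ⟨⟨x, le_of_lt hx⟩, hx, ?_⟩
    rw [← halfSpace_symm_coe ⟨x, le_of_lt hx⟩]
  left_inv' := by
    rintro _ ⟨p, hp, rfl⟩
    rw [Function.leftInverse_invFun hΦ.injective p, halfSpace_symm_coe]
  right_inv' x hx := by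
    have : (𝓡∂ m).symm x = ⟨x, le_of_lt hx⟩ := halfSpace_symm_coe ⟨x, le_of_lt hx⟩
    rw [this, Function.leftInverse_invFun hΦ.injective]
  open_source := hΦ.isOpen_image_interior
  open_target := isOpen_lt continuous_const
    (EuclideanSpace.proj (𝕜 := ℝ) (0 : Fin m)).continuous
  continuousOn_toFun := by
    refine continuous_subtype_val.comp_continuousOn
      (hΦ.isClosedEmbedding.isInducing.continuousOn_iff.2 (continuousOn_id.congr ?_))
    rintro _ ⟨p, hp, rfl⟩
    exact congrArg Φ (Function.leftInverse_invFun hΦ.injective p)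
  continuousOn_invFun := (hΦ.isProperMap.continuous.comp (𝓡∂ m).continuous_symm).continuousOn

/-- One direction is `Φ` itself. For the other, at a point with positive first coordinate the
half-space is a neighborhood, so the derivative within it is an honest invertible derivative and the
inverse is smooth. -/
lemma IsSmoothProperEmbedding.isSmoothChart_chart (hΦ : IsSmoothProperEmbedding m m Φ) :
    IsSmoothChart hΦ.chart where
  contMDiffOn_symm := by
    refine hΦ.contMDiff.comp_contMDiffOn ((𝓡∂ m).contMDiffOn_symm.mono fun x hx => ?_)
    rw [range_modelWithCorners_halfSpace]
    exact le_of_lt (show 0 < x 0 from hx)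
  contMDiffOn := by
    rintro _ ⟨p, hp, rfl⟩
    refine ContMDiffAt.contMDiffWithinAt ?_
    set c := interiorChart m (Φ p)
    have hpc : Φ p ∈ c.source := mem_interiorChart_source (hΦ.mem_interior p)
    have hmem : Φ p ∈ hΦ.chart.source := ⟨p, hp, rfl⟩
    have hval : hΦ.chart (Φ p) = p.1 :=
      congrArg Subtype.val (Function.leftInverse_invFun hΦ.injective p)
    set f := hΦ.chart.symm.trans c with hf
    have hnhds : halfSpace m ∈ 𝓝 p.1 := by
      refine mem_of_superset (hΦ.chart.open_target.mem_nhds ?_) fun x hx =>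
        le_of_lt (show 0 < x 0 from hx)
      exact hp
    have hfe : ⇑f = chartExpr Φ p := rfl
    have hcd : ContDiffAt ℝ ∞ f p.1 := (hΦ.contDiffWithinAt_chartExpr p).contDiffAt hnhds
    obtain ⟨D, hD⟩ := hΦ.exists_equiv_fderivWithin p
    have hfsymm : f.symm (c (Φ p)) = p.1 := by
      change hΦ.chart (c.symm (c (Φ p))) = p.1
      rw [c.left_inv hpc, hval]
    have htar : c (Φ p) ∈ f.target := by
      rw [hf, OpenPartialHomeomorph.trans_target]
      refine ⟨c.map_source hpc, ?_⟩
      change c.symm (c (Φ p)) ∈ hΦ.chart.source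
      rw [c.left_inv hpc]
      exact hmem
    have hinv : ContDiffAt ℝ ∞ f.symm (c (Φ p)) := by
      refine f.contDiffAt_symm (f₀' := D) htar ?_ (by rw [hfsymm]; exact hcd)
      rw [hfsymm, hD, fderivWithin_of_mem_nhds hnhds, ← hfe]
      exact (hcd.differentiableAt (by simp)).hasFDerivAt
    have hcomp : ContMDiffAt (𝓡∂ m) 𝓘(ℝ, EuclideanSpace ℝ (Fin m)) ∞ (f.symm ∘ c) (Φ p) :=
      hinv.contMDiffAt.comp (Φ p)
        ((isSmoothChart_interiorChart (Φ p)).contMDiffOn.contMDiffAt (c.open_source.mem_nhds hpc))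
    refine hcomp.congr_of_eventuallyEq ?_
    filter_upwards [c.open_source.mem_nhds hpc] with w hw
    exact congrArg hΦ.chart (c.left_inv hw).symm

end EmbeddingChart

end EndTheory
end

noncomputable section
namespace EndTheory

set_option linter.unusedSectionVars false

open Set Topology Filter MeasureTheory

/-! ### The integral over the strip -/

section SmoothStep

/-- `g` is a smooth monotone function that increases from `0` to `1` on `[p, q]`. -/
structure IsSmoothStep (g : ℝ → ℝ) (p q : ℝ) : Prop where
  contDiff : ContDiff ℝ ∞ g
  monotone : Monotone g
  eq_zero : ∀ t ≤ p, g t = 0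
  eq_one : ∀ t, q ≤ t → g t = 1

lemma exists_isSmoothStep {p q : ℝ} (h : p < q) : ∃ g, IsSmoothStep g p q := by
  have hpq : 0 < q - p := sub_pos.2 h
  refine ⟨fun t => Real.smoothTransition ((t - p) / (q - p)), ?_, ?_, ?_, ?_⟩
  · exact Real.smoothTransition.contDiff.comp (by fun_prop)
  · intro t t' ht
    exact Real.smoothTransition.monotone (by gcongr)
  · intro t ht
    exact Real.smoothTransition.zero_of_nonpos
      (div_nonpos_of_nonpos_of_nonneg (sub_nonpos.2 ht) hpq.le)
  · intro t ht
    exact Real.smoothTransition.one_of_one_le ((one_le_div hpq).2 (by linarith))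

variable {g : ℝ → ℝ} {p q : ℝ}

lemma IsSmoothStep.continuous_deriv (hg : IsSmoothStep g p q) : Continuous (deriv g) :=
  hg.contDiff.continuous_deriv (by simp)

lemma IsSmoothStep.deriv_eq_zero (hg : IsSmoothStep g p q) {t : ℝ} (ht : t ∉ Icc p q) :
    deriv g t = 0 := by
  have : ∃ c, g =ᶠ[𝓝 t] fun _ => c := by
    rcases lt_or_ge t p with h | h
    · exact ⟨0, by filter_upwards [gt_mem_nhds h] with u hu using hg.eq_zero u hu.le⟩
    · have h' : q < t := not_le.1 fun h' => ht ⟨h, h'⟩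
      exact ⟨1, by filter_upwards [lt_mem_nhds h'] with u hu using hg.eq_one u hu.le⟩
  obtain ⟨c, hc⟩ := this
  rw [hc.deriv_eq, deriv_const]

lemma IsSmoothStep.exists_deriv_ne_zero (hg : IsSmoothStep g p q) : ∃ t, deriv g t ≠ 0 := by
  by_contra! h
  have := is_const_of_deriv_eq_zero (hg.contDiff.differentiable (by simp)) h p (max p q)
  rw [hg.eq_zero p le_rfl, hg.eq_one _ (le_max_right _ _)] at this
  exact zero_ne_one this

lemma isCompact_box (a b c d : ℝ) :
    IsCompact {x : EuclideanSpace ℝ (Fin 2) | x 0 ∈ Icc a b ∧ x 1 ∈ Icc c d} := by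
  have h := (EuclideanSpace.equiv (Fin 2) ℝ).toHomeomorph.isCompact_preimage.2
    (isCompact_univ_pi (X := fun _ : Fin 2 => ℝ)
      (s := fun i => if i = 0 then Icc a b else Icc c d) fun i => by
        split_ifs <;> exact isCompact_Icc)
  convert h using 1
  ext x
  simp [Fin.forall_fin_two]

/-- The integral of `s'(x₁) ∂₀k` over the half-plane does not vanish if `k` has bounded support
and equals `1` on the left of a box that contains the support of `s'`. -/
lemma integral_deriv_mul_fderiv_ne_zero {R : ℝ} (hR : 0 < R) {s : ℝ → ℝ}
    (hs : IsSmoothStep s (-R) R) {k : EuclideanSpace ℝ (Fin 2) → ℝ}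
    (hk : ContDiffOn ℝ ∞ k {x | 0 < x 0}) {C : Set (EuclideanSpace ℝ (Fin 2))} (hC : IsCompact C)
    (hkC : ∀ x : EuclideanSpace ℝ (Fin 2), 0 < x 0 → x ∉ C → k x = 0)
    (hk1 : ∀ x : EuclideanSpace ℝ (Fin 2), 0 < x 0 → x 0 ≤ R → x 1 ∈ Icc (-R) R → k x = 1) :
    ∫ x in {x : EuclideanSpace ℝ (Fin 2) | 0 < x 0},
      deriv s (x 1) * fderiv ℝ k x (EuclideanSpace.single 0 1) ≠ 0 := by
  -- The step `μ` rises within `[R / 2, R]`, where `k = 1` over the box. Hence `k - 1 + μ` vanishes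
  -- near the edge `x 0 = 0` and equals `k` beyond `R`, and multiplied by `s'` it has compact
  -- support in the open half-plane.
  obtain ⟨μ, hμ⟩ := exists_isSmoothStep (half_lt_self hR)
  set U : Set (EuclideanSpace ℝ (Fin 2)) := {x | 0 < x 0} with hUdef
  have hc : ∀ i : Fin 2, Continuous fun x : EuclideanSpace ℝ (Fin 2) => x i := fun i =>
    (EuclideanSpace.proj (𝕜 := ℝ) i).continuous
  have hU : IsOpen U := isOpen_lt continuous_const (hc 0)
  have hpr : ∀ (i : Fin 2) x, HasFDerivAt (fun x : EuclideanSpace ℝ (Fin 2) => x i)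
      (EuclideanSpace.proj (𝕜 := ℝ) i) x := fun i x =>
    (EuclideanSpace.proj (𝕜 := ℝ) i).hasFDerivAt
  have hprc : ∀ i : Fin 2, ContDiff ℝ ∞ fun x : EuclideanSpace ℝ (Fin 2) => x i := fun i =>
    (EuclideanSpace.proj (𝕜 := ℝ) i).contDiff
  have hs' : ContDiff ℝ 1 (deriv s) :=
    (contDiff_infty_iff_deriv.1 hs.contDiff).2.of_le (by exact_mod_cast le_top)
  -- a function with compact support whose derivative differs from the integrand by `s'(x₁) μ'(x₀)`
  set w : EuclideanSpace ℝ (Fin 2) → ℝ := fun x => deriv s (x 1) * (k x - 1 + μ (x 0)) with hw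
  set C' := (C ∪ {x | x 0 ∈ Icc (R / 2) R ∧ x 1 ∈ Icc (-R) R}) ∩ {x | R / 2 ≤ x 0}
  have hC' : IsCompact C' :=
    (hC.union (isCompact_box _ _ _ _)).inter_right (isClosed_le continuous_const (hc 0))
  have hC'U : C' ⊆ U := fun x hx => (half_pos hR).trans_le hx.2
  have hwC : ContDiffOn ℝ ((1 : ℕ∞) : WithTop ℕ∞) w U :=
    (hs'.comp ((hprc 1).of_le (by simp))).contDiffOn.mul
      (((hk.of_le (by simp)).sub contDiffOn_const).add
        ((hμ.contDiff.comp (hprc 0)).of_le (by simp)).contDiffOn)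
  have hw0 : ∀ x ∈ U, x ∉ C' → w x = 0 := by
    intro x hx hxC
    by_cases hx1 : x 1 ∈ Icc (-R) R
    · by_cases hx0 : R / 2 ≤ x 0
      · have h1 : x ∉ C := fun h => hxC ⟨Or.inl h, hx0⟩
        have h2 : R < x 0 := not_le.1 fun h => hxC ⟨Or.inr ⟨⟨hx0, h⟩, hx1⟩, hx0⟩
        simp [hw, hkC x hx h1, hμ.eq_one _ h2.le]
      · rw [not_le] at hx0
        simp [hw, hk1 x hx (by linarith) hx1, hμ.eq_zero _ hx0.le]
    · simp [hw, hs.deriv_eq_zero hx1]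
  obtain ⟨hP, hPc⟩ := contDiff_indicator hU hC' hwC hw0 hC'U
  set v : EuclideanSpace ℝ (Fin 2) := EuclideanSpace.single 0 1
  have hder : ∀ x ∈ U, fderiv ℝ (U.indicator w) x v =
      deriv s (x 1) * fderiv ℝ k x v + deriv s (x 1) * deriv μ (x 0) := by
    intro x hx
    have h1 : HasFDerivAt (deriv s ∘ fun x : EuclideanSpace ℝ (Fin 2) => x 1) _ x :=
      ((hs'.differentiable one_ne_zero (x 1)).hasDerivAt).comp_hasFDerivAt x (hpr 1 x)
    have h2 : HasFDerivAt (μ ∘ fun x : EuclideanSpace ℝ (Fin 2) => x 0) _ x :=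
      ((hμ.contDiff.differentiable (by simp) (x 0)).hasDerivAt).comp_hasFDerivAt x (hpr 0 x)
    have h3 := ((hk.contDiffAt (hU.mem_nhds hx)).differentiableAt (by simp)).hasFDerivAt
    have h4 := h1.mul ((h3.sub_const 1).add h2)
    have h5 : U.indicator w =ᶠ[𝓝 x] w := by
      filter_upwards [hU.mem_nhds hx] with y hy using indicator_of_mem hy w
    rw [(h4.congr_of_eventuallyEq h5).fderiv]
    simp [v]
  set f : EuclideanSpace ℝ (Fin 2) → ℝ := fun x => deriv s (x 1) * deriv μ (x 0) with hf
  have hfc : Continuous f :=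
    (hs.continuous_deriv.comp (hc 1)).mul (hμ.continuous_deriv.comp (hc 0))
  have hfs : HasCompactSupport f := by
    refine HasCompactSupport.intro (isCompact_box (R / 2) R (-R) R) fun x hx => ?_
    by_cases h0 : x 0 ∈ Icc (R / 2) R
    · have h1 : x 1 ∉ Icc (-R) R := fun h => hx ⟨h0, h⟩
      simp [hf, hs.deriv_eq_zero h1]
    · simp [hf, hμ.deriv_eq_zero h0]
  have hfpos : 0 < ∫ x, f x := by
    obtain ⟨a, ha⟩ := hs.exists_deriv_ne_zero
    obtain ⟨b, hb⟩ := hμ.exists_deriv_ne_zero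
    refine hfc.integral_pos_of_hasCompactSupport_nonneg_nonzero hfs
      (fun x => mul_nonneg hs.monotone.deriv_nonneg hμ.monotone.deriv_nonneg) (x := !₂[b, a]) ?_
    simp [hf, ha, hb]
  have hfU : ∫ x in U, f x = ∫ x, f x := by
    refine setIntegral_eq_integral_of_forall_compl_eq_zero fun x hx => ?_
    have : x 0 ∉ Icc (R / 2) R := fun h => hx ((half_pos hR).trans_le h.1)
    simp [hf, hμ.deriv_eq_zero this]
  have hPU : ∫ x in U, fderiv ℝ (U.indicator w) x v = 0 := by
    rw [setIntegral_eq_integral_of_forall_compl_eq_zero, integral_fderiv_apply_eq_zero hP hPc]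
    intro x hx
    have : U.indicator w =ᶠ[𝓝 x] fun _ => 0 := by
      filter_upwards [hC'.isClosed.isOpen_compl.mem_nhds fun h => hx (hC'U h)] with y hy
      by_cases hyU : y ∈ U
      · rw [indicator_of_mem hyU, hw0 y hyU hy]
      · exact indicator_of_notMem hyU w
    rw [this.fderiv_eq]
    simp
  have hPi : IntegrableOn (fun x => fderiv ℝ (U.indicator w) x v) U :=
    ((hP.continuous_fderiv one_ne_zero).clm_apply
      continuous_const).integrable_of_hasCompactSupport (hPc.fderiv_apply (𝕜 := ℝ) v)
      |>.integrableOn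
  have hcalc : ∫ x in U, deriv s (x 1) * fderiv ℝ k x v = -∫ x, f x := by
    calc _ = ∫ x in U, (fderiv ℝ (U.indicator w) x v - f x) :=
          setIntegral_congr_fun hU.measurableSet fun x hx => by
            simp only [hder x hx, hf]
            ring
      _ = _ := by
          rw [integral_sub hPi (hfc.integrable_of_hasCompactSupport hfs).integrableOn, hPU, hfU,
            zero_sub]
  rw [hcalc]
  exact neg_ne_zero.2 hfpos.ne'

end SmoothStep

/-! ### Finite partitions of unity -/

section Partition

variable {m : ℕ} [NeZero m] {M : Type*} [TopologicalSpace M] [T2Space M] [SigmaCompactSpace M]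
  [ChartedSpace (EuclideanHalfSpace m) M] [IsManifold (𝓡∂ m) ∞ M]

/-- A finite smooth partition of unity on a compact subset of the interior. -/
lemma exists_finite_partition {C : Set M} (hC : IsCompact C) (hCi : C ⊆ (𝓡∂ m).interior M) :
    ∃ (t : Finset M) (Q : t → Set M) (ρ : t → M → ℝ), (∀ i, IsCompact (Q i)) ∧
      (∀ i, Q i ⊆ (interiorChart m (i : M)).source) ∧ (∀ i, ∀ z ∉ Q i, ρ i z = 0) ∧
      (∀ i, ContMDiff (𝓡∂ m) 𝓘(ℝ, ℝ) ∞ (ρ i)) ∧ ∀ z ∈ C, ∑ i, ρ i z = 1 := by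
  have : LocallyCompactSpace M := Manifold.locallyCompact_of_finiteDimensional (𝓡∂ m)
  have hQ : ∀ z ∈ C, ∃ Q : Set M, IsCompact Q ∧ Q ∈ 𝓝 z ∧ Q ⊆ (interiorChart m z).source := by
    intro z hz
    obtain ⟨Q, hQz, hQs, hQc⟩ := local_compact_nhds
      ((interiorChart m z).open_source.mem_nhds (mem_interiorChart_source (hCi hz)))
    exact ⟨Q, hQc, hQz, hQs⟩
  choose! Q hQc hQz hQs using hQ
  obtain ⟨t, htC, hCt⟩ := hC.elim_nhds_subcover (fun z => interior (Q z))
    fun z hz => interior_mem_nhds.2 (hQz z hz)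
  have hC' : C ⊆ ⋃ i : t, interior (Q i) := by
    simpa [iUnion_subtype] using hCt
  obtain ⟨f, hf⟩ := SmoothPartitionOfUnity.exists_isSubordinate (𝓡∂ m) hC.isClosed
    (fun i : t => interior (Q i)) (fun _ => isOpen_interior) hC'
  refine ⟨t, fun i => Q i, fun i => f i, fun i => hQc _ (htC _ i.2), fun i => hQs _ (htC _ i.2),
    fun i z hz => ?_, fun i => (f i).contMDiff, fun z hz => ?_⟩
  · by_contra h
    exact hz (interior_subset (hf i (subset_tsupport _ h)))
  · rw [← finsum_eq_sum_of_fintype]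
    exact f.sum_eq_one hz

end Partition

end EndTheory
end

noncomputable section
namespace EndTheory

set_option linter.unusedSectionVars false

open Set Topology Filter MeasureTheory

/-! ### Connectedness at infinity on surfaces -/

section Surface

variable {M : Type*} [TopologicalSpace M] [T2Space M] [SecondCountableTopology M]
  [ChartedSpace (EuclideanHalfSpace 2) M] [IsManifold (𝓡∂ 2) ∞ M]
  {o : ∀ x : M, Orientation ℝ (TangentSpace (𝓡∂ 2) x) (Fin 2)} {Φ : EuclideanHalfSpace 2 → M}

/-- In strip coordinates `dF ∧ dh = s'(x₁) dx₁ ∧ dh`, with coefficient `-s'(x₁) ∂₀h`, wherever `dh`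
does not vanish. The chart sign is constant on the connected half-plane, so the integral is a
nonzero constant times the one of `integral_deriv_mul_fderiv_ne_zero`. -/
lemma IsSmoothProperEmbedding.formIntegral_chart_ne_zero (ho : IsManifoldOrientation 2 o)
    (hΦ : IsSmoothProperEmbedding 2 2 Φ) {R : ℝ} (hR : 0 < R) {s : ℝ → ℝ}
    (hs : IsSmoothStep s (-R) R) {F h : M → ℝ} (hh : ContMDiff (𝓡∂ 2) 𝓘(ℝ, ℝ) ∞ h)
    {L : Set M} (hL : IsCompact L) (hhL : ∀ z ∉ L, h z = 0)
    (hh1 : ∀ p : EuclideanHalfSpace 2, p.1 0 ≤ R → p.1 1 ∈ Icc (-R) R → h (Φ p) = 1)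
    (hF : ∀ z ∈ hΦ.chart.source, (∃ c, ∀ᶠ w in 𝓝 z, h w = c) ∨
      ∀ᶠ w in 𝓝 z, F w = s (hΦ.chart w 1)) :
    formIntegral hΦ.chart (chartSign o hΦ.chart) 1 F h ≠ 0 := by
  set e := hΦ.chart
  have he : IsSmoothChart e := hΦ.isSmoothChart_chart
  have htarget : e.target = {x | 0 < x 0} := rfl
  have hsymm : ∀ (x : EuclideanSpace ℝ (Fin 2)) (hx : 0 < x 0), e.symm x = Φ ⟨x, hx.le⟩ :=
    fun x hx => congrArg Φ (halfSpace_symm_coe ⟨x, hx.le⟩)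
  have hσ : ∀ z ∈ e.source, ∀ᶠ w in 𝓝 z, chartSign o e w = chartSign o e z := by
    rintro _ ⟨p, hp, rfl⟩
    exact ho.eventually_chartSign he ⟨p, hp, rfl⟩ (hΦ.mem_interior p)
  have hconn : IsPreconnected e.target := by
    rw [htarget]
    exact (convex_halfSpace_gt
      (EuclideanSpace.proj (𝕜 := ℝ) (0 : Fin 2)).toLinearMap.isLinear _).isPreconnected
  set x₁ : EuclideanSpace ℝ (Fin 2) := EuclideanSpace.single 0 1
  have hx₁ : x₁ ∈ e.target := by
    rw [htarget]
    simp [x₁]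
  have hconst : ∀ x ∈ e.target, chartSign o e (e.symm x) = chartSign o e (e.symm x₁) := by
    intro x hx
    refine e.open_target.is_const_of_fderiv_eq_zero (𝕜 := ℝ) (f := chartSign o e ∘ e.symm) hconn
      (fun y hy => ?_) (fun y hy => ?_) hx hx₁
    · exact ((differentiableAt_const _).congr_of_eventuallyEq
        (eventuallyEq_comp_symm hσ hy)).differentiableWithinAt
    · exact fderiv_comp_symm_eq_zero hy (hσ _ (e.map_target hy))
  set k := h ∘ e.symm
  have hmain := integral_deriv_mul_fderiv_ne_zero hR hs (k := k)
    (he.contDiffOn_comp_symm hh) (C := Subtype.val '' (Φ ⁻¹' L))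
    ((hΦ.isProperMap.isCompact_preimage hL).image continuous_subtype_val)
    (fun x hx hxC => by
      change h (e.symm x) = 0
      rw [hsymm x hx]
      exact hhL _ fun hL => hxC ⟨_, hL, rfl⟩)
    (fun x hx hx0 hx1 => by
      change h (e.symm x) = 1
      rw [hsymm x hx]
      exact hh1 _ hx0 hx1)
  have hpt : ∀ x ∈ e.target, formIntegrand e (chartSign o e) 1 F h x =
      -chartSign o e (e.symm x₁) *
        (deriv s (x 1) * fderiv ℝ k x (EuclideanSpace.single 0 1)) := by
    intro x hx
    rcases hF _ (e.map_target hx) with ⟨c, hc⟩ | hc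
    · rw [formIntegrand_eq_zero hx (Or.inr (Or.inr ⟨c, hc⟩)), fderiv_comp_symm_eq_zero hx hc]
      simp
    · have h1 : F ∘ e.symm =ᶠ[𝓝 x] s ∘ fun y : EuclideanSpace ℝ (Fin 2) => y 1 := by
        filter_upwards [(e.symm.continuousAt hx).eventually hc, e.open_target.mem_nhds hx]
          with y hy hyt
        change F (e.symm y) = s (y 1)
        rw [hy, e.right_inv hyt]
      have h2 : HasFDerivAt (s ∘ fun y : EuclideanSpace ℝ (Fin 2) => y 1) _ x :=
        (hs.contDiff.differentiable (by simp) (x 1)).hasDerivAt.comp_hasFDerivAt x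
          (EuclideanSpace.proj (𝕜 := ℝ) (1 : Fin 2)).hasFDerivAt
      rw [formIntegrand, (h2.congr_of_eventuallyEq h1).fderiv, hconst x hx]
      simp [wedge, k]
  rw [formIntegral, setIntegral_congr_fun e.open_target.measurableSet hpt, integral_const_mul]
  exact mul_ne_zero (neg_ne_zero.2 (he.chartSign_ne_zero (e.map_target hx₁))) hmain

/-- On an oriented surface, the step function across the strip parametrized by `Φ` does not extend
to a function that is locally constant outside of the strip and a compact set. -/
theorem IsSmoothProperEmbedding.false_of_locally_constant (ho : IsManifoldOrientation 2 o)
    (hΦ : IsSmoothProperEmbedding 2 2 Φ) {K : Set M} (hK : IsCompact K)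
    (hKb : (𝓡∂ 2).boundary M ⊆ K) {R : ℝ} (hR : 0 < R)
    (hbox : ∀ p : EuclideanHalfSpace 2, p.1 0 ≤ R → p.1 1 ∈ Icc (-R) R → Φ p ∈ K)
    {s : ℝ → ℝ} (hs : IsSmoothStep s (-R) R) {F₀ : M → ℝ}
    (hFΦ : ∀ z ∈ hΦ.chart.source, F₀ z = s (hΦ.chart z 1))
    (hloc : ∀ z ∉ hΦ.chart.source, z ∉ K → ∃ c, ∀ᶠ w in 𝓝 z, F₀ w = c) : False := by
  have : LocallyCompactSpace M := Manifold.locallyCompact_of_finiteDimensional (𝓡∂ 2)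
  obtain ⟨L₁, hL₁, hKL₁⟩ := exists_compact_superset hK
  obtain ⟨L₂, hL₂, hL₁₂⟩ := exists_compact_superset hL₁
  obtain ⟨h, hh1, hh0, -⟩ := exists_contMDiffMap_one_nhds_of_subset_interior (𝓡∂ 2) (n := ⊤)
    hK.isClosed hKL₁
  set V := interior {z | h z = 1}
  have hKV : K ⊆ V := subset_interior_iff_mem_nhdsSet.2 hh1
  have hV1 : ∀ z ∈ V, ∀ᶠ w in 𝓝 z, h w = 1 := fun z hz => mem_interior_iff_mem_nhds.1 hz
  obtain ⟨χ, hχ0, hχ1, -⟩ := exists_contMDiffMap_zero_one_nhds_of_isClosed (𝓡∂ 2) (n := ⊤)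
    (s := Vᶜ) (t := K) isOpen_interior.isClosed_compl hK.isClosed
    (disjoint_compl_left_iff_subset.2 hKV)
  obtain ⟨W, hW, hKW, hWV⟩ := normal_exists_closure_subset hK.isClosed isOpen_interior hKV
  have hχ0' : ∀ z ∉ V, ∀ᶠ w in 𝓝 z, χ w = 0 := fun z hz =>
    eventually_nhdsSet_iff_forall.1 hχ0 z hz
  have hχ1' : ∀ z ∈ K, ∀ᶠ w in 𝓝 z, χ w = 1 := fun z hz =>
    eventually_nhdsSet_iff_forall.1 hχ1 z hz
  -- Nothing is known about `F₀` along `K` outside the strip. The cutoff makes `F` smooth there, and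
  -- it changes `F₀` only where `h = 1`, so it does not affect `dF ∧ dh`.
  set F : M → ℝ := fun z => (1 - χ z) * F₀ z with hF
  have hFV : ∀ z ∉ V, ∀ᶠ w in 𝓝 z, F w = F₀ w := fun z hz => by
    filter_upwards [hχ0' z hz] with w hw
    simp [hF, hw]
  have hFsmooth : ContMDiff (𝓡∂ 2) 𝓘(ℝ, ℝ) ∞ F := by
    intro z
    by_cases hzK : z ∈ K
    · refine (contMDiffAt_const (c := (0 : ℝ))).congr_of_eventuallyEq ?_
      filter_upwards [hχ1' z hzK] with w hw
      simp [hF, hw]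
    · have h1 : ContMDiffAt (𝓡∂ 2) 𝓘(ℝ, ℝ) ∞ F₀ z := by
        by_cases hzO : z ∈ hΦ.chart.source
        · have h2 : ContMDiffAt (𝓡∂ 2) 𝓘(ℝ, ℝ) ∞
              ((s ∘ fun x : EuclideanSpace ℝ (Fin 2) => x 1) ∘ hΦ.chart) z :=
            (hs.contDiff.comp
              (EuclideanSpace.proj (𝕜 := ℝ) (1 : Fin 2)).contDiff).contMDiff.contMDiffAt.comp z
              (hΦ.isSmoothChart_chart.contMDiffOn.contMDiffAt
                (hΦ.chart.open_source.mem_nhds hzO))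
          refine h2.congr_of_eventuallyEq ?_
          filter_upwards [hΦ.chart.open_source.mem_nhds hzO] with w hw using hFΦ w hw
        · obtain ⟨c, hc⟩ := hloc z hzO hzK
          exact contMDiffAt_const.congr_of_eventuallyEq hc
      exact (contMDiffAt_const.sub χ.contMDiff.contMDiffAt).mul h1
  -- On `W` the function `h` is constant, so the partition of unity is needed only off `W`. This
  -- avoids the boundary of `M`, which lies in `K ⊆ W`.
  have hCi : L₂ \ W ⊆ (𝓡∂ 2).interior M := fun z hz => by
    rw [← ModelWithCorners.compl_boundary]
    exact fun hb => hz.2 (hKW (hKb hb))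
  obtain ⟨t, Q, ρ, hQ, hQe, hρ0, hρ, hρ1⟩ := exists_finite_partition (hL₂.diff hW) hCi
  have hcov : ∀ z, (∃ c, ∀ᶠ w in 𝓝 z, h w = c) ∨ ∀ᶠ w in 𝓝 z, ∑ i, ρ i w = 1 := by
    intro z
    by_cases hzW : z ∈ closure W
    · exact Or.inl ⟨1, hV1 z (hWV hzW)⟩
    by_cases hzL : z ∈ interior L₂
    · right
      filter_upwards [isOpen_interior.mem_nhds hzL, isClosed_closure.isOpen_compl.mem_nhds hzW]
        with w hw hw' using hρ1 w ⟨interior_subset hw, fun h => hw' (subset_closure h)⟩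
    · refine Or.inl ⟨0, ?_⟩
      filter_upwards [hL₁.isClosed.isOpen_compl.mem_nhds fun h => hzL (hL₁₂ h)] with w hw
        using hh0 w hw
  have hchart := fun i : t => isSmoothChart_interiorChart (m := 2) (i : M)
  refine hΦ.formIntegral_chart_ne_zero (F := F) (h := h) ho hR hs h.contMDiff hL₁ hh0
    (fun p hp hp' => hh1.self_of_nhdsSet _ (hbox p hp hp')) (fun z hz => ?_) ?_
  · by_cases hzV : z ∈ V
    · exact Or.inl ⟨1, hV1 z hzV⟩
    · right
      filter_upwards [hFV z hzV, hΦ.chart.open_source.mem_nhds hz] with w hw hw'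
      rw [hw, hFΦ w hw']
  · refine formIntegral_one_eq_zero_of_cover (e := fun i : t => interiorChart 2 (i : M))
      (σ := fun i => chartSign o (interiorChart 2 (i : M))) (ρ := ρ) hQ hQe hρ0
      (fun i z hz => ho.eventually_chartSign_interiorChart _ hz)
      (fun i j => (hchart i).isOrientedTransition (hchart j))
      (fun i j => (hchart i).contDiffOn_comp_symm (hρ j))
      (fun i => (hchart i).contDiffOn_comp_symm hFsmooth)
      (fun i => (hchart i).contDiffOn_comp_symm h.contMDiff) hcov ?_
      (fun i => (hchart i).isOrientedTransition hΦ.isSmoothChart_chart)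
      (fun j => hΦ.isSmoothChart_chart.contDiffOn_comp_symm (hρ j))
      (hΦ.isSmoothChart_chart.contDiffOn_comp_symm hFsmooth)
      (hΦ.isSmoothChart_chart.contDiffOn_comp_symm h.contMDiff) (fun z hz => ?_)
    · rintro _ ⟨p, hp, rfl⟩
      exact ho.eventually_chartSign hΦ.isSmoothChart_chart ⟨p, hp, rfl⟩ (hΦ.mem_interior p)
    · by_cases hzV : z ∈ V
      · exact Or.inr ⟨1, hV1 z hzV⟩
      · obtain ⟨c, hc⟩ := hloc z hz fun h => hzV (hKV h)
        refine Or.inl ⟨c, ?_⟩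
        filter_upwards [hFV z hzV, hc] with w hw hw'
        rw [hw, hw']

lemma mem_connectedComponentIn_of_isPreconnected {X : Type*} [TopologicalSpace X]
    {F C : Set X} {a z w : X} (hC : IsPreconnected C) (hCF : C ⊆ F) (hz : z ∈ C) (hw : w ∈ C)
    (hza : z ∈ connectedComponentIn F a) : w ∈ connectedComponentIn F a := by
  rw [connectedComponentIn_eq hza]
  exact hC.subset_connectedComponentIn hz hCF hw

/-- Components of the complement of a closed set in a locally connected subspace are relatively
clopen. -/
lemma exists_nhds_forall_mem_connectedComponentIn_iff {X : Type*} [TopologicalSpace X]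
    {A K : Set X} [LocallyConnectedSpace A] (hK : IsClosed K) (a : X) {z : X} (hz : z ∈ A \ K) :
    ∃ U ∈ 𝓝 z, ∀ w ∈ U, w ∈ A →
      (w ∈ connectedComponentIn (A \ K) a ↔ z ∈ connectedComponentIn (A \ K) a) := by
  obtain ⟨C, hC, hCc, hCK⟩ := locallyConnectedSpace_iff_connected_subsets.1
    (inferInstanceAs (LocallyConnectedSpace A)) (⟨z, hz.1⟩ : A) (Subtype.val ⁻¹' Kᶜ)
    ((hK.isOpen_compl.preimage continuous_subtype_val).mem_nhds hz.2)
  rw [nhds_subtype, mem_comap] at hC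
  obtain ⟨U, hU, hUC⟩ := hC
  have hpre : IsPreconnected (Subtype.val '' C) :=
    hCc.image _ continuous_subtype_val.continuousOn
  have hsub : Subtype.val '' C ⊆ A \ K := by
    rintro _ ⟨w, hw, rfl⟩
    exact ⟨w.2, hCK hw⟩
  have hzC : z ∈ Subtype.val '' C := ⟨⟨z, hz.1⟩, hUC (show z ∈ U from mem_of_mem_nhds hU), rfl⟩
  refine ⟨U, hU, fun w hw hwA => ?_⟩
  have hwC : w ∈ Subtype.val '' C := ⟨⟨w, hwA⟩, hUC hw, rfl⟩
  exact ⟨mem_connectedComponentIn_of_isPreconnected hpre hsub hwC hzC,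
    mem_connectedComponentIn_of_isPreconnected hpre hsub hzC hwC⟩

/-- The seam is a line, and outside a compact set it consists of a left and a right ray. If they lay
in different components of the hat minus a compact set, a step across the strip would extend to a
function that is locally constant elsewhere, which `false_of_locally_constant` excludes. -/
theorem IsSmoothProperEmbedding.isConnectedAtInfinity_one (ho : IsManifoldOrientation 2 o)
    (hb : IsCompact ((𝓡∂ 2).boundary M)) (hΦ : IsSmoothProperEmbedding 2 2 Φ) :
    IsConnectedAtInfinity 1 Φ := by
  intro K₀ hK₀
  have hΦc := hΦ.isProperMap.continuous
  -- enlarge the compact set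
  obtain ⟨R, hR, hKR⟩ : ∃ R > 0, ∀ p, Φ p ∈ K₀ ∪ (𝓡∂ 2).boundary M → ‖p.1‖ ≤ R := by
    obtain ⟨R, hR⟩ := ((hΦ.isProperMap.isCompact_preimage (hK₀.union hb)).image
      continuous_subtype_val).isBounded.exists_pos_norm_le
    exact ⟨R, hR.1, fun p hp => hR.2 _ ⟨p, hp, rfl⟩⟩
  -- Adding the box `Φ '' B` to the compact set forces `h = 1` on the left end of the strip where
  -- `s` varies, and it covers the seam points with coordinate in `[-R, R]`, at which the function
  -- below jumps.
  set B : Set (EuclideanHalfSpace 2) := {p | p.1 0 ∈ Icc 0 R ∧ p.1 1 ∈ Icc (-R) R}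
  have hB : IsCompact B := isClosedEmbedding_halfSpace_val.isCompact_preimage (isCompact_box _ _ _ _)
  set K := (K₀ ∪ (𝓡∂ 2).boundary M) ∪ Φ '' B
  have hK : IsCompact K := (hK₀.union hb).union (hB.image hΦc)
  have hKΦ : ∀ p, Φ p ∈ K → p.1 1 ∈ Icc (-R) R := by
    rintro p (hp | ⟨q, hq, hqp⟩)
    · exact abs_le.1 ((PiLp.norm_apply_le p.1 1).trans (hKR p hp))
    · rw [← hΦ.injective hqp]
      exact hq.2
  have : LocallyConnectedSpace M := ChartedSpace.locallyConnectedSpace (EuclideanHalfSpace 2) M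
  have : LocallyConnectedSpace (hat 1 Φ) := hΦ.locallyConnectedSpace_compl
  set α : EuclideanSpace ℝ (Fin 1) → M := fun y => Φ (bdry 1 y)
  have hα : Continuous α := hΦc.comp isClosedEmbedding_bdry.continuous
  have hαF : ∀ y, y 0 ∉ Icc (-R) R → α y ∈ hat 1 Φ \ K := fun y hy =>
    ⟨hΦ.bdry_mem_hat y, fun h => hy (hKΦ _ h)⟩
  have hlin : IsLinearMap ℝ fun y : EuclideanSpace ℝ (Fin 1) => y 0 :=
    (EuclideanSpace.proj (𝕜 := ℝ) (0 : Fin 1)).toLinearMap.isLinear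
  have hright : IsPreconnected (α '' {y | R < y 0}) :=
    (convex_halfSpace_gt hlin R).isPreconnected.image _ hα.continuousOn
  have hleft : IsPreconnected (α '' {y | y 0 < -R}) :=
    (convex_halfSpace_lt hlin (-R)).isPreconnected.image _ hα.continuousOn
  have hrightF : α '' {y | R < y 0} ⊆ hat 1 Φ \ K := by
    rintro _ ⟨y, hy, rfl⟩
    exact hαF y fun h => not_lt.2 h.2 hy
  have hleftF : α '' {y | y 0 < -R} ⊆ hat 1 Φ \ K := by
    rintro _ ⟨y, hy, rfl⟩
    exact hαF y fun h => not_lt.2 h.1 hy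
  set a : M := α (EuclideanSpace.single 0 (R + 1))
  have ha : a ∈ α '' {y | R < y 0} := ⟨_, by simp, rfl⟩
  set A := connectedComponentIn (hat 1 Φ \ K) a
  have hrightA : α '' {y | R < y 0} ⊆ A := hright.subset_connectedComponentIn ha hrightF
  have hleftA : α '' {y | y 0 < -R} ⊆ A := by
    by_contra hnot
    have hdisj : ∀ z ∈ α '' {y | y 0 < -R}, z ∉ A := fun z hz hzA => hnot fun w hw =>
      mem_connectedComponentIn_of_isPreconnected hleft hleftF hz hw hzA
    obtain ⟨s, hs⟩ := exists_isSmoothStep (neg_lt_self hR)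
    classical
    set F₀ : M → ℝ := fun z =>
      if z ∈ hΦ.chart.source then s (hΦ.chart z 1) else if z ∈ A then 1 else 0 with hF₀
    have hsource : ∀ z, z ∉ hΦ.chart.source ↔ z ∈ hat 1 Φ := fun z => Iff.rfl
    have hFp : ∀ p : EuclideanHalfSpace 2, Φ p ∈ hΦ.chart.source → F₀ (Φ p) = s (p.1 1) := by
      intro p hp
      have : hΦ.chart (Φ p) = p.1 :=
        congrArg Subtype.val (Function.leftInverse_invFun hΦ.injective p)
      simp only [hF₀, if_pos hp, this]
    -- Points of the neighborhood close to a seam point with coordinate below `-R` or above `R` have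
    -- their transverse coordinate in the same range. There `s` is 0 or 1, which matches the value
    -- of `F₀` on the adjacent component.
    have hfront : ∀ {S : Set ℝ}, IsClosed S → ∀ y : EuclideanSpace ℝ (Fin 1), y 0 ∉ S →
        ∀ᶠ w in 𝓝 (α y), ∀ p, Φ p = w → p.1 1 ∉ S := by
      intro S hS y hy
      have hclosed : IsClosed (Φ '' {p | p.1 1 ∈ S}) := hΦ.isClosedEmbedding.isClosedMap _
        (hS.preimage ((EuclideanSpace.proj (𝕜 := ℝ) (1 : Fin 2)).continuous.comp
          continuous_subtype_val))
      filter_upwards [hclosed.isOpen_compl.mem_nhds (x := α y) (by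
        rintro ⟨p, hp, hpy⟩
        rw [hΦ.injective hpy] at hp
        exact hy hp)] with w hw p hpw hpS using hw ⟨p, hpS, hpw⟩
    refine hΦ.false_of_locally_constant ho hK
      (subset_union_right.trans subset_union_left) hR
      (fun p hp hp' => Or.inr ⟨p, ⟨⟨p.2, hp⟩, hp'⟩, rfl⟩) hs (F₀ := F₀)
      (fun z hz => by simp only [hF₀, if_pos hz]) fun z hz hzK => ?_
    obtain ⟨U, hU, hUA⟩ := exists_nhds_forall_mem_connectedComponentIn_iff hK.isClosed a
      (A := hat 1 Φ) ⟨hz, hzK⟩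
    -- Local constancy has to be checked across the seam, where the values on both sides must match,
    -- and away from the neighborhood, where `F₀` is the indicator of a relatively clopen component.
    by_cases hzΦ : z ∈ range Φ
    · have hzr : z ∈ hat 1 Φ ∩ range Φ := ⟨hz, hzΦ⟩
      rw [hΦ.hat_inter_range] at hzr
      obtain ⟨y, rfl⟩ := hzr
      have hy : y 0 < -R ∨ R < y 0 := by
        by_contra! h
        exact hzK (Or.inr ⟨bdry 1 y, ⟨⟨le_rfl, hR.le⟩, h⟩, rfl⟩)
      rcases hy with hy | hy
      · refine ⟨0, ?_⟩
        filter_upwards [hU, hfront (S := Ici (-R)) isClosed_Ici y (not_le.2 hy)] with w hw hw'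
        by_cases hwO : w ∈ hΦ.chart.source
        · obtain ⟨p, -, rfl⟩ := id hwO
          rw [hFp p hwO]
          exact hs.eq_zero _ (not_le.1 (hw' p rfl)).le
        · have : w ∉ A := fun h => hdisj (α y) ⟨y, hy, rfl⟩ ((hUA w hw hwO).1 h)
          simp only [hF₀, if_neg hwO, if_neg this]
      · refine ⟨1, ?_⟩
        filter_upwards [hU, hfront (S := Iic R) isClosed_Iic y (not_le.2 hy)] with w hw hw'
        by_cases hwO : w ∈ hΦ.chart.source
        · obtain ⟨p, -, rfl⟩ := id hwO
          rw [hFp p hwO]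
          exact hs.eq_one _ (not_le.1 (hw' p rfl)).le
        · have : w ∈ A := (hUA w hw hwO).2 (hrightA ⟨y, hy, rfl⟩)
          simp only [hF₀, if_neg hwO, if_pos this]
    · refine ⟨F₀ z, ?_⟩
      filter_upwards [hU, hΦ.isClosedEmbedding.isClosed_range.isOpen_compl.mem_nhds hzΦ]
        with w hw hw'
      have hwO : w ∉ hΦ.chart.source := fun ⟨p, _, hp⟩ => hw' ⟨p, hp⟩
      simp only [hF₀, if_neg hwO, if_neg hz]
      exact if_congr (hUA w hw hwO) rfl rfl
  have hmemA : ∀ y, y 0 ∉ Icc (-R) R → α y ∈ A := fun y hy => by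
    rcases lt_or_ge (y 0) (-R) with h | h
    · exact hleftA ⟨y, h, rfl⟩
    · exact hrightA ⟨y, not_le.1 fun h' => hy ⟨h, h'⟩, rfl⟩
  refine ⟨{y | y 0 ∈ Icc (-R) R}, ?_, fun y hy y' hy' =>
    ⟨A, (connectedComponentIn_subset _ _).trans
      (sdiff_subset_sdiff_right (subset_union_left.trans subset_union_left)),
      isPreconnected_connectedComponentIn, ?_, ?_⟩⟩
  · have h := (EuclideanSpace.equiv (Fin 1) ℝ).toHomeomorph.isCompact_preimage.2
      (isCompact_univ_pi (X := fun _ : Fin 1 => ℝ) (s := fun _ => Icc (-R) R)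
        fun _ => isCompact_Icc)
    convert h using 1
    ext x
    simp only [mem_preimage, mem_univ_pi, Fin.forall_fin_one]
    rfl
  · exact hmemA y hy
  · exact hmemA y' hy'

end Surface

end EndTheory
end

noncomputable section
namespace EndTheory

/-- The seam at infinity is connected by itself for n ≥ 2. For n = 1 the orientation and the compact
boundary take over through Stokes' theorem. -/
lemma IsEndSumPair.isConnectedAtInfinity {n : ℕ} (hn : 1 ≤ n)
    {M : Type*} [TopologicalSpace M] [ChartedSpace (EuclideanHalfSpace (n + 1)) M]
    [IsManifold (𝓡∂ (n + 1)) ∞ M]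
    {o : ∀ x : M, Orientation ℝ (TangentSpace (𝓡∂ (n + 1)) x) (Fin (n + 1))}
    {r : EuclideanHalfSpace 1 → M} (hM : IsEndSumPair n o r)
    {Φ : EuclideanHalfSpace (n + 1) → M} (hΦ : IsSmoothProperEmbedding (n + 1) (n + 1) Φ) :
    IsConnectedAtInfinity n Φ := by
  rcases hn.eq_or_lt with rfl | hn
  · have := hM.t2Space
    have := hM.secondCountable
    exact hΦ.isConnectedAtInfinity_one hM.oriented hM.compact_boundary
  · exact hΦ.isConnectedAtInfinity_of_two_le hn

end EndTheory
end

theorem mainTheorem12 (n : ℕ) (hn : 1 ≤ n)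
    {M : Type*} [TopologicalSpace M] [ChartedSpace (EuclideanHalfSpace (n + 1)) M]
    [IsManifold (𝓡∂ (n + 1)) ∞ M]
    {N : Type*} [TopologicalSpace N] [ChartedSpace (EuclideanHalfSpace (n + 1)) N]
    [IsManifold (𝓡∂ (n + 1)) ∞ N]
    (oM : ∀ x : M, Orientation ℝ (TangentSpace (𝓡∂ (n + 1)) x) (Fin (n + 1)))
    (oN : ∀ x : N, Orientation ℝ (TangentSpace (𝓡∂ (n + 1)) x) (Fin (n + 1)))
    (r : EuclideanHalfSpace 1 → M) (s : EuclideanHalfSpace 1 → N)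
    (hM : EndTheory.IsEndSumPair n oM r) (hN : EndTheory.IsEndSumPair n oN s)
    (Φ : EuclideanHalfSpace (n + 1) → M) (hΦ : EndTheory.IsRegularNeighborhood n r Φ)
    (Ψ : EuclideanHalfSpace (n + 1) → N) (hΨ : EndTheory.IsRegularNeighborhood n s Ψ)
    (g : EuclideanSpace ℝ (Fin n) ≃ₘ^∞⟮𝓡 n, 𝓡 n⟯ EuclideanSpace ℝ (Fin n))
    (hg : EndTheory.ReversesOrientation n oM oN Φ Ψ g) :
    Nonempty (CompactExhaustion (EndTheory.EndSum n Φ Ψ g)) ∧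
    ∀ (KM : CompactExhaustion M) (KN : CompactExhaustion N)
      (KS : CompactExhaustion (EndTheory.EndSum n Φ Ψ g)),
      EndTheory.numEnds KS + 1 = EndTheory.numEnds KM + EndTheory.numEnds KN ∧
      (EndTheory.numEnds KM = 1 → EndTheory.numEnds KN = 1 → EndTheory.numEnds KS = 1) := by
  have := hM.t2Space
  have := hM.secondCountable
  have := hM.connected
  have := hN.t2Space
  have := hN.secondCountable
  have := hN.connected
  obtain ⟨h1, h2⟩ := EndTheory.numEnds_endSum hn hΦ.embedding hΨ.embedding
    (hM.isConnectedAtInfinity hn hΦ.embedding) (hN.isConnectedAtInfinity hn hΨ.embedding)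
    g.toHomeomorph
  refine ⟨h1, fun KM KN KS => ⟨h2 KM KN KS, fun hKM hKN => ?_⟩⟩
  have h := h2 KM KN KS
  rw [hKM, hKN] at h
  exact WithTop.add_right_cancel ENat.one_ne_top h
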